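/- Let $0<q<1$ and write $[x]_q=\frac{q^{x}-q^{-x}}{q-q^{-1}}$. Let $\mathcal A=\mathcal O(S^2_q)$ be the coordinate algebra of the standard Podleś sphere, i.e. the unital $*$-algebra over $\mathbb C$ with generators $A=A^*$, $B$, $B^*$ and relations $$BA=q^2AB,\quad AB^*=q^2B^*A,\quad B^*B=A-A^2,\quad BB^*=q^2A-q^4A^2,$$ and let $\varepsilon:\mathcal A\to\mathbb C$ be the character with $\varepsilon(A)=\varepsilon(B)=\varepsilon(B^*)=0$. Let $\mathcal H_\pm$ be the Hilbert spaces with orthonormal bases $v^l_{k,\pm}$, $l=\frac12,\frac32,\dots$, $k=-l,-l+1,\dots,l$ (vectors with inadmissible indices are read as $0$). On their linear span put $$Kv^l_{k,\pm}=q^kv^l_{k,\pm},\quad |D|v^l_{k,\pm}=[l+\tfrac12]_q\,v^l_{k,\pm},\quad Ev^l_{k,\pm}=([l-k]_q[l+k+1]_q)^{1/2}v^l_{k+1,\pm},\quad Fv^l_{k,\pm}=([l-k+1]_q[l+k]_q)^{1/2}v^l_{k-1,\pm}.$$ $\mathcal A$ acts on $\mathcal H_\pm$ by the (bounded) representation of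 the Dąbrowski–Sitarz spectral triple: with $x_0=1-(1+q^2)A$, $x_{-1}=(1+q^{-2})^{1/2}B$, $x_1=-(1+q^2)^{1/2}B^*$, $$x_0v^l_{k,\pm}=\alpha^-(l,k)_\pm v^{l-1}_{k,\pm}+\alpha^0(l,k)_\pm v^l_{k,\pm}+\alpha^-(l+1,k)_\pm v^{l+1}_{k,\pm},$$ $$\alpha^-(l,k)_\pm=\frac{q^{k\pm1/2}[2]_q\,[l-k]_q^{1/2}[l+k]_q^{1/2}[l-\frac12]_q^{1/2}[l+\frac12]_q^{1/2}}{[2l-1]_q^{1/2}[2l]_q[2l+1]_q^{1/2}}\quad (\text{and } \alpha^-(\tfrac12,k)_\pm=0),$$ $$\alpha^0(l,k)_\pm=\frac{[l-k+1]_q[l+k]_q-q^2[l-k]_q[l+k+1]_q}{[2l]_q}\cdot\frac{\pm q^{\mp1}+(q-q^{-1})([\frac12]_q[\frac32]_q-[l]_q[l+1]_q)}{q[2l+2]_q},$$ and $x_1=[2]_q^{-1/2}(Ex_0-x_0E)K^{-1}$, $x_{-1}=[2]_q^{-1/2}(Fx_0-x_0F)K^{-1}$. Let $\mu\in\mathbb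 R$. For every $a\in\mathcal A$ and both signs, the operator $aK^{2\mu}|D|^{-z}$ on $\mathcal H_\pm$ (more precisely, its closure) is of trace class for $\operatorname{Re}z>2|\mu|$, the function $$\zeta^\pm_{aK^{2\mu}}(z)=\operatorname{tr}_{\mathcal H_\pm}(aK^{2\mu}|D|^{-z})$$ is holomorphic on $\{\operatorname{Re}z>2|\mu|\}$ and has a meromorphic continuation to $\{\operatorname{Re}z>2|\mu|-1\}$. Its residue at $z=2|\mu|$ is linear in $a$ and, both for $+$ and for $-$, is given by: - $0$ for $a=A^nB^m$ and $a=A^nB^{*m}$ with $n\ge0$, $m>0$ and any $\mu$; - $0$ for $a=A^n$ with $n>0$ and $\mu<0$; - $\dfrac{-q^{\mu}(q^{-1}-q)^{2\mu}}{(1-q^{2(n+\mu)})\ln q}$ for $a=A^n$ with $n>0$ and $\mu\ge0$; - $\dfrac{-q^{|\mu|}(q^{-1}-q)^{2|\mu|}}{(1-q^{2|\mu|})\ln q}$ for $a=1$ and $\mu\ne0$; - $\dfrac{2\ln(q^{-1}-q)}{(\ln q)^2}$ for $a=1$ and $\mu=0$. Consequently, put $\operatorname{tr}_{\mathcal H}=\operatorname{tr}_{\mathcal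 H_+}+\operatorname{tr}_{\mathcal H_-}$ and assume that $\mu\neq0$ or $q^{-1}-q\neq1$. Then $\operatorname{Res}_{z=2|\mu|}\operatorname{tr}_{\mathcal H}(K^{2\mu}|D|^{-z})\ne0$, and $$\tau_\mu(a)=\frac{\operatorname{Res}_{z=2|\mu|}\operatorname{tr}_{\mathcal H}(aK^{2\mu}|D|^{-z})}{\operatorname{Res}_{z=2|\mu|}\operatorname{tr}_{\mathcal H}(K^{2\mu}|D|^{-z})}$$ defines a linear functional on $\mathcal A$ with $\tau_\mu(1)=1$ and $\tau_\mu(A^nB^m)=\tau_\mu(A^nB^{*m})=0$ for $n\ge0$, $m>0$, such that: - if $\mu<0$, then $\tau_\mu=\varepsilon$, and $\tau_\mu(ab)=\tau_\mu(\sigma(b)a)$ for all $a,b\in\mathcal A$ and every algebra automorphism $\sigma$ of $\mathcal A$; - if $\mu\ge0$, then $\tau_\mu(ab)=\tau_\mu(\sigma(b)a)$ for all $a,b\in\mathcal A$, where $\sigma$ is the automorphism with $\sigma(A)=A$, $\sigma(B)=q^{2\mu}B$, $\sigma(B^*)=q^{-2\mu}B^*$; moreover, for $n>0$, $\tau_\mu(A^n)=\dfrac{1-q^{2\mu}}{1-q^{2(n+\mu)}}$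 if $\mu>0$, and $\tau_0(A^n)=\dfrac{-\ln q}{2(1-q^{2n})\ln(q^{-1}-q)}$. -/

import Mathlib

noncomputable section

namespace Podles

open scoped Topology

set_option linter.unusedVariables false
set_option linter.unusedSimpArgs false

/-! ### The coordinate algebra of the standard Podleś sphere -/

/-- The generators `A`, `B`, `B*`. -/
inductive Gen : Type
  | A
  | B
  | Bs

/-- The free algebra generator attached to a symbol. -/
def gen (g : Gen) : FreeAlgebra ℂ Gen := FreeAlgebra.ι ℂ g

/-- The defining relations
`B A = q² A B`, `A B* = q² B* A`, `B* B = A - A²`, `B B* = q² A - q⁴ A²`.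
This set of relations is stable under the involution `A* = A`, `(B)* = B*`, so the algebra
presented by it is the algebra underlying the `*`-algebra generated by `A = A*`, `B`, `B*`. -/
inductive Rel (q : ℝ) : FreeAlgebra ℂ Gen → FreeAlgebra ℂ Gen → Prop
  | BA : Rel q (gen .B * gen .A) (((q : ℂ) ^ 2) • (gen .A * gen .B))
  | ABs : Rel q (gen .A * gen .Bs) (((q : ℂ) ^ 2) • (gen .Bs * gen .A))
  | BsB : Rel q (gen .Bs * gen .B) (gen .A - gen .A ^ 2)
  | BBs : Rel q (gen .B * gen .Bs) (((q : ℂ) ^ 2) • gen .A - ((q : ℂ) ^ 4) • gen .A ^ 2)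

/-- The coordinate algebra `𝒪(S²_q)` over `ℂ`. -/
abbrev Sphere (q : ℝ) : Type := RingQuot (Rel q)

/-- The generator `A` of `𝒪(S²_q)`. -/
def genA (q : ℝ) : Sphere q := RingQuot.mkAlgHom ℂ (Rel q) (gen .A)

/-- The generator `B` of `𝒪(S²_q)`. -/
def genB (q : ℝ) : Sphere q := RingQuot.mkAlgHom ℂ (Rel q) (gen .B)

/-- The generator `B*` of `𝒪(S²_q)`. -/
def genBs (q : ℝ) : Sphere q := RingQuot.mkAlgHom ℂ (Rel q) (gen .Bs)

/-- A triple of elements of an algebra which satisfies the defining relations yields an algebra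
homomorphism on `𝒪(S²_q)`. -/
def lift (q : ℝ) {R : Type*} [Ring R] [Algebra ℂ R] (a b c : R)
    (h1 : b * a = ((q : ℂ) ^ 2) • (a * b)) (h2 : a * c = ((q : ℂ) ^ 2) • (c * a))
    (h3 : c * b = a - a ^ 2) (h4 : b * c = ((q : ℂ) ^ 2) • a - ((q : ℂ) ^ 4) • a ^ 2) :
    Sphere q →ₐ[ℂ] R :=
  RingQuot.liftAlgHom ℂ ⟨FreeAlgebra.lift ℂ (fun g : Gen => match g with
    | .A => a
    | .B => b
    | .Bs => c), by
      intro x y h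
      cases h <;> simp [gen, h1, h2, h3, h4]⟩

/-- The (restriction of the) counit: the character with `ε(A) = ε(B) = ε(B*) = 0`. -/
def counit (q : ℝ) : Sphere q →ₐ[ℂ] ℂ :=
  lift q 0 0 0 (by simp) (by simp) (by simp) (by simp)

/-! ### The Hilbert spaces `H_±` and the dense domain -/

/-- Labels of the orthonormal basis `v^l_k`, where `l = n + 1/2` with `n : ℕ`, and
`k = j - l` with `0 ≤ j ≤ 2 l = 2 n + 1`. -/
abbrev Idx : Type := Σ n : ℕ, Fin (2 * n + 2)

/-- The weight `l` of a label. -/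
def Idx.l (i : Idx) : ℝ := (i.1 : ℝ) + 1 / 2

/-- The weight `k ∈ {-l, -l + 1, …, l}` of a label. -/
def Idx.k (i : Idx) : ℝ := ((i.2 : ℕ) : ℝ) - i.l

/-- The linear span of the basis vectors `v^l_k`; this is the part of `Dom(D)` in `H_+`,
respectively in `H_-`. -/
abbrev Dom : Type := Idx →₀ ℂ

/-- The Hilbert space with orthonormal basis `v^l_k`, which serves as `H_+` and as `H_-`. -/
abbrev Hilb : Type := lp (fun _ : Idx => ℂ) 2

/-- The inclusion of the span of the basis vectors in the Hilbert space. -/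
def toHilb : Dom →ₗ[ℂ] Hilb :=
  Finsupp.linearCombination ℂ (fun i : Idx => (lp.single 2 i (1 : ℂ) : Hilb))

/-- The vector `v^l_k` for `l = n + 1/2`, `k = j - l`, with the convention that it is `0` if
`(l, k)` is not one of the admissible labels. -/
def vec (n j : ℤ) : Dom :=
  if h : 0 ≤ n ∧ 0 ≤ j ∧ j ≤ 2 * n + 1 then
    Finsupp.single ⟨n.toNat, ⟨j.toNat, by omega⟩⟩ 1
  else 0

/-- The diagonal operator with eigenvalue `c i` on the basis vector with label `i`. -/
def diag (c : Idx → ℂ) : Module.End ℂ Dom :=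
  Finsupp.linearCombination ℂ (fun i : Idx => Finsupp.single i (c i))

/-- The `q`-number `[x]_q = (q^x - q^{-x}) / (q - q^{-1})`. -/
def qnum (q x : ℝ) : ℝ := (q ^ x - q ^ (-x)) / (q - q⁻¹)

/-- `K^t`, with `K v^l_k = q^k v^l_k`. -/
def opK (q t : ℝ) : Module.End ℂ Dom := diag fun i => ((q ^ (t * i.k) : ℝ) : ℂ)

/-- `|D|^w` for complex `w`, where `D v^l_{k,±} = [l + 1/2]_q v^l_{k,∓}`, hence
`|D| v^l_{k,±} = [l + 1/2]_q v^l_{k,±}`. -/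
def opAbsD (q : ℝ) (w : ℂ) : Module.End ℂ Dom :=
  diag fun i => ((qnum q (i.l + 1 / 2) : ℝ) : ℂ) ^ w

/-- `E v^l_k = ([l - k] [l + k + 1])^{1/2} v^l_{k+1}`. -/
def opE (q : ℝ) : Module.End ℂ Dom :=
  Finsupp.linearCombination ℂ fun i : Idx =>
    ((√(qnum q (i.l - i.k) * qnum q (i.l + i.k + 1)) : ℝ) : ℂ) • vec i.1 ((i.2 : ℕ) + 1)

/-- `F v^l_k = ([l - k + 1] [l + k])^{1/2} v^l_{k-1}`. -/
def opF (q : ℝ) : Module.End ℂ Dom :=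
  Finsupp.linearCombination ℂ fun i : Idx =>
    ((√(qnum q (i.l - i.k + 1) * qnum q (i.l + i.k)) : ℝ) : ℂ) • vec i.1 ((i.2 : ℕ) - 1)

/-! ### The representation of `𝒪(S²_q)` on `H_±`; the sign `±` is an element `s` of `ℤˣ` -/

/-- The coefficient `α₀⁻(l, k)_±`. -/
def alphaMinus (q : ℝ) (s : ℤˣ) (l k : ℝ) : ℝ :=
  q ^ (k + ((s : ℤ) : ℝ) / 2) * qnum q 2 * √(qnum q (l - k)) * √(qnum q (l + k)) *
      √(qnum q (l - 1 / 2)) * √(qnum q (l + 1 / 2)) /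
    (√(qnum q (2 * l - 1)) * qnum q (2 * l) * √(qnum q (2 * l + 1)))

/-- The coefficient `β_±(l)`. -/
def beta (q : ℝ) (s : ℤˣ) (l : ℝ) : ℝ :=
  (((s : ℤ) : ℝ) * q ^ (-((s : ℤ) : ℝ)) +
      (q - q⁻¹) * (qnum q (1 / 2) * qnum q (3 / 2) - qnum q l * qnum q (l + 1))) /
    (q * qnum q (2 * l + 2))

/-- The coefficient `α₀⁰(l, k)_±`. -/
def alphaZero (q : ℝ) (s : ℤˣ) (l k : ℝ) : ℝ :=
  (qnum q (2 * l))⁻¹ *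
    (qnum q (l - k + 1) * qnum q (l + k) - q ^ 2 * qnum q (l - k) * qnum q (l + k + 1)) *
    beta q s l

/-- The coefficient `α₀⁺(l, k)_±`. -/
def alphaPlus (q : ℝ) (s : ℤˣ) (l k : ℝ) : ℝ := alphaMinus q s (l + 1) k

/-- The action of `x₀ = 1 - (1 + q²) A`:
`x₀ v^l_k = α₀⁻(l, k) v^{l-1}_k + α₀⁰(l, k) v^l_k + α₀⁺(l, k) v^{l+1}_k`. -/
def opX0 (q : ℝ) (s : ℤˣ) : Module.End ℂ Dom :=
  Finsupp.linearCombination ℂ fun i : Idx =>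
    ((alphaMinus q s i.l i.k : ℝ) : ℂ) • vec ((i.1 : ℤ) - 1) ((i.2 : ℕ) - 1) +
    ((alphaZero q s i.l i.k : ℝ) : ℂ) • vec i.1 (i.2 : ℕ) +
    ((alphaPlus q s i.l i.k : ℝ) : ℂ) • vec ((i.1 : ℤ) + 1) ((i.2 : ℕ) + 1)

/-- The action of `x₁ = -(1 + q²)^{1/2} B*`. It is determined by that of `x₀` through the
equivariance `E x₀ = (E ▷ x₀) K + (K⁻¹ ▷ x₀) E`, where `E ▷ x₀ = [2]^{1/2} x₁` and
`K⁻¹ ▷ x₀ = x₀`. -/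
def opX1 (q : ℝ) (s : ℤˣ) : Module.End ℂ Dom :=
  (((√(qnum q 2))⁻¹ : ℝ) : ℂ) • ((opE q * opX0 q s - opX0 q s * opE q) * opK q (-1))

/-- The action of `x₋₁ = (1 + q⁻²)^{1/2} B`. It is determined by that of `x₀` through the
equivariance `F x₀ = (F ▷ x₀) K + (K⁻¹ ▷ x₀) F`, where `F ▷ x₀ = [2]^{1/2} x₋₁` and
`K⁻¹ ▷ x₀ = x₀`. -/
def opXm1 (q : ℝ) (s : ℤˣ) : Module.End ℂ Dom :=
  (((√(qnum q 2))⁻¹ : ℝ) : ℂ) • ((opF q * opX0 q s - opX0 q s * opF q) * opK q (-1))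

/-- The action of the generator `A` on `H_±`. -/
def opA (q : ℝ) (s : ℤˣ) : Module.End ℂ Dom :=
  (((1 + q ^ 2)⁻¹ : ℝ) : ℂ) • (1 - opX0 q s)

/-- The action of the generator `B` on `H_±`. -/
def opB (q : ℝ) (s : ℤˣ) : Module.End ℂ Dom :=
  (((√(1 + (q ^ 2)⁻¹))⁻¹ : ℝ) : ℂ) • opXm1 q s

/-- The action of the generator `B*` on `H_±`. -/
def opBs (q : ℝ) (s : ℤˣ) : Module.End ℂ Dom :=
  ((-(√(1 + q ^ 2))⁻¹ : ℝ) : ℂ) • opX1 q s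

/-! ### The operators satisfy the defining relations -/

/-- Integer `q`-numbers. -/
def qz (q : ℝ) (m : ℤ) : ℝ := (q ^ m - (q ^ m)⁻¹) / (q - q⁻¹)

/-- The square root of an integer `q`-number. -/
def rz (q : ℝ) (m : ℤ) : ℝ := √(qz q m)

theorem qnum_int (q : ℝ) (m : ℤ) (x : ℝ) (hx : x = m) : qnum q x = qz q m := by
  subst hx
  have h : -(m : ℝ) = ((-m : ℤ) : ℝ) := by push_cast; ring
  rw [qnum, qz, h, Real.rpow_intCast, Real.rpow_intCast, zpow_neg]

theorem sub_inv_neg {q : ℝ} (h0 : 0 < q) (h1 : q < 1) : q - q⁻¹ < 0 := by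
  have : 1 < q⁻¹ := (one_lt_inv₀ h0).2 h1
  linarith

theorem qz_pos {q : ℝ} (h0 : 0 < q) (h1 : q < 1) {m : ℤ} (hm : 0 < m) : 0 < qz q m := by
  apply div_pos_of_neg_of_neg _ (sub_inv_neg h0 h1)
  exact sub_inv_neg (zpow_pos h0 m) (zpow_lt_one₀ h0 h1 hm)

theorem qz_zero (q : ℝ) : qz q 0 = 0 := by simp [qz]

theorem rz_zero (q : ℝ) : rz q 0 = 0 := by simp [rz, qz_zero]

theorem qz_nonneg {q : ℝ} (h0 : 0 < q) (h1 : q < 1) {m : ℤ} (hm : 0 ≤ m) : 0 ≤ qz q m := by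
  rcases hm.eq_or_lt with h | h
  · simp [← h, qz_zero]
  · exact (qz_pos h0 h1 h).le

theorem rz_mul_self {q : ℝ} (h0 : 0 < q) (h1 : q < 1) {m : ℤ} (hm : 0 ≤ m) :
    rz q m * rz q m = qz q m := Real.mul_self_sqrt (qz_nonneg h0 h1 hm)

theorem vec_eq_zero {n j : ℤ} (h : ¬ (0 ≤ n ∧ 0 ≤ j ∧ j ≤ 2 * n + 1)) : vec n j = 0 := by
  rw [vec, dif_neg h]

theorem vec_idx (i : Idx) : vec i.1 (i.2 : ℕ) = Finsupp.single i 1 := by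
  obtain ⟨n, j⟩ := i
  have := j.2
  rw [vec, dif_pos (by simp only; omega)]
  congr 1

theorem exists_idx {n j : ℤ} (h : 0 ≤ n ∧ 0 ≤ j ∧ j ≤ 2 * n + 1) :
    ∃ i : Idx, (i.1 : ℤ) = n ∧ ((i.2 : ℕ) : ℤ) = j ∧ vec n j = Finsupp.single i 1 :=
  ⟨⟨n.toNat, ⟨j.toNat, by omega⟩⟩, by simp; omega, by simp; omega, by rw [vec, dif_pos h]⟩

theorem end_ext {S T : Module.End ℂ Dom}
    (h : ∀ n j : ℤ, 0 ≤ n ∧ 0 ≤ j ∧ j ≤ 2 * n + 1 → S (vec n j) = T (vec n j)) : S = T := by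
  refine Finsupp.lhom_ext' fun i => LinearMap.ext_ring ?_
  have := i.2.2
  simpa [vec_idx] using h i.1 (i.2 : ℕ) (by omega)

/-- `q^k` for `k = j - n - 1/2`. -/
def qk (q : ℝ) (n j : ℤ) : ℝ := q ^ j / (q ^ n * √q)

theorem sqrt_eq {q : ℝ} : √q = q ^ (1 / 2 : ℝ) := Real.sqrt_eq_rpow q

theorem rpow_k {q : ℝ} (h0 : 0 < q) (n j : ℤ) (x : ℝ) (hx : x = (j : ℝ) - ((n : ℝ) + 1 / 2)) :
    q ^ x = qk q n j := by
  rw [hx, qk, Real.rpow_sub h0, Real.rpow_add h0, Real.rpow_intCast, Real.rpow_intCast, sqrt_eq]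

theorem opK_vec {q : ℝ} (h0 : 0 < q) (n j : ℤ) :
    opK q (-1) (vec n j) = (((qk q n j)⁻¹ : ℝ) : ℂ) • vec n j := by
  by_cases h : 0 ≤ n ∧ 0 ≤ j ∧ j ≤ 2 * n + 1
  · obtain ⟨i, hn, hj, hv⟩ := exists_idx h
    rw [hv, opK, diag, Finsupp.linearCombination_single, one_smul, Finsupp.smul_single,
      smul_eq_mul, mul_one]
    congr 2
    rw [neg_one_mul, Real.rpow_neg h0.le, rpow_k h0 n j]
    simp [Idx.k, Idx.l, ← hn, ← hj]
  · simp [vec_eq_zero h]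

theorem opE_vec {q : ℝ} (h0 : 0 < q) (h1 : q < 1) (n j : ℤ) :
    opE q (vec n j) = ((rz q (2 * n + 1 - j) * rz q (j + 1) : ℝ) : ℂ) • vec n (j + 1) := by
  by_cases h : 0 ≤ n ∧ 0 ≤ j ∧ j ≤ 2 * n + 1
  · obtain ⟨i, hn, hj, hv⟩ := exists_idx h
    rw [hv, opE, Finsupp.linearCombination_single, one_smul, hn, hj,
      qnum_int q (2 * n + 1 - j), qnum_int q (j + 1), Real.sqrt_mul (qz_nonneg h0 h1 (by omega))]
    · rfl
    · simp [Idx.k, ← hj]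
    · simp [Idx.k, Idx.l, ← hj, ← hn]; ring
  · rw [vec_eq_zero h, map_zero]
    by_cases h' : 0 ≤ n ∧ 0 ≤ j + 1 ∧ j + 1 ≤ 2 * n + 1
    · have : j + 1 = 0 := by omega
      simp [this, rz_zero]
    · simp [vec_eq_zero h']

theorem opF_vec {q : ℝ} (h0 : 0 < q) (h1 : q < 1) (n j : ℤ) :
    opF q (vec n j) = ((rz q (2 * n + 2 - j) * rz q j : ℝ) : ℂ) • vec n (j - 1) := by
  by_cases h : 0 ≤ n ∧ 0 ≤ j ∧ j ≤ 2 * n + 1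
  · obtain ⟨i, hn, hj, hv⟩ := exists_idx h
    rw [hv, opF, Finsupp.linearCombination_single, one_smul, hn, hj,
      qnum_int q (2 * n + 2 - j), qnum_int q j, Real.sqrt_mul (qz_nonneg h0 h1 (by omega))]
    · rfl
    · simp [Idx.k, ← hj]
    · simp [Idx.k, Idx.l, ← hj, ← hn]; ring
  · rw [vec_eq_zero h, map_zero]
    by_cases h' : 0 ≤ n ∧ 0 ≤ j - 1 ∧ j - 1 ≤ 2 * n + 1
    · have : 2 * n + 2 - j = 0 := by omega
      simp [this, rz_zero]
    · simp [vec_eq_zero h']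

/-- `q^n + q^{-n}`. -/
def cz (q : ℝ) (n : ℤ) : ℝ := q ^ n + (q ^ n)⁻¹

theorem cz_pos {q : ℝ} (h0 : 0 < q) (n : ℤ) : 0 < cz q n := by
  have := zpow_pos h0 n
  unfold cz; positivity

/-- The part of the off-diagonal coefficients of `A` that depends on `l` only. -/
def gz (q : ℝ) (s : ℤˣ) (n : ℤ) : ℝ :=
  -(q⁻¹ * q ^ (((s : ℤ) : ℝ) / 2)) / (qz q (2 * n + 1) * √(cz q n * cz q (n + 1)))

theorem qz_two_mul {q : ℝ} (h0 : 0 < q) (n : ℤ) : qz q (2 * n) = qz q n * cz q n := by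
  have := (zpow_pos h0 n).ne'
  rw [qz, qz, cz, two_mul, zpow_add₀ h0.ne']
  field_simp
  ring

theorem alphaMinus_eq {q : ℝ} (h0 : 0 < q) (h1 : q < 1) (s : ℤˣ) (n j : ℤ) (hn : 1 ≤ n)
    (l k : ℝ) (hl : l = n + 1 / 2) (hk : k = j - l) :
    -(1 + q ^ 2)⁻¹ * alphaMinus q s l k =
      gz q s n * qk q n j * (rz q j * rz q (2 * n + 1 - j)) := by
  have h2 := qz_pos h0 h1 (m := n) (by omega)
  have h3 := qz_pos h0 h1 (m := n + 1) (by omega)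
  have h4 := qz_pos h0 h1 (m := 2 * n + 1) (by omega)
  have c0 := cz_pos h0 n
  have c1 := cz_pos h0 (n + 1)
  rw [alphaMinus, qnum_int q (2 * n + 1 - j) (l - k) (by rw [hk, hl]; push_cast; ring),
    qnum_int q j (l + k) (by rw [hk]; ring), qnum_int q n (l - 1 / 2) (by rw [hl]; ring),
    qnum_int q (n + 1) (l + 1 / 2) (by rw [hl]; push_cast; ring),
    qnum_int q (2 * n) (2 * l - 1) (by rw [hl]; push_cast; ring),
    qnum_int q (2 * n + 1) (2 * l) (by rw [hl]; push_cast; ring),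
    qnum_int q (2 * (n + 1)) (2 * l + 1) (by rw [hl]; push_cast; ring),
    qnum_int q 2 2 (by simp), Real.rpow_add h0, rpow_k h0 n j k (by rw [hk, hl]),
    qz_two_mul h0, qz_two_mul h0, Real.sqrt_mul h2.le, Real.sqrt_mul h3.le, gz,
    Real.sqrt_mul c0.le]
  have e2 : qz q 2 = (1 + q ^ 2) / q := by
    have : q - q⁻¹ ≠ 0 := (sub_inv_neg h0 h1).ne
    rw [qz, div_eq_iff this]
    have : q ^ (2 : ℤ) = q ^ 2 := by norm_cast
    rw [this]; field_simp; ring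
  have k2 := (Real.sqrt_pos.2 h2).ne'
  have k3 := (Real.sqrt_pos.2 h3).ne'
  have k4 := (Real.sqrt_pos.2 c0).ne'
  have k5 := (Real.sqrt_pos.2 c1).ne'
  have k6 : (1 + q ^ 2) ≠ 0 := by positivity
  rw [e2, rz, rz]
  field_simp

/-- The diagonal coefficient of `A`. -/
def a0 (q : ℝ) (s : ℤˣ) (n j : ℤ) : ℝ :=
  (1 + q ^ 2)⁻¹ * (1 - (qz q (2 * n + 1))⁻¹ *
    (qz q (2 * n + 2 - j) * qz q j - q ^ 2 * qz q (2 * n + 1 - j) * qz q (j + 1)) *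
    ((((s : ℤ) : ℝ) * q ^ (-(s : ℤ)) - (q - q⁻¹) * (qz q n * qz q (n + 2))) /
      (q * qz q (2 * n + 3))))

theorem alphaZero_eq {q : ℝ} (h0 : 0 < q) (h1 : q < 1) (s : ℤˣ) (n j : ℤ)
    (l k : ℝ) (hl : l = n + 1 / 2) (hk : k = j - l) :
    (1 + q ^ 2)⁻¹ * (1 - alphaZero q s l k) = a0 q s n j := by
  have key : qnum q (1 / 2) * qnum q (3 / 2) - qnum q l * qnum q (l + 1) =
      - (qz q n * qz q (n + 2)) := by
    have hq : q - q⁻¹ ≠ 0 := (sub_inv_neg h0 h1).ne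
    have hu : √q ≠ 0 := (Real.sqrt_pos.2 h0).ne'
    have hu2 : q = √q ^ 2 := (Real.sq_sqrt h0.le).symm
    have ht := (zpow_pos h0 n).ne'
    have e1 : q ^ (1 / 2 : ℝ) = √q := sqrt_eq.symm
    have e2 : q ^ (3 / 2 : ℝ) = q * √q := by
      rw [show (3 / 2 : ℝ) = 1 + 1 / 2 by norm_num, Real.rpow_add h0, Real.rpow_one, e1]
    have e3 : q ^ l = q ^ n * √q := by
      rw [hl, Real.rpow_add h0, Real.rpow_intCast, e1]
    have e4 : q ^ (l + 1) = q ^ n * √q * q := by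
      rw [Real.rpow_add h0, e3, Real.rpow_one]
    have e5 : q ^ (n + 2) = q ^ n * q ^ 2 := by
      rw [zpow_add₀ h0.ne']; norm_cast
    simp only [qnum, qz, Real.rpow_neg h0.le, e1, e2, e3, e4, e5]
    have h00 := h0.ne'
    rw [div_mul_div_comm, div_mul_div_comm, div_mul_div_comm, ← sub_div, ← neg_div]
    congr 1
    generalize q ^ n = t at *
    generalize √q = u at *
    subst hu2
    field_simp
    ring
  rw [alphaZero, beta, key,
    qnum_int q (2 * n + 2 - j) (l - k + 1) (by rw [hk, hl]; push_cast; ring),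
    qnum_int q (2 * n + 1 - j) (l - k) (by rw [hk, hl]; push_cast; ring),
    qnum_int q j (l + k) (by rw [hk]; ring),
    qnum_int q (j + 1) (l + k + 1) (by rw [hk]; push_cast; ring),
    qnum_int q (2 * n + 1) (2 * l) (by rw [hl]; push_cast; ring),
    qnum_int q (2 * n + 3) (2 * l + 2) (by rw [hl]; push_cast; ring), a0]
  have : q ^ (-((s : ℤ) : ℝ)) = q ^ (-(s : ℤ)) := by
    rw [← Real.rpow_intCast]; push_cast; rfl
  rw [this]
  ring

theorem opA_vec {q : ℝ} (h0 : 0 < q) (h1 : q < 1) (s : ℤˣ) (n j : ℤ) :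
    opA q s (vec n j) =
      ((gz q s n * qk q n j * (rz q j * rz q (2 * n + 1 - j)) : ℝ) : ℂ) • vec (n - 1) (j - 1) +
      ((a0 q s n j : ℝ) : ℂ) • vec n j +
      ((gz q s (n + 1) * qk q n j * (rz q (j + 1) * rz q (2 * n + 2 - j)) : ℝ) : ℂ) •
        vec (n + 1) (j + 1) := by
  by_cases h : 0 ≤ n ∧ 0 ≤ j ∧ j ≤ 2 * n + 1
  · obtain ⟨i, hn, hj, hv⟩ := exists_idx h
    have hl : i.l = n + 1 / 2 := by simp [Idx.l, ← hn]
    have hk : i.k = j - i.l := by simp [Idx.k, ← hj]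
    have hk' : i.k = ((j + 1 : ℤ) : ℝ) - (i.l + 1) := by rw [hk]; push_cast; ring
    have e0 := alphaZero_eq h0 h1 s n j i.l i.k hl hk
    have ep := alphaMinus_eq h0 h1 s (n + 1) (j + 1) (by omega) (i.l + 1) i.k
      (by rw [hl]; push_cast; ring) hk'
    have hqk : qk q (n + 1) (j + 1) = qk q n j := by
      rw [← rpow_k h0 n j i.k (by rw [hk, hl]), ← rpow_k h0 (n + 1) (j + 1) i.k (by
        rw [hk, hl]; push_cast; ring)]
    have hr : 2 * (n + 1) + 1 - (j + 1) = 2 * n + 2 - j := by ring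
    rw [hr, hqk] at ep
    have em : ((-(1 + q ^ 2)⁻¹ * alphaMinus q s i.l i.k : ℝ) : ℂ) • vec (n - 1) (j - 1) =
        ((gz q s n * qk q n j * (rz q j * rz q (2 * n + 1 - j)) : ℝ) : ℂ) •
          vec (n - 1) (j - 1) := by
      by_cases hn1 : 1 ≤ n
      · rw [alphaMinus_eq h0 h1 s n j hn1 i.l i.k hl hk]
      · rw [vec_eq_zero (by omega), smul_zero, smul_zero]
    rw [← em, ← e0, ← ep, opA, LinearMap.smul_apply, LinearMap.sub_apply, Module.End.one_apply,
      opX0]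
    conv_lhs => rw [hv]
    rw [Finsupp.linearCombination_single, one_smul, hn, hj, ← hv, alphaPlus]
    push_cast
    module
  · rw [vec_eq_zero h, map_zero, smul_zero, vec_eq_zero (n := n - 1) (by omega)]
    by_cases h' : 0 ≤ n + 1 ∧ 0 ≤ j + 1 ∧ j + 1 ≤ 2 * (n + 1) + 1
    · have : j + 1 = 0 ∨ 2 * n + 2 - j = 0 := by omega
      rcases this with h | h <;> simp [h, rz_zero]
    · simp [vec_eq_zero h']

theorem two_consts {q : ℝ} (h0 : 0 < q) (h1 : q < 1) :
    (√(1 + (q ^ 2)⁻¹))⁻¹ * (√(qnum q 2))⁻¹ * (1 + q ^ 2) = √q * q ∧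
      (√(1 + q ^ 2))⁻¹ * (√(qnum q 2))⁻¹ * (1 + q ^ 2) = √q := by
  have e2 : qnum q 2 = (1 + q ^ 2) / q := by
    rw [qnum_int q 2 2 (by simp)]
    have : q - q⁻¹ ≠ 0 := (sub_inv_neg h0 h1).ne
    rw [qz, div_eq_iff this]
    have : q ^ (2 : ℤ) = q ^ 2 := by norm_cast
    rw [this]; field_simp; ring
  have e3 : 1 + (q ^ 2)⁻¹ = (1 + q ^ 2) / q ^ 2 := by field_simp; ring
  have h2 : 0 < 1 + q ^ 2 := by positivity
  have h3 := Real.sqrt_pos.2 h2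
  have h4 := Real.sqrt_pos.2 h0
  have e4 : √(1 + q ^ 2) ^ 2 = 1 + q ^ 2 := Real.sq_sqrt h2.le
  have e5 : √q ^ 2 = q := Real.sq_sqrt h0.le
  rw [e2, e3, Real.sqrt_div h2.le, Real.sqrt_div h2.le, Real.sqrt_sq h0.le]
  constructor
  · field_simp
    rw [e4]
  · field_simp
    rw [e4]

theorem opB_eq {q : ℝ} (h0 : 0 < q) (h1 : q < 1) (s : ℤˣ) :
    opB q s = ((-(√q * q) : ℝ) : ℂ) • ((opF q * opA q s - opA q s * opF q) * opK q (-1)) := by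
  have h2 : (1 + q ^ 2 : ℝ) ≠ 0 := by positivity
  have e : opF q * opA q s - opA q s * opF q =
      ((-(1 + q ^ 2)⁻¹ : ℝ) : ℂ) • (opF q * opX0 q s - opX0 q s * opF q) := by
    refine LinearMap.ext fun v => ?_
    simp only [opA, LinearMap.sub_apply, Module.End.mul_apply, LinearMap.smul_apply, map_sub,
      map_smul, Module.End.one_apply]
    push_cast
    module
  rw [e, opB, opXm1, ← (two_consts h0 h1).1, smul_mul_assoc, smul_smul, smul_smul]
  congr 1
  norm_cast
  field_simp

theorem opBs_eq {q : ℝ} (h0 : 0 < q) (h1 : q < 1) (s : ℤˣ) :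
    opBs q s = ((√q : ℝ) : ℂ) • ((opE q * opA q s - opA q s * opE q) * opK q (-1)) := by
  have h2 : (1 + q ^ 2 : ℝ) ≠ 0 := by positivity
  have e : opE q * opA q s - opA q s * opE q =
      ((-(1 + q ^ 2)⁻¹ : ℝ) : ℂ) • (opE q * opX0 q s - opX0 q s * opE q) := by
    refine LinearMap.ext fun v => ?_
    simp only [opA, LinearMap.sub_apply, Module.End.mul_apply, LinearMap.smul_apply, map_sub,
      map_smul, Module.End.one_apply]
    push_cast
    module
  rw [e, opBs, opX1]
  conv_rhs => rw [← (two_consts h0 h1).2]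
  rw [smul_mul_assoc, smul_smul, smul_smul]
  congr 1
  norm_cast
  field_simp

theorem qk_ne {q : ℝ} (h0 : 0 < q) (n j : ℤ) : qk q n j ≠ 0 := by
  have := zpow_pos h0 n
  have := zpow_pos h0 j
  have := Real.sqrt_pos.2 h0
  unfold qk; positivity

theorem qk_add {q : ℝ} (h0 : 0 < q) (n j a : ℤ) : qk q n (j + a) = qk q n j * q ^ a := by
  rw [qk, qk, zpow_add₀ h0.ne']; ring

theorem qz_succ {q : ℝ} (h0 : 0 < q) (h1 : q < 1) (m : ℤ) :
    qz q (m + 1) = q⁻¹ * qz q m + q ^ m ∧ qz q (m + 1) = q * qz q m + (q ^ m)⁻¹ := by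
  have hq := (sub_inv_neg h0 h1).ne
  have hm := (zpow_pos h0 m).ne'
  have hq0 := h0.ne'
  have hq2 : q ^ 2 - 1 ≠ 0 := by nlinarith
  rw [qz, qz, zpow_add_one₀ hq0]
  constructor <;> (field_simp; ring)

/-- Coefficient of `B`, from `v^l_k` to `v^{l-1}_{k-1}`. -/
def bm (q : ℝ) (s : ℤˣ) (n j : ℤ) : ℝ :=
  √q * (q ^ (2 * n + 1 - j))⁻¹ * gz q s n * (rz q j * rz q (j - 1))

/-- Coefficient of `B`, from `v^l_k` to `v^l_{k-1}`. -/
def b0 (q : ℝ) (s : ℤˣ) (n j : ℤ) : ℝ :=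
  -(√q * q) * (qk q n j)⁻¹ * (rz q j * rz q (2 * n + 2 - j)) * (a0 q s n j - a0 q s n (j - 1))

/-- Coefficient of `B`, from `v^l_k` to `v^{l+1}_{k-1}`. -/
def bp (q : ℝ) (s : ℤˣ) (n j : ℤ) : ℝ :=
  -(√q * q) * q ^ j * gz q s (n + 1) * (rz q (2 * n + 2 - j) * rz q (2 * n + 3 - j))

theorem opB_vec {q : ℝ} (h0 : 0 < q) (h1 : q < 1) (s : ℤˣ) (n j : ℤ) :
    opB q s (vec n j) =
      ((bm q s n j : ℝ) : ℂ) • vec (n - 1) (j - 2) + ((b0 q s n j : ℝ) : ℂ) • vec n (j - 1) +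
      ((bp q s n j : ℝ) : ℂ) • vec (n + 1) j := by
  by_cases h : 0 ≤ n ∧ 0 ≤ j ∧ j ≤ 2 * n + 1
  · have hk := qk_ne h0 n j
    have hq := h0.ne'
    have hk1 : qk q n (j - 1) = qk q n j * q⁻¹ := by
      rw [sub_eq_add_neg, qk_add h0, zpow_neg_one]
    have i1 : 2 * (n - 1) + 2 - (j - 1) = 2 * n + 1 - j := by ring
    have i2 : 2 * (n + 1) + 2 - (j + 1) = 2 * n + 3 - j := by ring
    have i3 : 2 * n + 1 - (j - 1) = 2 * n + 2 - j := by ring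
    have i4 : 2 * n + 2 - (j - 1) = 2 * n + 3 - j := by ring
    have i5 : j - 1 - 1 = j - 2 := by ring
    have i6 : j + 1 - 1 = j := by ring
    have i7 : j - 1 + 1 = j := by ring
    have e1 : -(√q * q) * ((qk q n j)⁻¹ * (gz q s n * qk q n j * (rz q j * rz q (2 * n + 1 - j)) *
        (rz q (2 * n + 1 - j) * rz q (j - 1)) -
        rz q (2 * n + 2 - j) * rz q j *
          (gz q s n * (qk q n j * q⁻¹) * (rz q (j - 1) * rz q (2 * n + 2 - j))))) =
        bm q s n j := by
      have hr := rz_mul_self h0 h1 (m := 2 * n + 1 - j) (by omega)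
      have hr' := rz_mul_self h0 h1 (m := 2 * n + 2 - j) (by omega)
      have hs := (qz_succ h0 h1 (2 * n + 1 - j)).2
      rw [show 2 * n + 1 - j + 1 = 2 * n + 2 - j by ring] at hs
      rw [← hr, ← hr'] at hs
      generalize rz q (2 * n + 2 - j) = r' at *
      generalize rz q (2 * n + 1 - j) = r at *
      rw [bm]
      have hy := (zpow_pos h0 (2 * n + 1 - j)).ne'
      generalize q ^ (2 * n + 1 - j) = y at *
      field_simp at hs ⊢
      linear_combination (gz q s n * rz q j * rz q (j - 1)) * hs
    have e2 : -(√q * q) * ((qk q n j)⁻¹ *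
        (a0 q s n j * (rz q (2 * n + 2 - j) * rz q j) -
          rz q (2 * n + 2 - j) * rz q j * a0 q s n (j - 1))) = b0 q s n j := by
      rw [b0]; ring
    have e3 : -(√q * q) * ((qk q n j)⁻¹ *
        (gz q s (n + 1) * qk q n j * (rz q (j + 1) * rz q (2 * n + 2 - j)) *
          (rz q (2 * n + 3 - j) * rz q (j + 1)) -
        rz q (2 * n + 2 - j) * rz q j *
          (gz q s (n + 1) * (qk q n j * q⁻¹) * (rz q j * rz q (2 * n + 3 - j))))) =
        bp q s n j := by
      have hr := rz_mul_self h0 h1 (m := j) (by omega)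
      have hr' := rz_mul_self h0 h1 (m := j + 1) (by omega)
      have hs := (qz_succ h0 h1 j).1
      rw [← hr, ← hr'] at hs
      generalize rz q (j + 1) = r' at *
      generalize rz q j = r at *
      rw [bp]
      field_simp at hs ⊢
      linear_combination (-gz q s (n + 1) * rz q (2 * n + 2 - j) * rz q (2 * n + 3 - j)) * hs
    rw [opB_eq h0 h1, LinearMap.smul_apply, Module.End.mul_apply, opK_vec h0, map_smul,
      LinearMap.sub_apply, Module.End.mul_apply, Module.End.mul_apply, opA_vec h0 h1,
      opF_vec h0 h1, map_add, map_add, map_smul, map_smul, map_smul, map_smul, opF_vec h0 h1,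
      opF_vec h0 h1, opF_vec h0 h1, opA_vec h0 h1, hk1, i1, i2, i3, i4, i5, i6, i7,
      ← e1, ← e2, ← e3]
    push_cast
    module
  · rw [vec_eq_zero h, map_zero, vec_eq_zero (n := n - 1) (by omega), smul_zero, zero_add]
    have z1 : ((b0 q s n j : ℝ) : ℂ) • vec n (j - 1) = 0 := by
      by_cases h' : 0 ≤ n ∧ 0 ≤ j - 1 ∧ j - 1 ≤ 2 * n + 1
      · have : 2 * n + 2 - j = 0 := by omega
        simp [b0, this, rz_zero]
      · simp [vec_eq_zero h']
    have z2 : ((bp q s n j : ℝ) : ℂ) • vec (n + 1) j = 0 := by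
      by_cases h' : 0 ≤ n + 1 ∧ 0 ≤ j ∧ j ≤ 2 * (n + 1) + 1
      · have : 2 * n + 2 - j = 0 ∨ 2 * n + 3 - j = 0 := by omega
        rcases this with h | h <;> simp [bp, h, rz_zero]
      · simp [vec_eq_zero h']
    rw [z1, z2, add_zero]

theorem opBs_vec {q : ℝ} (h0 : 0 < q) (h1 : q < 1) (s : ℤˣ) (n j : ℤ) :
    opBs q s (vec n j) =
      ((bp q s (n - 1) j : ℝ) : ℂ) • vec (n - 1) j +
      ((b0 q s n (j + 1) : ℝ) : ℂ) • vec n (j + 1) +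
      ((bm q s (n + 1) (j + 2) : ℝ) : ℂ) • vec (n + 1) (j + 2) := by
  have i0 : 2 * (n - 1) + 2 - j = 2 * n - j := by ring
  have i1 : 2 * (n - 1) + 3 - j = 2 * n + 1 - j := by ring
  have i2 : 2 * (n + 1) + 1 - (j + 2) = 2 * n + 1 - j := by ring
  have i3 : 2 * n + 2 - (j + 1) = 2 * n + 1 - j := by ring
  have i4 : 2 * (n - 1) + 1 - (j - 1) = 2 * n - j := by ring
  have i5 : 2 * (n + 1) + 1 - (j + 1) = 2 * n + 2 - j := by ring
  have i6 : j + 1 - 1 = j := by ring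
  have i7 : j - 1 + 1 = j := by ring
  have i8 : j + 2 - 1 = j + 1 := by ring
  have i9 : j + 1 + 1 = j + 2 := by ring
  have i10 : n - 1 + 1 = n := by ring
  have i11 : 2 * n + 1 - (j + 1) = 2 * n - j := by ring
  by_cases h : 0 ≤ n ∧ 0 ≤ j ∧ j ≤ 2 * n + 1
  · have hk := qk_ne h0 n j
    have hq := h0.ne'
    have hk1 : qk q n (j + 1) = qk q n j * q := by
      rw [qk_add h0, zpow_one]
    have e1 : √q * ((qk q n j)⁻¹ * (gz q s n * qk q n j * (rz q j * rz q (2 * n + 1 - j)) *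
        (rz q (2 * n - j) * rz q j) -
        rz q (2 * n + 1 - j) * rz q (j + 1) *
          (gz q s n * (qk q n j * q) * (rz q (j + 1) * rz q (2 * n - j))))) =
        bp q s (n - 1) j := by
      have hr := rz_mul_self h0 h1 (m := j) (by omega)
      have hr' := rz_mul_self h0 h1 (m := j + 1) (by omega)
      have hs := (qz_succ h0 h1 j).1
      rw [← hr, ← hr'] at hs
      rw [bp, i0, i1, i10]
      generalize rz q (j + 1) = r' at *
      generalize rz q j = r at *
      field_simp at hs ⊢
      linear_combination (-gz q s n * rz q (2 * n + 1 - j) * rz q (2 * n - j)) * hs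
    have e2 : √q * ((qk q n j)⁻¹ *
        (a0 q s n j * (rz q (2 * n + 1 - j) * rz q (j + 1)) -
          rz q (2 * n + 1 - j) * rz q (j + 1) * a0 q s n (j + 1))) = b0 q s n (j + 1) := by
      rw [b0, hk1, i3, i6]
      field_simp
      ring
    have e3 : √q * ((qk q n j)⁻¹ *
        (gz q s (n + 1) * qk q n j * (rz q (j + 1) * rz q (2 * n + 2 - j)) *
          (rz q (2 * n + 2 - j) * rz q (j + 2)) -
        rz q (2 * n + 1 - j) * rz q (j + 1) *
          (gz q s (n + 1) * (qk q n j * q) * (rz q (j + 2) * rz q (2 * n + 1 - j))))) =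
        bm q s (n + 1) (j + 2) := by
      have hr := rz_mul_self h0 h1 (m := 2 * n + 1 - j) (by omega)
      have hr' := rz_mul_self h0 h1 (m := 2 * n + 2 - j) (by omega)
      have hs := (qz_succ h0 h1 (2 * n + 1 - j)).2
      rw [show 2 * n + 1 - j + 1 = 2 * n + 2 - j by ring] at hs
      rw [← hr, ← hr'] at hs
      rw [bm, i2, i8]
      generalize rz q (2 * n + 2 - j) = r' at *
      generalize rz q (2 * n + 1 - j) = r at *
      have hy := (zpow_pos h0 (2 * n + 1 - j)).ne'
      generalize q ^ (2 * n + 1 - j) = y at *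
      field_simp at hs ⊢
      linear_combination (gz q s (n + 1) * rz q (j + 1) * rz q (j + 2)) * hs
    rw [opBs_eq h0 h1, LinearMap.smul_apply, Module.End.mul_apply, opK_vec h0, map_smul,
      LinearMap.sub_apply, Module.End.mul_apply, Module.End.mul_apply, opA_vec h0 h1,
      opE_vec h0 h1, map_add, map_add, map_smul, map_smul, map_smul, map_smul, opE_vec h0 h1,
      opE_vec h0 h1, opE_vec h0 h1, opA_vec h0 h1, hk1, i4, i5, i6, i7, i9, i11,
      show 2 * n + 2 - (j + 1) = 2 * n + 1 - j by ring, ← e1, ← e2, ← e3]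
    push_cast
    module
  · rw [vec_eq_zero h, map_zero, vec_eq_zero (n := n - 1) (by omega), smul_zero, zero_add]
    have z1 : ((b0 q s n (j + 1) : ℝ) : ℂ) • vec n (j + 1) = 0 := by
      by_cases h' : 0 ≤ n ∧ 0 ≤ j + 1 ∧ j + 1 ≤ 2 * n + 1
      · have : j + 1 = 0 := by omega
        simp [b0, this, rz_zero]
      · simp [vec_eq_zero h']
    have z2 : ((bm q s (n + 1) (j + 2) : ℝ) : ℂ) • vec (n + 1) (j + 2) = 0 := by
      by_cases h' : 0 ≤ n + 1 ∧ 0 ≤ j + 2 ∧ j + 2 ≤ 2 * (n + 1) + 1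
      · have : j + 2 = 0 ∨ j + 1 = 0 := by omega
        rw [bm, i8]
        rcases this with h | h <;> simp [h, rz_zero]
      · simp [vec_eq_zero h']
    rw [z1, z2, add_zero]

/-- Closed form of the coefficient of `q^{2(l+k)}` in the diagonal coefficient of `A`, where
`t = q^n` and `Q = q^{±2}`. -/
def hf (q Q t : ℝ) : ℝ :=
  (1 + t ^ 4 * q ^ 4 - (1 + Q) * t ^ 2 * q ^ 2) / ((1 - t ^ 4 * q ^ 2) * (1 - t ^ 4 * q ^ 6))

/-- Closed form of the diagonal coefficient of `A`, where `t = q^n` and `x = q^j`. -/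
def af (q Q t x : ℝ) : ℝ := (1 + q ^ 2)⁻¹ * (1 - (1 + t ^ 4 * q ^ 4) * hf q Q t) + x ^ 2 * hf q Q t

/-- `q^{±2}`. -/
def qs (q : ℝ) (s : ℤˣ) : ℝ := q ^ (2 * (s : ℤ))

/-- Rescaled off-diagonal coefficient. -/
def gt (q : ℝ) (s : ℤˣ) (n : ℤ) : ℝ := gz q s n / √q

theorem pow_odd_ne {q : ℝ} (h0 : 0 < q) (h1 : q < 1) {m : ℤ} (hm : m ≠ 0) : 1 - q ^ m ≠ 0 := by
  intro h
  exact hm ((zpow_eq_one_iff_right₀ h0.le h1.ne).1 (by linarith))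

theorem den1_ne {q : ℝ} (h0 : 0 < q) (h1 : q < 1) (n : ℤ) : 1 - (q ^ n) ^ 4 * q ^ 2 ≠ 0 := by
  have := pow_odd_ne h0 h1 (m := n * 4 + 2) (by omega)
  rw [zpow_add₀ h0.ne', zpow_mul] at this
  exact_mod_cast this

theorem den3_ne {q : ℝ} (h0 : 0 < q) (h1 : q < 1) (n : ℤ) : 1 - (q ^ n) ^ 4 * q ^ 6 ≠ 0 := by
  have := pow_odd_ne h0 h1 (m := n * 4 + 6) (by omega)
  rw [zpow_add₀ h0.ne', zpow_mul] at this
  exact_mod_cast this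

theorem qz_eq {q : ℝ} (h0 : 0 < q) (m : ℤ) :
    qz q m = (1 - (q ^ m) ^ 2) * q / (q ^ m * (1 - q ^ 2)) := by
  have := (zpow_pos h0 m).ne'
  rw [qz]
  by_cases h : 1 - q ^ 2 = 0
  · have : q - q⁻¹ = 0 := by field_simp; linarith
    simp [h, this]
  · have : q - q⁻¹ ≠ 0 := by
      intro h'; apply h; field_simp at h'; linarith
    have h3 : q ^ 2 - 1 ≠ 0 := by intro h'; apply h; linarith
    field_simp
    ring

theorem a0_eq {q : ℝ} (h0 : 0 < q) (h1 : q < 1) (s : ℤˣ) (n j : ℤ) :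
    a0 q s n j = af q (qs q s) (q ^ n) (q ^ j) := by
  have hq := h0.ne'
  have ht := (zpow_pos h0 n).ne'
  have hx := (zpow_pos h0 j).ne'
  have d1 := den1_ne h0 h1 n
  have d3 := den3_ne h0 h1 n
  have w : 1 - q ^ 2 ≠ 0 := by nlinarith
  have w' : q ^ 2 - 1 ≠ 0 := by nlinarith
  have w2 : 1 + q ^ 2 ≠ 0 := by positivity
  have z1 : q ^ (2 * n + 1) = (q ^ n) ^ 2 * q := by
    rw [zpow_add₀ hq, mul_comm 2 n, zpow_mul, zpow_one]; norm_cast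
  have z3 : q ^ (2 * n + 3) = (q ^ n) ^ 2 * q ^ 3 := by
    rw [zpow_add₀ hq, mul_comm 2 n, zpow_mul]; norm_cast
  have z4 : q ^ (2 * n + 1 - j) = (q ^ n) ^ 2 * q / q ^ j := by
    rw [zpow_sub₀ hq, z1]
  have z5 : q ^ (2 * n + 2 - j) = (q ^ n) ^ 2 * q ^ 2 / q ^ j := by
    rw [zpow_sub₀ hq, zpow_add₀ hq, mul_comm 2 n, zpow_mul]; norm_cast
  have z6 : q ^ (j + 1) = q ^ j * q := zpow_add_one₀ hq j
  have z7 : q ^ (n + 2) = q ^ n * q ^ 2 := by rw [zpow_add₀ hq]; norm_cast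
  rw [a0, af, hf]
  simp only [qz_eq h0, z1, z3, z4, z5, z6, z7]
  have e1 : 1 - ((q ^ n) ^ 2 * q) ^ 2 = 1 - (q ^ n) ^ 4 * q ^ 2 := by ring
  have e3 : 1 - ((q ^ n) ^ 2 * q ^ 3) ^ 2 = 1 - (q ^ n) ^ 4 * q ^ 6 := by ring
  rw [e1, e3]
  rcases Int.units_eq_one_or s with rfl | rfl
  · have : qs q 1 = q ^ 2 := by simp only [qs]; norm_cast
    rw [this]
    simp only [Units.val_one, Int.cast_one, zpow_neg_one]
    generalize q ^ n = t at *
    generalize q ^ j = x at *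
    field_simp
    ring
  · have : qs q (-1) = (q ^ 2)⁻¹ := by
      simp only [qs, Units.val_neg, Units.val_one, mul_neg, mul_one, zpow_neg]; norm_cast
    rw [this]
    simp only [Units.val_neg, Units.val_one, Int.cast_neg, Int.cast_one, neg_neg, zpow_one]
    generalize q ^ n = t at *
    generalize q ^ j = x at *
    field_simp
    ring

theorem gt_sq {q : ℝ} (h0 : 0 < q) (h1 : q < 1) (s : ℤˣ) (n : ℤ) :
    gt q s n ^ 2 * ((1 - (q ^ n) ^ 4 * q ^ 2) ^ 2 * (1 + (q ^ n) ^ 2) * (1 + (q ^ n) ^ 2 * q ^ 2))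
      = (q ^ (s : ℤ) / q ^ 2) * (1 - q ^ 2) ^ 2 * (q ^ n) ^ 6 := by
  have hq := h0.ne'
  have ht := (zpow_pos h0 n).ne'
  have d1 := den1_ne h0 h1 n
  have w : 1 - q ^ 2 ≠ 0 := by nlinarith
  have z1 : q ^ (2 * n + 1) = (q ^ n) ^ 2 * q := by
    rw [zpow_add₀ hq, mul_comm 2 n, zpow_mul, zpow_one]; norm_cast
  have e1 : 1 - ((q ^ n) ^ 2 * q) ^ 2 = 1 - (q ^ n) ^ 4 * q ^ 2 := by ring
  have c0 := cz_pos h0 n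
  have c1 := cz_pos h0 (n + 1)
  have hs : (q ^ (((s : ℤ) : ℝ) / 2)) ^ 2 = q ^ (s : ℤ) := by
    rw [← Real.rpow_natCast, ← Real.rpow_mul h0.le, ← Real.rpow_intCast]
    congr 1; push_cast; ring
  rw [gt, gz, div_pow, div_pow, mul_pow, Real.sq_sqrt h0.le, Real.sq_sqrt (by positivity), neg_sq,
    mul_pow, hs, qz_eq h0, z1, e1, cz, cz, zpow_add_one₀ hq]
  have k1 : 1 + (q ^ n) ^ 2 ≠ 0 := by positivity
  have k2 : 1 + (q ^ n) ^ 2 * q ^ 2 ≠ 0 := by positivity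
  have k1' : q ^ n + (q ^ n)⁻¹ = (1 + (q ^ n) ^ 2) / q ^ n := by field_simp; ring
  have k2' : q ^ n * q + (q ^ n * q)⁻¹ = (1 + (q ^ n) ^ 2 * q ^ 2) / (q ^ n * q) := by
    field_simp; ring
  rw [k1', k2']
  generalize q ^ n = t at *
  generalize q ^ (s : ℤ) = Q at *
  have d1' : 1 - q ^ 2 * t ^ 4 ≠ 0 := by rwa [mul_comm (q ^ 2)]
  field_simp

/-- Closed forms of the coefficients of `A` and `B`, as functions of `n`, `p = l + k`, `r = l - k`. -/
def cAm (q : ℝ) (s : ℤˣ) (n p r : ℤ) : ℝ := gt q s n * (q ^ p / q ^ n) * (rz q p * rz q r)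
def cA0 (q : ℝ) (s : ℤˣ) (n p _r : ℤ) : ℝ := af q (qs q s) (q ^ n) (q ^ p)
def cAp (q : ℝ) (s : ℤˣ) (n p r : ℤ) : ℝ :=
  gt q s (n + 1) * (q ^ p / q ^ n) * (rz q (p + 1) * rz q (r + 1))
def cBm (q : ℝ) (s : ℤˣ) (n p r : ℤ) : ℝ := q * (q ^ r)⁻¹ * gt q s n * (rz q p * rz q (p - 1))
def cB0 (q : ℝ) (s : ℤˣ) (n p r : ℤ) : ℝ :=
  (1 - q ^ 2) * q ^ n * q ^ p * hf q (qs q s) (q ^ n) * (rz q p * rz q (r + 1))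
def cBp (q : ℝ) (s : ℤˣ) (n p r : ℤ) : ℝ :=
  -(q ^ 2) * q ^ p * gt q s (n + 1) * (rz q (r + 1) * rz q (r + 2))

/-- Coefficients of an operator that shifts `l` by `-1`, `0`, `1` and `k` by `d`. -/
def IsTri (T : Module.End ℂ Dom) (d : ℤ) (cm c0 cp : ℤ → ℤ → ℤ → ℝ) : Prop :=
  ∀ n p r : ℤ, p + r = 2 * n + 1 → T (vec n p) =
    ((cm n p r : ℝ) : ℂ) • vec (n - 1) (p - 1 + d) + ((c0 n p r : ℝ) : ℂ) • vec n (p + d) +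
    ((cp n p r : ℝ) : ℂ) • vec (n + 1) (p + 1 + d)

theorem isTri_A {q : ℝ} (h0 : 0 < q) (h1 : q < 1) (s : ℤˣ) :
    IsTri (opA q s) 0 (cAm q s) (cA0 q s) (cAp q s) := by
  intro n p r h
  obtain rfl : r = 2 * n + 1 - p := by omega
  have hu := (Real.sqrt_pos.2 h0).ne'
  have ht := (zpow_pos h0 n).ne'
  have e1 : cAm q s n p (2 * n + 1 - p) =
      gz q s n * qk q n p * (rz q p * rz q (2 * n + 1 - p)) := by
    rw [cAm, gt, qk]; field_simp
  have e2 : cAp q s n p (2 * n + 1 - p) =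
      gz q s (n + 1) * qk q n p * (rz q (p + 1) * rz q (2 * n + 2 - p)) := by
    rw [cAp, gt, qk, show 2 * n + 1 - p + 1 = 2 * n + 2 - p by ring]; field_simp
  rw [opA_vec h0 h1, a0_eq h0 h1, add_zero, add_zero, add_zero, e1, e2, cA0]

theorem cB_eq {q : ℝ} (h0 : 0 < q) (h1 : q < 1) (s : ℤˣ) (n p r : ℤ) (h : p + r = 2 * n + 1) :
    cBm q s n p r = bm q s n p ∧ cB0 q s n p r = b0 q s n p ∧ cBp q s n p r = bp q s n p := by
  obtain rfl : r = 2 * n + 1 - p := by omega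
  have hu := (Real.sqrt_pos.2 h0).ne'
  have hq := h0.ne'
  have hu2 := Real.sq_sqrt h0.le
  have ht := (zpow_pos h0 n).ne'
  have hx := (zpow_pos h0 p).ne'
  refine ⟨?_, ?_, ?_⟩
  · rw [bm, cBm, gt]; field_simp; rw [hu2]; ring
  · rw [b0, cB0, qk, a0_eq h0 h1, a0_eq h0 h1, af, af, zpow_sub_one₀ hq,
      show 2 * n + 1 - p + 1 = 2 * n + 2 - p by ring]
    field_simp
    rw [hu2]
    ring
  · rw [bp, cBp, gt, show 2 * n + 1 - p + 1 = 2 * n + 2 - p by ring,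
      show 2 * n + 1 - p + 2 = 2 * n + 3 - p by ring]
    field_simp; rw [hu2]; ring

theorem isTri_B {q : ℝ} (h0 : 0 < q) (h1 : q < 1) (s : ℤˣ) :
    IsTri (opB q s) (-1) (cBm q s) (cB0 q s) (cBp q s) := by
  intro n p r h
  simp only [cB_eq h0 h1 s n p r h]
  rw [opB_vec h0 h1, show p - 1 + -1 = p - 2 by ring, show p + -1 = p - 1 by ring,
    show p + 1 + -1 = p by ring]

theorem isTri_Bs {q : ℝ} (h0 : 0 < q) (h1 : q < 1) (s : ℤˣ) :
    IsTri (opBs q s) 1 (fun n p r => cBp q s (n - 1) p (r - 2))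
      (fun n p r => cB0 q s n (p + 1) (r - 1)) (fun n p r => cBm q s (n + 1) (p + 2) r) := by
  intro n p r h
  simp only [cB_eq h0 h1 s (n - 1) p (r - 2) (by omega),
    cB_eq h0 h1 s n (p + 1) (r - 1) (by omega), cB_eq h0 h1 s (n + 1) (p + 2) r (by omega)]
  rw [opBs_vec h0 h1, show p - 1 + 1 = p by ring, show p + 1 + 1 = p + 2 by ring]

theorem IsTri.comp {S T : Module.End ℂ Dom} {d e : ℤ} {sm s0 sp tm t0 tp : ℤ → ℤ → ℤ → ℝ}
    (hS : IsTri S d sm s0 sp) (hT : IsTri T e tm t0 tp) (n p r : ℤ) (h : p + r = 2 * n + 1) :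
    (S * T) (vec n p) =
      ((sm (n - 1) (p - 1 + e) (r - 1 - e) * tm n p r : ℝ) : ℂ) • vec (n - 2) (p - 2 + (d + e)) +
      ((sm n (p + e) (r - e) * t0 n p r +
        s0 (n - 1) (p - 1 + e) (r - 1 - e) * tm n p r : ℝ) : ℂ) • vec (n - 1) (p - 1 + (d + e)) +
      ((sm (n + 1) (p + 1 + e) (r + 1 - e) * tp n p r + s0 n (p + e) (r - e) * t0 n p r +
        sp (n - 1) (p - 1 + e) (r - 1 - e) * tm n p r : ℝ) : ℂ) • vec n (p + (d + e)) +
      ((s0 (n + 1) (p + 1 + e) (r + 1 - e) * tp n p r +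
        sp n (p + e) (r - e) * t0 n p r : ℝ) : ℂ) • vec (n + 1) (p + 1 + (d + e)) +
      ((sp (n + 1) (p + 1 + e) (r + 1 - e) * tp n p r : ℝ) : ℂ) •
        vec (n + 2) (p + 2 + (d + e)) := by
  rw [Module.End.mul_apply, hT n p r h, map_add, map_add, map_smul, map_smul, map_smul,
    hS (n - 1) (p - 1 + e) (r - 1 - e) (by omega), hS n (p + e) (r - e) (by omega),
    hS (n + 1) (p + 1 + e) (r + 1 - e) (by omega),
    show n - 1 - 1 = n - 2 by ring, show n - 1 + 1 = n by ring, show n + 1 - 1 = n by ring,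
    show n + 1 + 1 = n + 2 by ring,
    show p - 1 + e - 1 + d = p - 2 + (d + e) by ring, show p - 1 + e + d = p - 1 + (d + e) by ring,
    show p - 1 + e + 1 + d = p + (d + e) by ring, show p + e - 1 + d = p - 1 + (d + e) by ring,
    show p + e + d = p + (d + e) by ring, show p + e + 1 + d = p + 1 + (d + e) by ring,
    show p + 1 + e - 1 + d = p + (d + e) by ring, show p + 1 + e + d = p + 1 + (d + e) by ring,
    show p + 1 + e + 1 + d = p + 2 + (d + e) by ring]
  push_cast
  module

theorem tri_congr {c1 c2 c3 c4 c5 d1 d2 d3 d4 d5 : ℝ}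
    {v1 v2 v3 v4 v5 : Dom} (h1 : c1 = d1) (h2 : c2 = d2) (h3 : c3 = d3) (h4 : c4 = d4)
    (h5 : c5 = d5) : (c1 : ℂ) • v1 + (c2 : ℂ) • v2 + (c3 : ℂ) • v3 + (c4 : ℂ) • v4 +
      (c5 : ℂ) • v5 = (d1 : ℂ) • v1 + (d2 : ℂ) • v2 + (d3 : ℂ) • v3 + (d4 : ℂ) • v4 +
      (d5 : ℂ) • v5 := by
  rw [h1, h2, h3, h4, h5]

theorem tri_smul (c c1 c2 c3 c4 c5 : ℝ) (v1 v2 v3 v4 v5 : Dom) :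
    (c : ℂ) • ((c1 : ℂ) • v1 + (c2 : ℂ) • v2 + (c3 : ℂ) • v3 + (c4 : ℂ) • v4 +
      (c5 : ℂ) • v5) = ((c * c1 : ℝ) : ℂ) • v1 + ((c * c2 : ℝ) : ℂ) • v2 +
      ((c * c3 : ℝ) : ℂ) • v3 + ((c * c4 : ℝ) : ℂ) • v4 + ((c * c5 : ℝ) : ℂ) • v5 := by
  push_cast
  module

/-- `[m]_q` as a function of `y = q^m`. -/
def zf (q y : ℝ) : ℝ := (1 - y ^ 2) * q / (y * (1 - q ^ 2))

theorem rz_sq {q : ℝ} (h0 : 0 < q) (h1 : q < 1) {m : ℤ} (hm : 0 ≤ m) :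
    rz q m * rz q m = zf q (q ^ m) := by rw [rz_mul_self h0 h1 hm, qz_eq h0, zf]


/-- Closed form of the square of the rescaled off-diagonal coefficient, where `c = q^{±1}`. -/
def gf (q c t : ℝ) : ℝ :=
  (c / q ^ 2) * (1 - q ^ 2) ^ 2 * t ^ 6 /
    ((1 - t ^ 4 * q ^ 2) ^ 2 * (1 + t ^ 2) * (1 + t ^ 2 * q ^ 2))

theorem hf_down {q t : ℝ} (Q : ℝ) (hq : q ≠ 0) :
    hf q Q (t * q⁻¹) = q ^ 2 * (1 + t ^ 4 - (1 + Q) * t ^ 2) /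
      ((q ^ 2 - t ^ 4) * (1 - t ^ 4 * q ^ 2)) := by
  have e1 : 1 - (t * q⁻¹) ^ 4 * q ^ 2 = (q ^ 2 - t ^ 4) / q ^ 2 := by field_simp
  have e2 : 1 - (t * q⁻¹) ^ 4 * q ^ 6 = 1 - t ^ 4 * q ^ 2 := by field_simp
  have e3 : 1 + (t * q⁻¹) ^ 4 * q ^ 4 - (1 + Q) * (t * q⁻¹) ^ 2 * q ^ 2 =
      1 + t ^ 4 - (1 + Q) * t ^ 2 := by field_simp
  rw [hf, e1, e2, e3, div_mul_eq_mul_div, div_div_eq_mul_div]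
  ring

theorem hf_up {q t : ℝ} (Q : ℝ) :
    hf q Q (t * q) = (1 + t ^ 4 * q ^ 8 - (1 + Q) * t ^ 2 * q ^ 4) /
      ((1 - t ^ 4 * q ^ 6) * (1 - t ^ 4 * q ^ 10)) := by
  rw [hf]; congr 1 <;> ring

theorem key_BA_m {q t x y Q : ℝ} (h0 : 0 < q) (h1 : q < 1) (ht : 0 < t) (hx : 0 < x)
    (hy : y = t ^ 2 * q / x) (D0 : q ^ 2 - t ^ 4 ≠ 0) (D1 : 1 - t ^ 4 * q ^ 2 ≠ 0)
    (D2 : 1 - t ^ 4 * q ^ 6 ≠ 0) (D3 : 1 - t ^ 4 * q ^ 10 ≠ 0) :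
      q * y⁻¹ * af q Q t x + (1 + -q ^ 2) * (t * q⁻¹) * (x * q⁻¹) * hf q Q (t * q⁻¹) * (x / t) *
      zf q y =
        q ^ 2 * ((x * q⁻¹ / t) * ((1 + -q ^ 2) * t * x * hf q Q t) * zf q (y * q) + af q Q (t *
      q⁻¹) (x * (q ^ 2)⁻¹) * (q * y⁻¹)) := by
  have hq := h0.ne'
  have ht' := ht.ne'
  have hx' := hx.ne'
  have w1 : 1 - q ^ 2 ≠ 0 := by nlinarith
  have w2 : 1 + q ^ 2 ≠ 0 := by positivity
  have D1' : 1 - q ^ 2 * t ^ 4 ≠ 0 := by rwa [mul_comm (q ^ 2)]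
  have D2' : 1 - q ^ 6 * t ^ 4 ≠ 0 := by rwa [mul_comm (q ^ 6)]
  have D3' : 1 - q ^ 10 * t ^ 4 ≠ 0 := by rwa [mul_comm (q ^ 10)]
  subst hy
  simp only [af, hf_down Q hq, zf]
  simp only [hf]
  field_simp
  ring

theorem key_BA_p {q t x y Q : ℝ} (h0 : 0 < q) (h1 : q < 1) (ht : 0 < t) (hx : 0 < x)
    (hy : y = t ^ 2 * q / x) (D0 : q ^ 2 - t ^ 4 ≠ 0) (D1 : 1 - t ^ 4 * q ^ 2 ≠ 0)
    (D2 : 1 - t ^ 4 * q ^ 6 ≠ 0) (D3 : 1 - t ^ 4 * q ^ 10 ≠ 0) :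
      (1 + -q ^ 2) * (t * q) * (x * q) * hf q Q (t * q) * (x / t) * zf q (x * q) + -q ^ 2 * x *
      af q Q t x =
        q ^ 2 * (af q Q (t * q) x * (-q ^ 2 * x) + (x * q⁻¹ / t) * ((1 + -q ^ 2) * t * x * hf q
      Q t) * zf q x) := by
  have hq := h0.ne'
  have ht' := ht.ne'
  have hx' := hx.ne'
  have w1 : 1 - q ^ 2 ≠ 0 := by nlinarith
  have w2 : 1 + q ^ 2 ≠ 0 := by positivity
  have D1' : 1 - q ^ 2 * t ^ 4 ≠ 0 := by rwa [mul_comm (q ^ 2)]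
  have D2' : 1 - q ^ 6 * t ^ 4 ≠ 0 := by rwa [mul_comm (q ^ 6)]
  have D3' : 1 - q ^ 10 * t ^ 4 ≠ 0 := by rwa [mul_comm (q ^ 10)]
  subst hy
  simp only [af, hf_up Q, zf]
  simp only [hf]
  field_simp
  ring

theorem key_ABs_m {q t x y Q : ℝ} (h0 : 0 < q) (h1 : q < 1) (ht : 0 < t) (hx : 0 < x)
    (hy : y = t ^ 2 * q / x) (D0 : q ^ 2 - t ^ 4 ≠ 0) (D1 : 1 - t ^ 4 * q ^ 2 ≠ 0)
    (D2 : 1 - t ^ 4 * q ^ 6 ≠ 0) (D3 : 1 - t ^ 4 * q ^ 10 ≠ 0) :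
      (x * q / t) * ((1 + -q ^ 2) * t * (x * q) * hf q Q t) * zf q (x * q) + af q Q (t * q⁻¹) x
      * (-q ^ 2 * x) =
        q ^ 2 * (-q ^ 2 * x * af q Q t x + (1 + -q ^ 2) * (t * q⁻¹) * x * hf q Q (t * q⁻¹) * (x
      / t) * zf q x) := by
  have hq := h0.ne'
  have ht' := ht.ne'
  have hx' := hx.ne'
  have w1 : 1 - q ^ 2 ≠ 0 := by nlinarith
  have w2 : 1 + q ^ 2 ≠ 0 := by positivity
  have D1' : 1 - q ^ 2 * t ^ 4 ≠ 0 := by rwa [mul_comm (q ^ 2)]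
  have D2' : 1 - q ^ 6 * t ^ 4 ≠ 0 := by rwa [mul_comm (q ^ 6)]
  have D3' : 1 - q ^ 10 * t ^ 4 ≠ 0 := by rwa [mul_comm (q ^ 10)]
  subst hy
  simp only [af, hf_down Q hq, zf]
  simp only [hf]
  field_simp
  ring

theorem key_ABs_p {q t x y Q : ℝ} (h0 : 0 < q) (h1 : q < 1) (ht : 0 < t) (hx : 0 < x)
    (hy : y = t ^ 2 * q / x) (D0 : q ^ 2 - t ^ 4 ≠ 0) (D1 : 1 - t ^ 4 * q ^ 2 ≠ 0)
    (D2 : 1 - t ^ 4 * q ^ 6 ≠ 0) (D3 : 1 - t ^ 4 * q ^ 10 ≠ 0) :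
      af q Q (t * q) (x * q ^ 2) * (q * y⁻¹) + (x * q / t) * ((1 + -q ^ 2) * t * (x * q) * hf q
      Q t) * zf q y =
        q ^ 2 * ((1 + -q ^ 2) * (t * q) * (x * q ^ 2) * hf q Q (t * q) * (x / t) * zf q (y * q)
      + q * y⁻¹ * af q Q t x) := by
  have hq := h0.ne'
  have ht' := ht.ne'
  have hx' := hx.ne'
  have w1 : 1 - q ^ 2 ≠ 0 := by nlinarith
  have w2 : 1 + q ^ 2 ≠ 0 := by positivity
  have D1' : 1 - q ^ 2 * t ^ 4 ≠ 0 := by rwa [mul_comm (q ^ 2)]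
  have D2' : 1 - q ^ 6 * t ^ 4 ≠ 0 := by rwa [mul_comm (q ^ 6)]
  have D3' : 1 - q ^ 10 * t ^ 4 ≠ 0 := by rwa [mul_comm (q ^ 10)]
  subst hy
  simp only [af, hf_up Q, zf]
  simp only [hf]
  field_simp
  ring

theorem key_BsB_m {q t x y Q : ℝ} (h0 : 0 < q) (h1 : q < 1) (ht : 0 < t) (hx : 0 < x)
    (hy : y = t ^ 2 * q / x) (D0 : q ^ 2 - t ^ 4 ≠ 0) (D1 : 1 - t ^ 4 * q ^ 2 ≠ 0)
    (D2 : 1 - t ^ 4 * q ^ 6 ≠ 0) (D3 : 1 - t ^ 4 * q ^ 10 ≠ 0) :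
      (-q ^ 2 * (x * q⁻¹)) * ((1 + -q ^ 2) * t * x * hf q Q t) * zf q (y * q) + (1 + -q ^ 2) *
      (t * q⁻¹) * (x * q⁻¹) * hf q Q (t * q⁻¹) * (q * y⁻¹) * zf q (x * q⁻¹) =
        (x / t) - ((x / t) * af q Q t x + af q Q (t * q⁻¹) (x * q⁻¹) * (x / t)) := by
  have hq := h0.ne'
  have ht' := ht.ne'
  have hx' := hx.ne'
  have w1 : 1 - q ^ 2 ≠ 0 := by nlinarith
  have w2 : 1 + q ^ 2 ≠ 0 := by positivity
  have D1' : 1 - q ^ 2 * t ^ 4 ≠ 0 := by rwa [mul_comm (q ^ 2)]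
  have D2' : 1 - q ^ 6 * t ^ 4 ≠ 0 := by rwa [mul_comm (q ^ 6)]
  have D3' : 1 - q ^ 10 * t ^ 4 ≠ 0 := by rwa [mul_comm (q ^ 10)]
  subst hy
  simp only [af, hf_down Q hq, zf]
  simp only [hf]
  field_simp
  ring

theorem key_BsB_p {q t x y Q : ℝ} (h0 : 0 < q) (h1 : q < 1) (ht : 0 < t) (hx : 0 < x)
    (hy : y = t ^ 2 * q / x) (D0 : q ^ 2 - t ^ 4 ≠ 0) (D1 : 1 - t ^ 4 * q ^ 2 ≠ 0)
    (D2 : 1 - t ^ 4 * q ^ 6 ≠ 0) (D3 : 1 - t ^ 4 * q ^ 10 ≠ 0) :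
      (1 + -q ^ 2) * (t * q) * (x * q) * hf q Q (t * q) * (-q ^ 2 * x) * zf q (y * q ^ 2) + q *
      (y * q)⁻¹ * ((1 + -q ^ 2) * t * x * hf q Q t) * zf q x =
        (x / t) - (af q Q (t * q) (x * q) * (x / t) + (x / t) * af q Q t x) := by
  have hq := h0.ne'
  have ht' := ht.ne'
  have hx' := hx.ne'
  have w1 : 1 - q ^ 2 ≠ 0 := by nlinarith
  have w2 : 1 + q ^ 2 ≠ 0 := by positivity
  have D1' : 1 - q ^ 2 * t ^ 4 ≠ 0 := by rwa [mul_comm (q ^ 2)]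
  have D2' : 1 - q ^ 6 * t ^ 4 ≠ 0 := by rwa [mul_comm (q ^ 6)]
  have D3' : 1 - q ^ 10 * t ^ 4 ≠ 0 := by rwa [mul_comm (q ^ 10)]
  subst hy
  simp only [af, hf_up Q, zf]
  simp only [hf]
  field_simp
  ring

theorem key_BBs_m {q t x y Q : ℝ} (h0 : 0 < q) (h1 : q < 1) (ht : 0 < t) (hx : 0 < x)
    (hy : y = t ^ 2 * q / x) (D0 : q ^ 2 - t ^ 4 ≠ 0) (D1 : 1 - t ^ 4 * q ^ 2 ≠ 0)
    (D2 : 1 - t ^ 4 * q ^ 6 ≠ 0) (D3 : 1 - t ^ 4 * q ^ 10 ≠ 0) :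
      q * (y * q⁻¹)⁻¹ * ((1 + -q ^ 2) * t * (x * q) * hf q Q t) * zf q (x * q) + (1 + -q ^ 2) *
      (t * q⁻¹) * x * hf q Q (t * q⁻¹) * (-q ^ 2 * x) * zf q (y * q⁻¹) =
        q ^ 2 * (x / t) - q ^ 4 * ((x / t) * af q Q t x + af q Q (t * q⁻¹) (x * q⁻¹) * (x / t)) := by
  have hq := h0.ne'
  have ht' := ht.ne'
  have hx' := hx.ne'
  have w1 : 1 - q ^ 2 ≠ 0 := by nlinarith
  have w2 : 1 + q ^ 2 ≠ 0 := by positivity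
  have D1' : 1 - q ^ 2 * t ^ 4 ≠ 0 := by rwa [mul_comm (q ^ 2)]
  have D2' : 1 - q ^ 6 * t ^ 4 ≠ 0 := by rwa [mul_comm (q ^ 6)]
  have D3' : 1 - q ^ 10 * t ^ 4 ≠ 0 := by rwa [mul_comm (q ^ 10)]
  subst hy
  simp only [af, hf_down Q hq, zf]
  simp only [hf]
  field_simp
  ring

theorem key_BBs_p {q t x y Q : ℝ} (h0 : 0 < q) (h1 : q < 1) (ht : 0 < t) (hx : 0 < x)
    (hy : y = t ^ 2 * q / x) (D0 : q ^ 2 - t ^ 4 ≠ 0) (D1 : 1 - t ^ 4 * q ^ 2 ≠ 0)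
    (D2 : 1 - t ^ 4 * q ^ 6 ≠ 0) (D3 : 1 - t ^ 4 * q ^ 10 ≠ 0) :
      (1 + -q ^ 2) * (t * q) * (x * q ^ 2) * hf q Q (t * q) * (q * y⁻¹) * zf q (x * q ^ 2) + (-q
      ^ 2 * (x * q)) * ((1 + -q ^ 2) * t * (x * q) * hf q Q t) * zf q y =
        q ^ 2 * (x / t) - q ^ 4 * (af q Q (t * q) (x * q) * (x / t) + (x / t) * af q Q t x) := by
  have hq := h0.ne'
  have ht' := ht.ne'
  have hx' := hx.ne'
  have w1 : 1 - q ^ 2 ≠ 0 := by nlinarith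
  have w2 : 1 + q ^ 2 ≠ 0 := by positivity
  have D1' : 1 - q ^ 2 * t ^ 4 ≠ 0 := by rwa [mul_comm (q ^ 2)]
  have D2' : 1 - q ^ 6 * t ^ 4 ≠ 0 := by rwa [mul_comm (q ^ 6)]
  have D3' : 1 - q ^ 10 * t ^ 4 ≠ 0 := by rwa [mul_comm (q ^ 10)]
  subst hy
  simp only [af, hf_up Q, zf]
  simp only [hf]
  field_simp
  ring

theorem key_BA_0 {q t x y Q c : ℝ} (h0 : 0 < q) (h1 : q < 1) (ht : 0 < t) (hx : 0 < x)
    (hy : y = t ^ 2 * q / x) (D0 : q ^ 2 - t ^ 4 ≠ 0) (D1 : 1 - t ^ 4 * q ^ 2 ≠ 0)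
    (D2 : 1 - t ^ 4 * q ^ 6 ≠ 0) (D3 : 1 - t ^ 4 * q ^ 10 ≠ 0)
    (hQ : (c = q ∧ Q = q ^ 2) ∨ (c = q⁻¹ ∧ Q = (q ^ 2)⁻¹)) :
      q * (y * q)⁻¹ * (x / t) * gf q c (t * q) * zf q (x * q) + (((1 + -q ^ 2) * t * x * hf q Q
      t) * af q Q t x + (-q ^ 2 * (x * q⁻¹)) * (x / t) * gf q c t * zf q y) =
        q ^ 2 * ((x / (t * q)) * (-q ^ 2 * x) * gf q c (t * q) * zf q (y * q ^ 2) + (af q Q t (x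
      * q⁻¹) * ((1 + -q ^ 2) * t * x * hf q Q t) + (x * (q ^ 2)⁻¹ / (t * q⁻¹)) * (q * y⁻¹) * gf
      q c t * zf q (x * q⁻¹))) := by
  have hq := h0.ne'
  have ht' := ht.ne'
  have hx' := hx.ne'
  have w1 : 1 - q ^ 2 ≠ 0 := by nlinarith
  have w2 : 1 + q ^ 2 ≠ 0 := by positivity
  have D1' : 1 - q ^ 2 * t ^ 4 ≠ 0 := by rwa [mul_comm (q ^ 2)]
  have D2' : 1 - q ^ 6 * t ^ 4 ≠ 0 := by rwa [mul_comm (q ^ 6)]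
  have D3' : 1 - q ^ 10 * t ^ 4 ≠ 0 := by rwa [mul_comm (q ^ 10)]
  have k0 : 1 + t ^ 2 ≠ 0 := by positivity
  have k1 : 1 + t ^ 2 * q ^ 2 ≠ 0 := by positivity
  have k2 : 1 + t ^ 2 * q ^ 4 ≠ 0 := by positivity
  have k1' : 1 + q ^ 2 * t ^ 2 ≠ 0 := by positivity
  have k2' : 1 + q ^ 4 * t ^ 2 ≠ 0 := by positivity
  have e1 : 1 - (t * q) ^ 4 * q ^ 2 = 1 - t ^ 4 * q ^ 6 := by ring
  have e2 : 1 + (t * q) ^ 2 = 1 + t ^ 2 * q ^ 2 := by ring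
  have e3 : 1 + (t * q) ^ 2 * q ^ 2 = 1 + t ^ 2 * q ^ 4 := by ring
  subst hy
  simp only [af, gf, e1, e2, e3, hf, zf]
  clear e1 e2 e3
  rcases hQ with ⟨rfl, rfl⟩ | ⟨rfl, rfl⟩
  · field_simp
    ring
  · field_simp
    ring

theorem key_ABs_0 {q t x y Q c : ℝ} (h0 : 0 < q) (h1 : q < 1) (ht : 0 < t) (hx : 0 < x)
    (hy : y = t ^ 2 * q / x) (D0 : q ^ 2 - t ^ 4 ≠ 0) (D1 : 1 - t ^ 4 * q ^ 2 ≠ 0)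
    (D2 : 1 - t ^ 4 * q ^ 6 ≠ 0) (D3 : 1 - t ^ 4 * q ^ 10 ≠ 0)
    (hQ : (c = q ∧ Q = q ^ 2) ∨ (c = q⁻¹ ∧ Q = (q ^ 2)⁻¹)) :
      (x * q ^ 2 / (t * q)) * (q * y⁻¹) * gf q c (t * q) * zf q (x * q ^ 2) + (af q Q t (x * q)
      * ((1 + -q ^ 2) * t * (x * q) * hf q Q t) + (x / (t * q⁻¹)) * (-q ^ 2 * x) * gf q c t * zf
      q (y * q⁻¹)) =
        q ^ 2 * ((-q ^ 2 * (x * q)) * (x / t) * gf q c (t * q) * zf q (y * q) + (((1 + -q ^ 2) *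
      t * (x * q) * hf q Q t) * af q Q t x + q * (y * q⁻¹)⁻¹ * (x / t) * gf q c t * zf q x)) := by
  have hq := h0.ne'
  have ht' := ht.ne'
  have hx' := hx.ne'
  have w1 : 1 - q ^ 2 ≠ 0 := by nlinarith
  have w2 : 1 + q ^ 2 ≠ 0 := by positivity
  have D1' : 1 - q ^ 2 * t ^ 4 ≠ 0 := by rwa [mul_comm (q ^ 2)]
  have D2' : 1 - q ^ 6 * t ^ 4 ≠ 0 := by rwa [mul_comm (q ^ 6)]
  have D3' : 1 - q ^ 10 * t ^ 4 ≠ 0 := by rwa [mul_comm (q ^ 10)]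
  have k0 : 1 + t ^ 2 ≠ 0 := by positivity
  have k1 : 1 + t ^ 2 * q ^ 2 ≠ 0 := by positivity
  have k2 : 1 + t ^ 2 * q ^ 4 ≠ 0 := by positivity
  have k1' : 1 + q ^ 2 * t ^ 2 ≠ 0 := by positivity
  have k2' : 1 + q ^ 4 * t ^ 2 ≠ 0 := by positivity
  have e1 : 1 - (t * q) ^ 4 * q ^ 2 = 1 - t ^ 4 * q ^ 6 := by ring
  have e2 : 1 + (t * q) ^ 2 = 1 + t ^ 2 * q ^ 2 := by ring
  have e3 : 1 + (t * q) ^ 2 * q ^ 2 = 1 + t ^ 2 * q ^ 4 := by ring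
  subst hy
  simp only [af, gf, e1, e2, e3, hf, zf]
  clear e1 e2 e3
  rcases hQ with ⟨rfl, rfl⟩ | ⟨rfl, rfl⟩
  · field_simp
    ring
  · field_simp
    ring

theorem key_BsB_0 {q t x y Q c : ℝ} (h0 : 0 < q) (h1 : q < 1) (ht : 0 < t) (hx : 0 < x)
    (hy : y = t ^ 2 * q / x) (D0 : q ^ 2 - t ^ 4 ≠ 0) (D1 : 1 - t ^ 4 * q ^ 2 ≠ 0)
    (D2 : 1 - t ^ 4 * q ^ 6 ≠ 0) (D3 : 1 - t ^ 4 * q ^ 10 ≠ 0)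
    (hQ : (c = q ∧ Q = q ^ 2) ∨ (c = q⁻¹ ∧ Q = (q ^ 2)⁻¹)) :
      (-q ^ 2 * x) * (-q ^ 2 * x) * gf q c (t * q) * (zf q (y * q) * zf q (y * q ^ 2)) + (((1 +
      -q ^ 2) * t * x * hf q Q t) * ((1 + -q ^ 2) * t * x * hf q Q t) * (zf q x * zf q (y * q))
      + (q * y⁻¹) * (q * y⁻¹) * gf q c t * (zf q x * zf q (x * q⁻¹))) =
        af q Q t x - ((x * q / (t * q)) * (x / t) * gf q c (t * q) * (zf q (x * q) * zf q (y *
      q)) + (af q Q t x * af q Q t x + (x * q⁻¹ / (t * q⁻¹)) * (x / t) * gf q c t * (zf q x * zf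
      q y))) := by
  have hq := h0.ne'
  have ht' := ht.ne'
  have hx' := hx.ne'
  have w1 : 1 - q ^ 2 ≠ 0 := by nlinarith
  have w2 : 1 + q ^ 2 ≠ 0 := by positivity
  have D1' : 1 - q ^ 2 * t ^ 4 ≠ 0 := by rwa [mul_comm (q ^ 2)]
  have D2' : 1 - q ^ 6 * t ^ 4 ≠ 0 := by rwa [mul_comm (q ^ 6)]
  have D3' : 1 - q ^ 10 * t ^ 4 ≠ 0 := by rwa [mul_comm (q ^ 10)]
  have k0 : 1 + t ^ 2 ≠ 0 := by positivity
  have k1 : 1 + t ^ 2 * q ^ 2 ≠ 0 := by positivity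
  have k2 : 1 + t ^ 2 * q ^ 4 ≠ 0 := by positivity
  have k1' : 1 + q ^ 2 * t ^ 2 ≠ 0 := by positivity
  have k2' : 1 + q ^ 4 * t ^ 2 ≠ 0 := by positivity
  have e1 : 1 - (t * q) ^ 4 * q ^ 2 = 1 - t ^ 4 * q ^ 6 := by ring
  have e2 : 1 + (t * q) ^ 2 = 1 + t ^ 2 * q ^ 2 := by ring
  have e3 : 1 + (t * q) ^ 2 * q ^ 2 = 1 + t ^ 2 * q ^ 4 := by ring
  subst hy
  simp only [af, gf, e1, e2, e3, hf, zf]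
  clear e1 e2 e3
  rcases hQ with ⟨rfl, rfl⟩ | ⟨rfl, rfl⟩
  · field_simp
    ring
  · field_simp
    ring

theorem key_BBs_0 {q t x y Q c : ℝ} (h0 : 0 < q) (h1 : q < 1) (ht : 0 < t) (hx : 0 < x)
    (hy : y = t ^ 2 * q / x) (D0 : q ^ 2 - t ^ 4 ≠ 0) (D1 : 1 - t ^ 4 * q ^ 2 ≠ 0)
    (D2 : 1 - t ^ 4 * q ^ 6 ≠ 0) (D3 : 1 - t ^ 4 * q ^ 10 ≠ 0)
    (hQ : (c = q ∧ Q = q ^ 2) ∨ (c = q⁻¹ ∧ Q = (q ^ 2)⁻¹)) :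
      (q * y⁻¹) * (q * y⁻¹) * gf q c (t * q) * (zf q (x * q ^ 2) * zf q (x * q)) + (((1 + -q ^
      2) * t * (x * q) * hf q Q t) * ((1 + -q ^ 2) * t * (x * q) * hf q Q t) * (zf q (x * q) *
      zf q y) + (-q ^ 2 * x) * (-q ^ 2 * x) * gf q c t * (zf q (y * q⁻¹) * zf q y)) =
        q ^ 2 * af q Q t x - q ^ 4 * ((x * q / (t * q)) * (x / t) * gf q c (t * q) * (zf q (x *
      q) * zf q (y * q)) + (af q Q t x * af q Q t x + (x * q⁻¹ / (t * q⁻¹)) * (x / t) * gf q c t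
      * (zf q x * zf q y))) := by
  have hq := h0.ne'
  have ht' := ht.ne'
  have hx' := hx.ne'
  have w1 : 1 - q ^ 2 ≠ 0 := by nlinarith
  have w2 : 1 + q ^ 2 ≠ 0 := by positivity
  have D1' : 1 - q ^ 2 * t ^ 4 ≠ 0 := by rwa [mul_comm (q ^ 2)]
  have D2' : 1 - q ^ 6 * t ^ 4 ≠ 0 := by rwa [mul_comm (q ^ 6)]
  have D3' : 1 - q ^ 10 * t ^ 4 ≠ 0 := by rwa [mul_comm (q ^ 10)]
  have k0 : 1 + t ^ 2 ≠ 0 := by positivity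
  have k1 : 1 + t ^ 2 * q ^ 2 ≠ 0 := by positivity
  have k2 : 1 + t ^ 2 * q ^ 4 ≠ 0 := by positivity
  have k1' : 1 + q ^ 2 * t ^ 2 ≠ 0 := by positivity
  have k2' : 1 + q ^ 4 * t ^ 2 ≠ 0 := by positivity
  have e1 : 1 - (t * q) ^ 4 * q ^ 2 = 1 - t ^ 4 * q ^ 6 := by ring
  have e2 : 1 + (t * q) ^ 2 = 1 + t ^ 2 * q ^ 2 := by ring
  have e3 : 1 + (t * q) ^ 2 * q ^ 2 = 1 + t ^ 2 * q ^ 4 := by ring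
  subst hy
  simp only [af, gf, e1, e2, e3, hf, zf]
  clear e1 e2 e3
  rcases hQ with ⟨rfl, rfl⟩ | ⟨rfl, rfl⟩
  · field_simp
    ring
  · field_simp
    ring

theorem gt_mul_self {q : ℝ} (h0 : 0 < q) (h1 : q < 1) (s : ℤˣ) (n : ℤ) :
    gt q s n * gt q s n = gf q (q ^ (s : ℤ)) (q ^ n) := by
  have h := gt_sq h0 h1 s n
  have d1 := den1_ne h0 h1 n
  have k1 : 1 + (q ^ n) ^ 2 ≠ 0 := by positivity
  have k2 : 1 + (q ^ n) ^ 2 * q ^ 2 ≠ 0 := by positivity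
  rw [gf, eq_div_iff (mul_ne_zero (mul_ne_zero (pow_ne_zero 2 d1) k1) k2), ← h]
  ring

theorem facts {q : ℝ} (h0 : 0 < q) (h1 : q < 1) (s : ℤˣ) {n p r : ℤ}
    (h : 0 ≤ n ∧ 0 ≤ p ∧ p ≤ 2 * n + 1) (hr : p + r = 2 * n + 1) :
    (0 < q ^ n ∧ 0 < q ^ p ∧ q ^ r = (q ^ n) ^ 2 * q / q ^ p ∧
      q ^ 2 - (q ^ n) ^ 4 ≠ 0 ∧ 1 - (q ^ n) ^ 4 * q ^ 2 ≠ 0 ∧ 1 - (q ^ n) ^ 4 * q ^ 6 ≠ 0 ∧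
      1 - (q ^ n) ^ 4 * q ^ 10 ≠ 0) ∧
    (rz q p * rz q p = zf q (q ^ p) ∧ rz q (p + 1) * rz q (p + 1) = zf q (q ^ p * q) ∧
      rz q (p + 2) * rz q (p + 2) = zf q (q ^ p * q ^ 2) ∧
      rz q p * (rz q (p + -1) * rz q (p + -1)) = rz q p * zf q (q ^ p * q⁻¹)) ∧
    (rz q r * rz q r = zf q (q ^ r) ∧ rz q (r + 1) * rz q (r + 1) = zf q (q ^ r * q) ∧
      rz q (r + 2) * rz q (r + 2) = zf q (q ^ r * q ^ 2) ∧
      rz q r * (rz q (r + -1) * rz q (r + -1)) = rz q r * zf q (q ^ r * q⁻¹)) ∧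
    (gt q s n * gt q s n = gf q (q ^ (s : ℤ)) (q ^ n) ∧
      gt q s (n + 1) * gt q s (n + 1) = gf q (q ^ (s : ℤ)) (q ^ n * q)) ∧
    ((q ^ (s : ℤ) = q ∧ qs q s = q ^ 2) ∨ (q ^ (s : ℤ) = q⁻¹ ∧ qs q s = (q ^ 2)⁻¹)) := by
  have hq := h0.ne'
  have z1 (m : ℤ) : q ^ (m + 1) = q ^ m * q := zpow_add_one₀ hq m
  have z2 (m : ℤ) : q ^ (m + 2) = q ^ m * q ^ 2 := by rw [zpow_add₀ hq]; norm_cast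
  have zm (m : ℤ) : q ^ (m + -1) = q ^ m * q⁻¹ := by rw [zpow_add₀ hq, zpow_neg_one]
  have sq {m : ℤ} (hm : 0 ≤ m) : rz q m * (rz q (m + -1) * rz q (m + -1)) =
      rz q m * zf q (q ^ m * q⁻¹) := by
    rcases hm.eq_or_lt with h | h
    · rw [← h, rz_zero, zero_mul, zero_mul]
    · rw [rz_sq h0 h1 (by omega), zm]
  have hp : 0 ≤ p := h.2.1
  have hr0 : 0 ≤ r := by omega
  refine ⟨⟨zpow_pos h0 n, zpow_pos h0 p, ?_, ?_, den1_ne h0 h1 n, den3_ne h0 h1 n, ?_⟩,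
    ⟨rz_sq h0 h1 hp, ?_, ?_, sq hp⟩, ⟨rz_sq h0 h1 hr0, ?_, ?_, sq hr0⟩,
    ⟨gt_mul_self h0 h1 s n, ?_⟩, ?_⟩
  · rw [show r = n * 2 + 1 - p by omega, zpow_sub₀ hq, zpow_add_one₀ hq, zpow_mul]
    norm_cast
  · have := den1_ne h0 h1 (n + -1)
    rw [zm] at this
    intro h
    apply this
    have : q ^ 2 = (q ^ n) ^ 4 := by linarith
    field_simp
    rw [this]; ring
  · have := den3_ne h0 h1 (n + 1)
    rw [z1] at this
    intro h; apply this; rw [← h]; ring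
  · rw [rz_sq h0 h1 (by omega), z1]
  · rw [rz_sq h0 h1 (by omega), z2]
  · rw [rz_sq h0 h1 (by omega), z1]
  · rw [rz_sq h0 h1 (by omega), z2]
  · rw [gt_mul_self h0 h1, z1]
  · rcases Int.units_eq_one_or s with rfl | rfl
    · left
      constructor
      · simp
      · simp only [qs]; norm_cast
    · right
      constructor
      · simp
      · simp only [qs, Units.val_neg, Units.val_one, mul_neg, mul_one, zpow_neg]; norm_cast

theorem tri_lin (c d a2 a3 a4 b1 b2 b3 b4 b5 : ℝ) (v1 v2 v3 v4 v5 : Dom) :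
    (c : ℂ) • ((a2 : ℂ) • v2 + (a3 : ℂ) • v3 + (a4 : ℂ) • v4) -
      (d : ℂ) • ((b1 : ℂ) • v1 + (b2 : ℂ) • v2 + (b3 : ℂ) • v3 + (b4 : ℂ) • v4 + (b5 : ℂ) • v5) =
    ((-(d * b1) : ℝ) : ℂ) • v1 + ((c * a2 - d * b2 : ℝ) : ℂ) • v2 +
      ((c * a3 - d * b3 : ℝ) : ℂ) • v3 + ((c * a4 - d * b4 : ℝ) : ℂ) • v4 +
      ((-(d * b5) : ℝ) : ℂ) • v5 := by
  push_cast
  module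

theorem rel_BA {q : ℝ} (h0 : 0 < q) (h1 : q < 1) (s : ℤˣ) :
    opB q s * opA q s = ((q : ℂ) ^ 2) • (opA q s * opB q s) := by
  refine end_ext fun n p h => ?_
  obtain ⟨r, hr⟩ : ∃ r, p + r = 2 * n + 1 := ⟨2 * n + 1 - p, by ring⟩
  have hq := h0.ne'
  have zm1 : q ^ (-1 : ℤ) = q⁻¹ := zpow_neg_one q
  have zm2 : q ^ (-2 : ℤ) = (q ^ 2)⁻¹ := by rw [zpow_neg]; norm_cast
  have z2 : q ^ (2 : ℤ) = q ^ 2 := by norm_cast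
  have c2 : ((q : ℂ) ^ 2) = ((q ^ 2 : ℝ) : ℂ) := by push_cast; rfl
  have c4 : ((q : ℂ) ^ 4) = ((q ^ 4 : ℝ) : ℂ) := by push_cast; rfl
  obtain ⟨⟨ht, hx, hy, D0, D1, D2, D3⟩, ⟨hP0, hP1, hP2, hPm⟩, ⟨hR0, hR1, hR2, hRm⟩, ⟨hg0, hg1⟩,
    hQ⟩ := facts h0 h1 s h hr
  have ht' := ht.ne'
  have hx' := hx.ne'
  rw [(isTri_B h0 h1 s).comp (isTri_A h0 h1 s) n p r hr, LinearMap.smul_apply,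
    (isTri_A h0 h1 s).comp (isTri_B h0 h1 s) n p r hr, zero_add, add_zero, c2, tri_smul]
  apply tri_congr
  all_goals simp only [cAm, cA0, cAp, cBm, cB0, cBp, sub_eq_add_neg, add_assoc, Int.reduceAdd,
    Int.reduceNeg, add_zero, neg_zero, zpow_add₀ hq, zm1, zm2, z2, zpow_one, neg_add_cancel,
    add_neg_cancel, neg_neg]
  · rw [hy]
    field_simp
  · have key := key_BA_m h0 h1 ht hx hy D0 D1 D2 D3 (Q := qs q s)
    linear_combination (gt q s n * rz q p * rz q (p + -1)) * key +
      (gt q s n * rz q p * rz q (p + -1)) * ((1 + -q ^ 2) * (q ^ n * q⁻¹) * (q ^ p * q⁻¹) * hf q (qs q s) ((q ^ n * q⁻¹)) * (q ^ p / q ^ n)) * hR0 +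
      (-(gt q s n * rz q p * rz q (p + -1))) * (q ^ 2 * (q ^ p * q⁻¹ / q ^ n) * ((1 + -q ^ 2) * q ^ n * q ^ p * hf q (qs q s) (q ^ n))) * hR1
  · have key := key_BA_0 h0 h1 ht hx hy D0 D1 D2 D3 hQ
    linear_combination (rz q p * rz q (r + 1)) * key +
      (rz q p * rz q (r + 1)) * (q * (q ^ r * q)⁻¹ * (q ^ p / q ^ n)) * (rz q (p + 1) * rz q (p + 1)) * hg1 +
      (rz q p * rz q (r + 1)) * (q * (q ^ r * q)⁻¹ * (q ^ p / q ^ n)) * gf q (q ^ (s : ℤ)) (q ^ n * q) * hP1 +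
      (rz q p * rz q (r + 1)) * (-q ^ 2 * (q ^ p * q⁻¹) * (q ^ p / q ^ n)) * (rz q r * rz q r) * hg0 +
      (rz q p * rz q (r + 1)) * (-q ^ 2 * (q ^ p * q⁻¹) * (q ^ p / q ^ n)) * gf q (q ^ (s : ℤ)) (q ^ n) * hR0 +
      (-(rz q p * rz q (r + 1))) * (q ^ 2 * ((q ^ p / (q ^ n * q)) * (-q ^ 2 * q ^ p))) * (rz q (r + 2) * rz q (r + 2)) * hg1 +
      (-(rz q p * rz q (r + 1))) * (q ^ 2 * ((q ^ p / (q ^ n * q)) * (-q ^ 2 * q ^ p))) * gf q (q ^ (s : ℤ)) (q ^ n * q) * hR2 +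
      (-rz q (r + 1)) * (q ^ 2 * ((q ^ p * (q ^ 2)⁻¹ / (q ^ n * q⁻¹)) * (q * (q ^ r)⁻¹))) * rz q p * (rz q (p + -1) * rz q (p + -1)) * hg0 +
      (-rz q (r + 1)) * (q ^ 2 * ((q ^ p * (q ^ 2)⁻¹ / (q ^ n * q⁻¹)) * (q * (q ^ r)⁻¹))) * gf q (q ^ (s : ℤ)) (q ^ n) * hPm
  · have key := key_BA_p h0 h1 ht hx hy D0 D1 D2 D3 (Q := qs q s)
    linear_combination (gt q s (n + 1) * rz q (r + 1) * rz q (r + 2)) * key +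
      (gt q s (n + 1) * rz q (r + 1) * rz q (r + 2)) * ((1 + -q ^ 2) * (q ^ n * q) * (q ^ p * q) * hf q (qs q s) ((q ^ n * q)) * (q ^ p / q ^ n)) * hP1 +
      (-(gt q s (n + 1) * rz q (r + 1) * rz q (r + 2))) * (q ^ 2 * (q ^ p * q⁻¹ / q ^ n) * ((1 + -q ^ 2) * q ^ n * q ^ p * hf q (qs q s) (q ^ n))) * hP0
  · field_simp

theorem rel_ABs {q : ℝ} (h0 : 0 < q) (h1 : q < 1) (s : ℤˣ) :
    opA q s * opBs q s = ((q : ℂ) ^ 2) • (opBs q s * opA q s) := by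
  refine end_ext fun n p h => ?_
  obtain ⟨r, hr⟩ : ∃ r, p + r = 2 * n + 1 := ⟨2 * n + 1 - p, by ring⟩
  have hq := h0.ne'
  have zm1 : q ^ (-1 : ℤ) = q⁻¹ := zpow_neg_one q
  have zm2 : q ^ (-2 : ℤ) = (q ^ 2)⁻¹ := by rw [zpow_neg]; norm_cast
  have z2 : q ^ (2 : ℤ) = q ^ 2 := by norm_cast
  have c2 : ((q : ℂ) ^ 2) = ((q ^ 2 : ℝ) : ℂ) := by push_cast; rfl
  have c4 : ((q : ℂ) ^ 4) = ((q ^ 4 : ℝ) : ℂ) := by push_cast; rfl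
  obtain ⟨⟨ht, hx, hy, D0, D1, D2, D3⟩, ⟨hP0, hP1, hP2, hPm⟩, ⟨hR0, hR1, hR2, hRm⟩, ⟨hg0, hg1⟩,
    hQ⟩ := facts h0 h1 s h hr
  have ht' := ht.ne'
  have hx' := hx.ne'
  rw [(isTri_A h0 h1 s).comp (isTri_Bs h0 h1 s) n p r hr, LinearMap.smul_apply,
    (isTri_Bs h0 h1 s).comp (isTri_A h0 h1 s) n p r hr, zero_add, add_zero, c2, tri_smul]
  apply tri_congr
  all_goals simp only [cAm, cA0, cAp, cBm, cB0, cBp, sub_eq_add_neg, add_assoc, Int.reduceAdd,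
    Int.reduceNeg, add_zero, neg_zero, zpow_add₀ hq, zm1, zm2, z2, zpow_one, neg_add_cancel,
    add_neg_cancel, neg_neg]
  · field_simp
  · have key := key_ABs_m h0 h1 ht hx hy D0 D1 D2 D3 (Q := qs q s)
    linear_combination (gt q s n * rz q (r + -1) * rz q r) * key +
      (gt q s n * rz q (r + -1) * rz q r) * (q ^ p * q / q ^ n * ((1 + -q ^ 2) * q ^ n * (q ^ p * q) * hf q (qs q s) (q ^ n))) * hP1 +
      (-(gt q s n * rz q (r + -1) * rz q r)) * (q ^ 2 * ((1 + -q ^ 2) * (q ^ n * q⁻¹) * q ^ p * hf q (qs q s) ((q ^ n * q⁻¹)) * (q ^ p / q ^ n))) * hP0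
  · have key := key_ABs_0 h0 h1 ht hx hy D0 D1 D2 D3 hQ
    linear_combination (rz q (p + 1) * rz q r) * key +
      (rz q (p + 1) * rz q r) * ((q ^ p * q ^ 2 / (q ^ n * q)) * (q * (q ^ r)⁻¹)) * (rz q (p + 2) * rz q (p + 2)) * hg1 +
      (rz q (p + 1) * rz q r) * ((q ^ p * q ^ 2 / (q ^ n * q)) * (q * (q ^ r)⁻¹)) * gf q (q ^ (s : ℤ)) (q ^ n * q) * hP2 +
      rz q (p + 1) * ((q ^ p / (q ^ n * q⁻¹)) * (-q ^ 2 * q ^ p)) * rz q r * (rz q (r + -1) * rz q (r + -1)) * hg0 +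
      rz q (p + 1) * ((q ^ p / (q ^ n * q⁻¹)) * (-q ^ 2 * q ^ p)) * gf q (q ^ (s : ℤ)) (q ^ n) * hRm +
      (-(rz q (p + 1) * rz q r)) * (q ^ 2 * ((-q ^ 2 * (q ^ p * q)) * (q ^ p / q ^ n))) * (rz q (r + 1) * rz q (r + 1)) * hg1 +
      (-(rz q (p + 1) * rz q r)) * (q ^ 2 * ((-q ^ 2 * (q ^ p * q)) * (q ^ p / q ^ n))) * gf q (q ^ (s : ℤ)) (q ^ n * q) * hR1 +
      (-(rz q (p + 1) * rz q r)) * (q ^ 2 * (q * (q ^ r * q⁻¹)⁻¹ * (q ^ p / q ^ n))) * (rz q p * rz q p) * hg0 +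
      (-(rz q (p + 1) * rz q r)) * (q ^ 2 * (q * (q ^ r * q⁻¹)⁻¹ * (q ^ p / q ^ n))) * gf q (q ^ (s : ℤ)) (q ^ n) * hP0
  · have key := key_ABs_p h0 h1 ht hx hy D0 D1 D2 D3 (Q := qs q s)
    linear_combination (gt q s (n + 1) * rz q (p + 2) * rz q (p + 1)) * key +
      (gt q s (n + 1) * rz q (p + 2) * rz q (p + 1)) * (q ^ p * q / q ^ n * ((1 + -q ^ 2) * q ^ n * (q ^ p * q) * hf q (qs q s) (q ^ n))) * hR0 +
      (-(gt q s (n + 1) * rz q (p + 2) * rz q (p + 1))) * (q ^ 2 * ((1 + -q ^ 2) * (q ^ n * q) * (q ^ p * q ^ 2) * hf q (qs q s) ((q ^ n * q)) * (q ^ p / q ^ n))) * hR1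
  · rw [hy]
    field_simp

theorem rel_BsB {q : ℝ} (h0 : 0 < q) (h1 : q < 1) (s : ℤˣ) :
    opBs q s * opB q s = opA q s - opA q s ^ 2 := by
  refine end_ext fun n p h => ?_
  obtain ⟨r, hr⟩ : ∃ r, p + r = 2 * n + 1 := ⟨2 * n + 1 - p, by ring⟩
  have hq := h0.ne'
  have zm1 : q ^ (-1 : ℤ) = q⁻¹ := zpow_neg_one q
  have zm2 : q ^ (-2 : ℤ) = (q ^ 2)⁻¹ := by rw [zpow_neg]; norm_cast
  have z2 : q ^ (2 : ℤ) = q ^ 2 := by norm_cast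
  have c2 : ((q : ℂ) ^ 2) = ((q ^ 2 : ℝ) : ℂ) := by push_cast; rfl
  have c4 : ((q : ℂ) ^ 4) = ((q ^ 4 : ℝ) : ℂ) := by push_cast; rfl
  obtain ⟨⟨ht, hx, hy, D0, D1, D2, D3⟩, ⟨hP0, hP1, hP2, hPm⟩, ⟨hR0, hR1, hR2, hRm⟩, ⟨hg0, hg1⟩,
    hQ⟩ := facts h0 h1 s h hr
  have ht' := ht.ne'
  have hx' := hx.ne'
  have hL := tri_lin 1 1
  simp only [Complex.ofReal_one, one_smul, one_mul] at hL
  rw [(isTri_Bs h0 h1 s).comp (isTri_B h0 h1 s) n p r hr, LinearMap.sub_apply, pow_two,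
    (isTri_A h0 h1 s).comp (isTri_A h0 h1 s) n p r hr, isTri_A h0 h1 s n p r hr]
  simp only [add_neg_cancel, add_zero]
  rw [hL]
  apply tri_congr
  all_goals simp only [cAm, cA0, cAp, cBm, cB0, cBp, sub_eq_add_neg, add_assoc, Int.reduceAdd,
    Int.reduceNeg, add_zero, neg_zero, zpow_add₀ hq, zm1, zm2, z2, zpow_one, neg_add_cancel,
    add_neg_cancel, neg_neg]
  · rw [hy]
    field_simp
  · have key := key_BsB_m h0 h1 ht hx hy D0 D1 D2 D3 (Q := qs q s)
    linear_combination (gt q s n * rz q p * rz q r) * key +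
      (gt q s n * rz q p * rz q r) * (-q ^ 2 * (q ^ p * q⁻¹) * ((1 + -q ^ 2) * q ^ n * q ^ p * hf q (qs q s) (q ^ n))) * hR1 +
      (gt q s n * rz q r) * ((1 + -q ^ 2) * (q ^ n * q⁻¹) * (q ^ p * q⁻¹) * hf q (qs q s) ((q ^ n * q⁻¹)) * (q * (q ^ r)⁻¹)) * hPm
  · have key := key_BsB_0 h0 h1 ht hx hy D0 D1 D2 D3 hQ
    linear_combination 1 * key +
      ((-q ^ 2 * q ^ p) * (-q ^ 2 * q ^ p)) * ((rz q (r + 1) * rz q (r + 1)) * (rz q (r + 2) * rz q (r + 2))) * hg1 +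
      ((-q ^ 2 * q ^ p) * (-q ^ 2 * q ^ p)) * gf q (q ^ (s : ℤ)) (q ^ n * q) * (rz q (r + 2) * rz q (r + 2)) * hR1 +
      ((-q ^ 2 * q ^ p) * (-q ^ 2 * q ^ p)) * gf q (q ^ (s : ℤ)) (q ^ n * q) * zf q (q ^ r * q) * hR2 +
      (((1 + -q ^ 2) * q ^ n * q ^ p * hf q (qs q s) (q ^ n)) * ((1 + -q ^ 2) * q ^ n * q ^ p * hf q (qs q s) (q ^ n))) * (rz q (r + 1) * rz q (r + 1)) * hP0 +
      (((1 + -q ^ 2) * q ^ n * q ^ p * hf q (qs q s) (q ^ n)) * ((1 + -q ^ 2) * q ^ n * q ^ p * hf q (qs q s) (q ^ n))) * zf q (q ^ p) * hR1 +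
      ((q * (q ^ r)⁻¹) * (q * (q ^ r)⁻¹)) * ((rz q p * rz q p) * (rz q (p + -1) * rz q (p + -1))) * hg0 +
      ((q * (q ^ r)⁻¹) * (q * (q ^ r)⁻¹)) * gf q (q ^ (s : ℤ)) (q ^ n) * rz q p * hPm +
      ((q * (q ^ r)⁻¹) * (q * (q ^ r)⁻¹)) * gf q (q ^ (s : ℤ)) (q ^ n) * zf q (q ^ p * q⁻¹) * hP0 +
      1 * ((q ^ p * q / (q ^ n * q)) * (q ^ p / q ^ n)) * ((rz q (p + 1) * rz q (p + 1)) * (rz q (r + 1) * rz q (r + 1))) * hg1 +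
      1 * ((q ^ p * q / (q ^ n * q)) * (q ^ p / q ^ n)) * gf q (q ^ (s : ℤ)) (q ^ n * q) * (rz q (r + 1) * rz q (r + 1)) * hP1 +
      1 * ((q ^ p * q / (q ^ n * q)) * (q ^ p / q ^ n)) * gf q (q ^ (s : ℤ)) (q ^ n * q) * zf q (q ^ p * q) * hR1 +
      1 * ((q ^ p * q⁻¹ / (q ^ n * q⁻¹)) * (q ^ p / q ^ n)) * ((rz q p * rz q p) * (rz q r * rz q r)) * hg0 +
      1 * ((q ^ p * q⁻¹ / (q ^ n * q⁻¹)) * (q ^ p / q ^ n)) * gf q (q ^ (s : ℤ)) (q ^ n) * (rz q r * rz q r) * hP0 +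
      1 * ((q ^ p * q⁻¹ / (q ^ n * q⁻¹)) * (q ^ p / q ^ n)) * gf q (q ^ (s : ℤ)) (q ^ n) * zf q (q ^ p) * hR0
  · have key := key_BsB_p h0 h1 ht hx hy D0 D1 D2 D3 (Q := qs q s)
    linear_combination (gt q s (n + 1) * rz q (p + 1) * rz q (r + 1)) * key +
      (gt q s (n + 1) * rz q (p + 1) * rz q (r + 1)) * ((1 + -q ^ 2) * (q ^ n * q) * (q ^ p * q) * hf q (qs q s) ((q ^ n * q)) * (-q ^ 2 * q ^ p)) * hR2 +
      (gt q s (n + 1) * rz q (p + 1) * rz q (r + 1)) * (q * (q ^ r * q)⁻¹ * ((1 + -q ^ 2) * q ^ n * q ^ p * hf q (qs q s) (q ^ n))) * hP0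
  · rw [hy]
    field_simp

theorem rel_BBs {q : ℝ} (h0 : 0 < q) (h1 : q < 1) (s : ℤˣ) :
    opB q s * opBs q s = ((q : ℂ) ^ 2) • opA q s - ((q : ℂ) ^ 4) • opA q s ^ 2 := by
  refine end_ext fun n p h => ?_
  obtain ⟨r, hr⟩ : ∃ r, p + r = 2 * n + 1 := ⟨2 * n + 1 - p, by ring⟩
  have hq := h0.ne'
  have zm1 : q ^ (-1 : ℤ) = q⁻¹ := zpow_neg_one q
  have zm2 : q ^ (-2 : ℤ) = (q ^ 2)⁻¹ := by rw [zpow_neg]; norm_cast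
  have z2 : q ^ (2 : ℤ) = q ^ 2 := by norm_cast
  have c2 : ((q : ℂ) ^ 2) = ((q ^ 2 : ℝ) : ℂ) := by push_cast; rfl
  have c4 : ((q : ℂ) ^ 4) = ((q ^ 4 : ℝ) : ℂ) := by push_cast; rfl
  obtain ⟨⟨ht, hx, hy, D0, D1, D2, D3⟩, ⟨hP0, hP1, hP2, hPm⟩, ⟨hR0, hR1, hR2, hRm⟩, ⟨hg0, hg1⟩,
    hQ⟩ := facts h0 h1 s h hr
  have ht' := ht.ne'
  have hx' := hx.ne'
  rw [(isTri_B h0 h1 s).comp (isTri_Bs h0 h1 s) n p r hr, LinearMap.sub_apply,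
    LinearMap.smul_apply, LinearMap.smul_apply, pow_two (opA q s),
    (isTri_A h0 h1 s).comp (isTri_A h0 h1 s) n p r hr, isTri_A h0 h1 s n p r hr, c2, c4]
  simp only [neg_add_cancel, add_zero]
  rw [tri_lin]
  apply tri_congr
  all_goals simp only [cAm, cA0, cAp, cBm, cB0, cBp, sub_eq_add_neg, add_assoc, Int.reduceAdd,
    Int.reduceNeg, add_zero, neg_zero, zpow_add₀ hq, zm1, zm2, z2, zpow_one, neg_add_cancel,
    add_neg_cancel, neg_neg]
  · rw [hy]
    field_simp
  · have key := key_BBs_m h0 h1 ht hx hy D0 D1 D2 D3 (Q := qs q s)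
    linear_combination (gt q s n * rz q p * rz q r) * key +
      (gt q s n * rz q p * rz q r) * (q * (q ^ r * q⁻¹)⁻¹ * ((1 + -q ^ 2) * q ^ n * (q ^ p * q) * hf q (qs q s) (q ^ n))) * hP1 +
      (gt q s n * rz q p) * ((1 + -q ^ 2) * (q ^ n * q⁻¹) * q ^ p * hf q (qs q s) ((q ^ n * q⁻¹)) * (-q ^ 2 * q ^ p)) * hRm
  · have key := key_BBs_0 h0 h1 ht hx hy D0 D1 D2 D3 hQ
    linear_combination 1 * key +
      ((q * (q ^ r)⁻¹) * (q * (q ^ r)⁻¹)) * ((rz q (p + 2) * rz q (p + 2)) * (rz q (p + 1) * rz q (p + 1))) * hg1 +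
      ((q * (q ^ r)⁻¹) * (q * (q ^ r)⁻¹)) * gf q (q ^ (s : ℤ)) (q ^ n * q) * (rz q (p + 1) * rz q (p + 1)) * hP2 +
      ((q * (q ^ r)⁻¹) * (q * (q ^ r)⁻¹)) * gf q (q ^ (s : ℤ)) (q ^ n * q) * zf q (q ^ p * q ^ 2) * hP1 +
      (((1 + -q ^ 2) * q ^ n * (q ^ p * q) * hf q (qs q s) (q ^ n)) * ((1 + -q ^ 2) * q ^ n * (q ^ p * q) * hf q (qs q s) (q ^ n))) * (rz q r * rz q r) * hP1 +
      (((1 + -q ^ 2) * q ^ n * (q ^ p * q) * hf q (qs q s) (q ^ n)) * ((1 + -q ^ 2) * q ^ n * (q ^ p * q) * hf q (qs q s) (q ^ n))) * zf q (q ^ p * q) * hR0 +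
      ((-q ^ 2 * q ^ p) * (-q ^ 2 * q ^ p)) * ((rz q r * rz q r) * (rz q (r + -1) * rz q (r + -1))) * hg0 +
      ((-q ^ 2 * q ^ p) * (-q ^ 2 * q ^ p)) * gf q (q ^ (s : ℤ)) (q ^ n) * rz q r * hRm +
      ((-q ^ 2 * q ^ p) * (-q ^ 2 * q ^ p)) * gf q (q ^ (s : ℤ)) (q ^ n) * zf q (q ^ r * q⁻¹) * hR0 +
      q ^ 4 * ((q ^ p * q / (q ^ n * q)) * (q ^ p / q ^ n)) * ((rz q (p + 1) * rz q (p + 1)) * (rz q (r + 1) * rz q (r + 1))) * hg1 +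
      q ^ 4 * ((q ^ p * q / (q ^ n * q)) * (q ^ p / q ^ n)) * gf q (q ^ (s : ℤ)) (q ^ n * q) * (rz q (r + 1) * rz q (r + 1)) * hP1 +
      q ^ 4 * ((q ^ p * q / (q ^ n * q)) * (q ^ p / q ^ n)) * gf q (q ^ (s : ℤ)) (q ^ n * q) * zf q (q ^ p * q) * hR1 +
      q ^ 4 * ((q ^ p * q⁻¹ / (q ^ n * q⁻¹)) * (q ^ p / q ^ n)) * ((rz q p * rz q p) * (rz q r * rz q r)) * hg0 +
      q ^ 4 * ((q ^ p * q⁻¹ / (q ^ n * q⁻¹)) * (q ^ p / q ^ n)) * gf q (q ^ (s : ℤ)) (q ^ n) * (rz q r * rz q r) * hP0 +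
      q ^ 4 * ((q ^ p * q⁻¹ / (q ^ n * q⁻¹)) * (q ^ p / q ^ n)) * gf q (q ^ (s : ℤ)) (q ^ n) * zf q (q ^ p) * hR0
  · have key := key_BBs_p h0 h1 ht hx hy D0 D1 D2 D3 (Q := qs q s)
    linear_combination (gt q s (n + 1) * rz q (p + 1) * rz q (r + 1)) * key +
      (gt q s (n + 1) * rz q (p + 1) * rz q (r + 1)) * ((1 + -q ^ 2) * (q ^ n * q) * (q ^ p * q ^ 2) * hf q (qs q s) ((q ^ n * q)) * (q * (q ^ r)⁻¹)) * hP2 +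
      (gt q s (n + 1) * rz q (p + 1) * rz q (r + 1)) * (-q ^ 2 * (q ^ p * q) * ((1 + -q ^ 2) * q ^ n * (q ^ p * q) * hf q (qs q s) (q ^ n))) * hR0
  · rw [hy]
    field_simp

/-- The representation of `𝒪(S²_q)` on `H_±` (restricted to the span of the basis vectors). -/
def rep (q : ℝ) (hq : 0 < q ∧ q < 1) (s : ℤˣ) : Sphere q →ₐ[ℂ] Module.End ℂ Dom :=
  lift q (opA q s) (opB q s) (opBs q s) (rel_BA hq.1 hq.2 s) (rel_ABs hq.1 hq.2 s)
    (rel_BsB hq.1 hq.2 s) (rel_BBs hq.1 hq.2 s)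

/-! ### Trace class operators and the zeta functions -/

/-- A bounded operator `T` is of trace class: the sum of `⟨e, |T| e⟩` over an orthonormal basis is
finite, where `|T| = (T* T)^{1/2}`. (This does not depend on the basis.) -/
def IsTraceClass {ι H : Type*} [NormedAddCommGroup H] [InnerProductSpace ℂ H] [CompleteSpace H]
    (e : HilbertBasis ι ℂ H) (T : H →L[ℂ] H) : Prop :=
  Summable fun i : ι => (inner ℂ (e i) (CFC.abs T (e i))).re

/-- The orthonormal basis `v^l_k` of the Hilbert space. -/
def stdBasis : HilbertBasis Idx ℂ Hilb := HilbertBasis.ofRepr (LinearIsometryEquiv.refl ℂ Hilb)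

theorem stdBasis_apply (i : Idx) : stdBasis i = toHilb (Finsupp.single i 1) := by
  rw [toHilb, Finsupp.linearCombination_single, one_smul, ← HilbertBasis.repr_symm_single]
  rfl

/-- The closure of the densely defined operator `T` is an everywhere defined bounded operator of
trace class. -/
def HasTraceClassClosure (T : Module.End ℂ Dom) : Prop :=
  ∃ T' : Hilb →L[ℂ] Hilb, (∀ v : Dom, T' (toHilb v) = toHilb (T v)) ∧ IsTraceClass stdBasis T'

/-- The trace, as the sum of the diagonal matrix coefficients with respect to the orthonormal
basis. -/
def trace (T : Module.End ℂ Dom) : ℂ := ∑' i : Idx, T (Finsupp.single i 1) i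

/-- The operator `a K^{2μ} |D|^{-z}` on `H_±`. -/
def zetaOp (q : ℝ) (hq : 0 < q ∧ q < 1) (s : ℤˣ) (μ : ℝ) (a : Sphere q) (z : ℂ) :
    Module.End ℂ Dom :=
  rep q hq s a * opK q (2 * μ) * opAbsD q (-z)

/-- The zeta function `ζ^±_{a K^{2μ}}(z) = tr_{H_±}(a K^{2μ} |D|^{-z})`. -/
def zeta (q : ℝ) (hq : 0 < q ∧ q < 1) (s : ℤˣ) (μ : ℝ) (a : Sphere q) (z : ℂ) : ℂ :=
  trace (zetaOp q hq s μ a z)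

/-- `f` is a meromorphic function on `{Re z > c'}` which agrees with `F` on `{Re z > c}`. -/
def IsMeromorphicContinuation (F : ℂ → ℂ) (c c' : ℝ) (f : ℂ → ℂ) : Prop :=
  MeromorphicOn f {z : ℂ | c' < z.re} ∧ Set.EqOn f F {z : ℂ | c < z.re}

/-- `f` is meromorphic at `z₀` with residue `w` there. -/
def HasResidue (f : ℂ → ℂ) (z₀ w : ℂ) : Prop :=
  MeromorphicAt f z₀ ∧
    ∀ᶠ r : ℝ in 𝓝[>] 0, (2 * (Real.pi : ℂ) * Complex.I)⁻¹ * (∮ z in C(z₀, r), f z) = w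

end Podles

end

noncomputable section

namespace Podles

open scoped Topology

/-! ### Monomials and the scaling automorphisms -/

/-! Since `K` and `|D|` are diagonal, the zeta function sees only the diagonal matrix coefficients
of `a`: with `l = n + 1/2` it is the Dirichlet-type series `∑ₙ cₙ [n+1]^{-z}`, `cₙ = ∑_k q^{2μk}
⟨v^l_k, a v^l_k⟩` (`zeta_eq_qseries`). The relations put every element in the span of `Aⁿ Bᵐ` and
`Aⁿ B*ᵐ` (`monoSpan_eq_top`), so these monomials suffice. For `m > 0` they shift the weight `k` and
have zero diagonal.

For `A^N` one compares with a diagonal model. In every column, `A` differs from the diagonal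
operator with eigenvalues `q^{2(l+k)}` by `O(qⁿ)` in `ℓ¹`-norm, and so does `A^N` from the `N`-th
power of that operator (`colBound_opA_pow_sub`). There are `2n+2` weights, with `q^{2μk} =
O(q^{-2|μ|n})`, so the error contributes coefficients `O((n+1) q^{(1-2|μ|)n})`, whose series is
holomorphic on `Re z > 2|μ| - 1`. The residue comes from the model alone, which does not know the
sign `±`.

For the model, `cₙ` is a geometric sum over `p = l + k`. If `N + μ ≠ 0`, its two ends are multiples
of `q^{-2μn}` and `q^{(2μ+4N)n}` (`continues_lead`). The factorisation `[n+1]^{-z} = (q(q⁻¹-q))^z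
q^{nz} (1-q^{2n+2})^{-z}`, whose last factor is `1 + O(q^{2n})` locally uniformly in `z`, turns `∑
q^{θn}[n+1]^{-z}` into `(q(q⁻¹-q))^z / (1-q^{θ+z})` plus a function holomorphic for `Re z > -θ - 2`.
This has a simple pole at `-θ`. The end `p = 0` has its real pole at `2μ`, and the end `p = 2n+1` at
`-2μ-4N`. Hence `2|μ|` is reached by the first end when `μ ≥ 0`, and by the second when `μ < 0` only
for `N = 0`: in that case the trace concentrates near `k = l`, where `A` tends to `0`, and the
counit appears. When `N + μ = 0` the sum is `2n+2` times an exponential. If `N > 0` it is too small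
to matter; if `N = μ = 0` it gives a double pole, whose residue is the derivative of a regular
factor and produces `log (q⁻¹ - q)` (`continues_succ`).

For `μ ≥ 0` the table says that `(1 - q^{2μ+2n})` times the residue of `Aⁿ` does not depend on `n >
0`, which is exactly what the twisted trace property requires (`twisted_trace`). For `μ < 0` the
normalised residue is the counit. It is multiplicative with commuting values, so only its invariance
under automorphisms is needed (`counit_comp`): the characters form the two lines `A = 0`, `BB* = 0`,
and the counit is their crossing point, the only character with a two-dimensional tangent space.

Trace class follows from summability of the column norms (`hasTraceClassClosure_of_summable`).
Uniqueness of continuation makes the residue a well-defined linear functional. -/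

theorem genB_mul_genA (q : ℝ) : genB q * genA q = ((q : ℂ) ^ 2) • (genA q * genB q) := by
  simpa [genA, genB] using RingQuot.mkAlgHom_rel ℂ (Rel.BA (q := q))

theorem genA_mul_genBs (q : ℝ) : genA q * genBs q = ((q : ℂ) ^ 2) • (genBs q * genA q) := by
  simpa [genA, genBs] using RingQuot.mkAlgHom_rel ℂ (Rel.ABs (q := q))

theorem genBs_mul_genB (q : ℝ) : genBs q * genB q = genA q - genA q ^ 2 := by
  simpa [genA, genB, genBs] using RingQuot.mkAlgHom_rel ℂ (Rel.BsB (q := q))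

theorem genB_mul_genBs (q : ℝ) :
    genB q * genBs q = ((q : ℂ) ^ 2) • genA q - ((q : ℂ) ^ 4) • genA q ^ 2 := by
  simpa [genA, genB, genBs] using RingQuot.mkAlgHom_rel ℂ (Rel.BBs (q := q))

@[simp]
theorem lift_genA (q : ℝ) {R : Type*} [Ring R] [Algebra ℂ R] (a b c : R) (h1 h2 h3 h4) :
    lift q a b c h1 h2 h3 h4 (genA q) = a := by
  simp [lift, genA, gen]

@[simp]
theorem lift_genB (q : ℝ) {R : Type*} [Ring R] [Algebra ℂ R] (a b c : R) (h1 h2 h3 h4) :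
    lift q a b c h1 h2 h3 h4 (genB q) = b := by
  simp [lift, genB, gen]

@[simp]
theorem lift_genBs (q : ℝ) {R : Type*} [Ring R] [Algebra ℂ R] (a b c : R) (h1 h2 h3 h4) :
    lift q a b c h1 h2 h3 h4 (genBs q) = c := by
  simp [lift, genBs, gen]

/-- A subalgebra which contains the generators is everything. -/
theorem mem_of_gens {q : ℝ} (S : Subalgebra ℂ (Sphere q)) (hA : genA q ∈ S) (hB : genB q ∈ S)
    (hBs : genBs q ∈ S) (x : Sphere q) : x ∈ S := by
  obtain ⟨y, rfl⟩ := RingQuot.mkAlgHom_surjective ℂ (Rel q) x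
  induction y using FreeAlgebra.induction with
  | grade0 r => rw [AlgHom.commutes]; exact S.algebraMap_mem r
  | grade1 g => cases g <;> assumption
  | mul a b ha hb => rw [map_mul]; exact S.mul_mem ha hb
  | add a b ha hb => rw [map_add]; exact S.add_mem ha hb

theorem hom_ext {q : ℝ} {R : Type*} [Ring R] [Algebra ℂ R] {f g : Sphere q →ₐ[ℂ] R}
    (hA : f (genA q) = g (genA q)) (hB : f (genB q) = g (genB q))
    (hBs : f (genBs q) = g (genBs q)) : f = g :=
  AlgHom.ext fun x => mem_of_gens (AlgHom.equalizer f g) hA hB hBs x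

theorem genB_mul_genA_pow (q : ℝ) (n : ℕ) :
    genB q * genA q ^ n = ((q : ℂ) ^ (2 * n)) • (genA q ^ n * genB q) := by
  induction n with
  | zero => simp
  | succ n ih =>
    rw [pow_succ, ← mul_assoc, ih, smul_mul_assoc, mul_assoc, genB_mul_genA, mul_smul_comm,
      smul_smul, ← mul_assoc]
    congr 1
    ring

theorem genBs_mul_genA {q : ℝ} (h0 : 0 < q) :
    genBs q * genA q = (((q : ℂ) ^ 2)⁻¹) • (genA q * genBs q) := by
  have : (q : ℂ) ≠ 0 := by exact_mod_cast h0.ne'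
  rw [genA_mul_genBs, smul_smul, inv_mul_cancel₀ (pow_ne_zero _ this), one_smul]

theorem genBs_mul_genA_pow {q : ℝ} (h0 : 0 < q) (n : ℕ) :
    genBs q * genA q ^ n = (((q : ℂ) ^ (2 * n))⁻¹) • (genA q ^ n * genBs q) := by
  induction n with
  | zero => simp
  | succ n ih =>
    rw [pow_succ, ← mul_assoc, ih, smul_mul_assoc, mul_assoc, genBs_mul_genA h0, mul_smul_comm,
      smul_smul, ← mul_assoc]
    congr 1
    rw [← mul_inv]
    congr 1
    ring

/-- The span of the monomials `Aⁿ Bᵐ` and `Aⁿ B*ᵐ`. -/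
def monoSpan (q : ℝ) : Submodule ℂ (Sphere q) :=
  Submodule.span ℂ ({x | ∃ n m : ℕ, x = genA q ^ n * genB q ^ m} ∪
    {x | ∃ n m : ℕ, x = genA q ^ n * genBs q ^ m})

theorem monoB_mem (q : ℝ) (n m : ℕ) : genA q ^ n * genB q ^ m ∈ monoSpan q :=
  Submodule.subset_span (Or.inl ⟨n, m, rfl⟩)

theorem monoBs_mem (q : ℝ) (n m : ℕ) : genA q ^ n * genBs q ^ m ∈ monoSpan q :=
  Submodule.subset_span (Or.inr ⟨n, m, rfl⟩)

/-- The mixed product: `BB*` collapses to a polynomial in `A`, so one power of `B*` is traded for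
powers of `A`. It serves both the spanning argument and the only nontrivial case of the twisted
trace property. -/
theorem genB_mul_monoBs (q : ℝ) (n m : ℕ) :
    genB q * (genA q ^ n * genBs q ^ (m + 1)) =
      ((q : ℂ) ^ (2 * n + 2)) • (genA q ^ (n + 1) * genBs q ^ m) -
      ((q : ℂ) ^ (2 * n + 4)) • (genA q ^ (n + 2) * genBs q ^ m) := by
  rw [← mul_assoc, genB_mul_genA_pow, smul_mul_assoc, pow_succ', mul_assoc, ← mul_assoc (genB q),
    genB_mul_genBs, sub_mul, mul_sub, smul_sub, smul_mul_assoc, smul_mul_assoc, mul_smul_comm,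
    mul_smul_comm, smul_smul, smul_smul, ← mul_assoc, ← mul_assoc, ← pow_succ, ← pow_add,
    ← pow_add, ← pow_add]

theorem genBs_mul_monoB {q : ℝ} (h0 : 0 < q) (n m : ℕ) :
    genBs q * (genA q ^ n * genB q ^ (m + 1)) =
      (((q : ℂ) ^ (2 * n))⁻¹) • (genA q ^ (n + 1) * genB q ^ m) -
      (((q : ℂ) ^ (2 * n))⁻¹) • (genA q ^ (n + 2) * genB q ^ m) := by
  rw [← mul_assoc, genBs_mul_genA_pow h0, smul_mul_assoc, pow_succ', mul_assoc,
    ← mul_assoc (genBs q), genBs_mul_genB, sub_mul, mul_sub, smul_sub, ← mul_assoc, ← mul_assoc,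
    ← pow_succ, ← pow_add]

/-- The elements whose left multiplication preserves the span form a subalgebra. It contains the
generators, hence is everything, and acting on `1` gives the claim. Linear independence of the
monomials is never needed. -/
theorem monoSpan_eq_top {q : ℝ} (h0 : 0 < q) : monoSpan q = ⊤ := by
  let S : Subalgebra ℂ (Sphere q) :=
    { carrier := {x | ∀ y ∈ monoSpan q, x * y ∈ monoSpan q}
      mul_mem' := fun {a b} ha hb y hy => by rw [mul_assoc]; exact ha _ (hb _ hy)
      add_mem' := fun {a b} ha hb y hy => by rw [add_mul]; exact add_mem (ha _ hy) (hb _ hy)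
      algebraMap_mem' := fun r y hy => by
        rw [← Algebra.smul_def]; exact Submodule.smul_mem _ _ hy }
  have key : ∀ x : Sphere q, (∀ n m : ℕ, x * (genA q ^ n * genB q ^ m) ∈ monoSpan q) →
      (∀ n m : ℕ, x * (genA q ^ n * genBs q ^ m) ∈ monoSpan q) → x ∈ S := by
    intro x h1 h2 y hy
    have : monoSpan q ≤ (monoSpan q).comap (LinearMap.mulLeft ℂ x) := by
      refine Submodule.span_le.2 ?_
      rintro _ (⟨n, m, rfl⟩ | ⟨n, m, rfl⟩)
      · exact h1 n m
      · exact h2 n m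
    exact this hy
  rw [eq_top_iff]
  intro x _
  have hx : x ∈ S := by
    refine mem_of_gens S (key _ ?_ ?_) (key _ ?_ ?_) (key _ ?_ ?_) x
    · intro n m; rw [← mul_assoc, ← pow_succ']; exact monoB_mem q _ _
    · intro n m; rw [← mul_assoc, ← pow_succ']; exact monoBs_mem q _ _
    · intro n m
      rw [← mul_assoc, genB_mul_genA_pow, smul_mul_assoc, mul_assoc, ← pow_succ']
      exact Submodule.smul_mem _ _ (monoB_mem q _ _)
    · intro n m
      cases m with
      | zero =>
        rw [pow_zero, mul_one, genB_mul_genA_pow]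
        exact Submodule.smul_mem _ _ (by simpa using monoB_mem q n 1)
      | succ m =>
        rw [genB_mul_monoBs]
        exact sub_mem (Submodule.smul_mem _ _ (monoBs_mem q _ _))
          (Submodule.smul_mem _ _ (monoBs_mem q _ _))
    · intro n m
      cases m with
      | zero =>
        rw [pow_zero, mul_one, genBs_mul_genA_pow h0]
        exact Submodule.smul_mem _ _ (by simpa using monoBs_mem q n 1)
      | succ m =>
        rw [genBs_mul_monoB h0]
        exact sub_mem (Submodule.smul_mem _ _ (monoB_mem q _ _))
          (Submodule.smul_mem _ _ (monoB_mem q _ _))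
    · intro n m
      rw [← mul_assoc, genBs_mul_genA_pow h0, smul_mul_assoc, mul_assoc, ← pow_succ']
      exact Submodule.smul_mem _ _ (monoBs_mem q _ _)
  simpa using hx 1 (by simpa using monoB_mem q 0 0)

/-- Induction over the spanning set of monomials. -/
theorem mono_induction {q : ℝ} (h0 : 0 < q) {P : Sphere q → Prop}
    (hA : ∀ n : ℕ, P (genA q ^ n)) (hB : ∀ n m : ℕ, 0 < m → P (genA q ^ n * genB q ^ m))
    (hBs : ∀ n m : ℕ, 0 < m → P (genA q ^ n * genBs q ^ m))
    (hadd : ∀ x y, P x → P y → P (x + y)) (hsmul : ∀ (c : ℂ) x, P x → P (c • x))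
    (x : Sphere q) : P x := by
  have hx : x ∈ monoSpan q := by rw [monoSpan_eq_top h0]; trivial
  induction hx using Submodule.span_induction with
  | mem x hx =>
    rcases hx with ⟨n, m, rfl⟩ | ⟨n, m, rfl⟩
    · rcases m.eq_zero_or_pos with rfl | hm
      · simpa using hA n
      · exact hB n m hm
    · rcases m.eq_zero_or_pos with rfl | hm
      · simpa using hA n
      · exact hBs n m hm
  | zero => simpa using hsmul 0 _ (hA 0)
  | add x y _ _ hx hy => exact hadd x y hx hy
  | smul c x _ hx => exact hsmul c x hx

/-- The endomorphism `A ↦ A`, `B ↦ y B`, `B* ↦ y⁻¹ B*`. -/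
def scaleHom (q : ℝ) (y : ℂ) (hy : y ≠ 0) : Sphere q →ₐ[ℂ] Sphere q :=
  lift q (genA q) (y • genB q) (y⁻¹ • genBs q)
    (by rw [smul_mul_assoc, mul_smul_comm, genB_mul_genA, smul_comm])
    (by rw [smul_mul_assoc, mul_smul_comm, genA_mul_genBs, smul_comm])
    (by rw [smul_mul_assoc, mul_smul_comm, genBs_mul_genB, smul_smul, inv_mul_cancel₀ hy,
      one_smul])
    (by rw [smul_mul_assoc, mul_smul_comm, genB_mul_genBs, smul_smul, mul_inv_cancel₀ hy,
      one_smul])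

/-- The automorphism `A ↦ A`, `B ↦ y B`, `B* ↦ y⁻¹ B*`. -/
def scale (q : ℝ) (y : ℂ) (hy : y ≠ 0) : Sphere q ≃ₐ[ℂ] Sphere q :=
  AlgEquiv.ofAlgHom (scaleHom q y hy) (scaleHom q y⁻¹ (inv_ne_zero hy))
    (hom_ext (by simp [scaleHom]) (by simp [scaleHom, smul_smul, hy])
      (by simp [scaleHom, smul_smul, hy]))
    (hom_ext (by simp [scaleHom]) (by simp [scaleHom, smul_smul, hy])
      (by simp [scaleHom, smul_smul, hy]))

theorem scale_genA (q : ℝ) (y : ℂ) (hy : y ≠ 0) : scale q y hy (genA q) = genA q := by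
  simp [scale, scaleHom]

theorem scale_genB (q : ℝ) (y : ℂ) (hy : y ≠ 0) : scale q y hy (genB q) = y • genB q := by
  simp [scale, scaleHom]

theorem scale_genBs (q : ℝ) (y : ℂ) (hy : y ≠ 0) : scale q y hy (genBs q) = y⁻¹ • genBs q := by
  simp [scale, scaleHom]

/-! ### Right multiplication on monomials and twisted traces -/

theorem genB_pow_mul_genA (q : ℝ) (m : ℕ) :
    genB q ^ m * genA q = ((q : ℂ) ^ (2 * m)) • (genA q * genB q ^ m) := by
  induction m with
  | zero => simp
  | succ m ih =>
    rw [pow_succ, mul_assoc, genB_mul_genA, mul_smul_comm, ← mul_assoc, ih, smul_mul_assoc,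
      smul_smul, mul_assoc]
    congr 1
    ring

theorem genBs_pow_mul_genA {q : ℝ} (h0 : 0 < q) (m : ℕ) :
    genBs q ^ m * genA q = (((q : ℂ) ^ (2 * m))⁻¹) • (genA q * genBs q ^ m) := by
  induction m with
  | zero => simp
  | succ m ih =>
    rw [pow_succ, mul_assoc, genBs_mul_genA h0, mul_smul_comm, ← mul_assoc, ih, smul_mul_assoc,
      smul_smul, mul_assoc, ← mul_inv]
    congr 2
    ring

theorem monoB_mul_genA (q : ℝ) (n m : ℕ) : genA q ^ n * genB q ^ m * genA q =
    ((q : ℂ) ^ (2 * m)) • (genA q ^ (n + 1) * genB q ^ m) := by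
  rw [mul_assoc, genB_pow_mul_genA, mul_smul_comm, ← mul_assoc, ← pow_succ]

theorem monoBs_mul_genA {q : ℝ} (h0 : 0 < q) (n m : ℕ) : genA q ^ n * genBs q ^ m * genA q =
    (((q : ℂ) ^ (2 * m))⁻¹) • (genA q ^ (n + 1) * genBs q ^ m) := by
  rw [mul_assoc, genBs_pow_mul_genA h0, mul_smul_comm, ← mul_assoc, ← pow_succ]

theorem monoBs_mul_genB {q : ℝ} (h0 : 0 < q) (n m : ℕ) :
    genA q ^ n * genBs q ^ (m + 1) * genB q =
      (((q : ℂ) ^ (2 * m))⁻¹) • (genA q ^ (n + 1) * genBs q ^ m) -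
      (((q : ℂ) ^ (4 * m))⁻¹) • (genA q ^ (n + 2) * genBs q ^ m) := by
  have h : genBs q ^ m * genA q ^ 2 = (((q : ℂ) ^ (4 * m))⁻¹) • (genA q ^ 2 * genBs q ^ m) := by
    rw [pow_two, ← mul_assoc, genBs_pow_mul_genA h0, smul_mul_assoc, mul_assoc,
      genBs_pow_mul_genA h0, mul_smul_comm, smul_smul, ← mul_assoc, ← mul_inv]
    congr 2
    ring
  rw [pow_succ (genBs q), ← mul_assoc, mul_assoc _ (genBs q), genBs_mul_genB, mul_sub, mul_assoc,
    mul_assoc, h, genBs_pow_mul_genA h0, mul_smul_comm, mul_smul_comm, ← mul_assoc, ← mul_assoc,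
    ← pow_succ, ← pow_add]

theorem monoB_mul_genBs (q : ℝ) (n m : ℕ) :
    genA q ^ n * genB q ^ (m + 1) * genBs q =
      ((q : ℂ) ^ (2 * m + 2)) • (genA q ^ (n + 1) * genB q ^ m) -
      ((q : ℂ) ^ (4 * m + 4)) • (genA q ^ (n + 2) * genB q ^ m) := by
  have h : genB q ^ m * genA q ^ 2 = ((q : ℂ) ^ (4 * m)) • (genA q ^ 2 * genB q ^ m) := by
    rw [pow_two, ← mul_assoc, genB_pow_mul_genA, smul_mul_assoc, mul_assoc,
      genB_pow_mul_genA, mul_smul_comm, smul_smul, ← mul_assoc]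
    congr 1
    ring
  rw [pow_succ (genB q), ← mul_assoc, mul_assoc _ (genB q), genB_mul_genBs, mul_sub, mul_assoc,
    mul_assoc, mul_smul_comm, mul_smul_comm, mul_smul_comm, mul_smul_comm, h, genB_pow_mul_genA,
    mul_smul_comm, mul_smul_comm, smul_smul, smul_smul, ← mul_assoc, ← mul_assoc, ← pow_succ,
    ← pow_add (genA q)]
  congr 2 <;> ring

/-- A functional that vanishes on the monomials `Aⁿ Bᵐ`, `Aⁿ B*ᵐ` with `m > 0` and for which
`(1 - y q^{2n}) τ(Aⁿ)` does not depend on `n > 0` is a trace twisted by `scale q y`. -/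
theorem twisted_trace {q : ℝ} (h0 : 0 < q) (y : ℂ) (hy : y ≠ 0) (τ : Sphere q →ₗ[ℂ] ℂ)
    (hB : ∀ n m : ℕ, 0 < m → τ (genA q ^ n * genB q ^ m) = 0)
    (hBs : ∀ n m : ℕ, 0 < m → τ (genA q ^ n * genBs q ^ m) = 0)
    (hA : ∀ n : ℕ, (1 - y * (q : ℂ) ^ (2 * (n + 1))) * τ (genA q ^ (n + 1)) =
      (1 - y * (q : ℂ) ^ (2 * (n + 2))) * τ (genA q ^ (n + 2)))
    (a b : Sphere q) : τ (a * b) = τ (scale q y hy b * a) := by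
  have hq : (q : ℂ) ≠ 0 := by exact_mod_cast h0.ne'
  -- The good `b` are closed under products because `τ(a b c) = τ(σ(c) a b) = τ(σ(b) σ(c) a)`; so
  -- testing generators `b` against monomials `a` is enough.
  let S : Subalgebra ℂ (Sphere q) :=
    { carrier := {b | ∀ a, τ (a * b) = τ (scale q y hy b * a)}
      mul_mem' := fun {b c} hb hc a => by
        rw [← mul_assoc, hc, ← mul_assoc, hb, ← mul_assoc, ← map_mul (scale q y hy)]
      add_mem' := fun {b c} hb hc a => by rw [mul_add, map_add, hb, hc, map_add, add_mul, map_add]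
      algebraMap_mem' := fun r a => by
        rw [AlgEquiv.commutes, Algebra.commutes] }
  have key : ∀ b : Sphere q, (∀ n : ℕ, τ (genA q ^ n * b) = τ (scale q y hy b * genA q ^ n)) →
      (∀ n m : ℕ, 0 < m → τ (genA q ^ n * genB q ^ m * b) =
        τ (scale q y hy b * (genA q ^ n * genB q ^ m))) →
      (∀ n m : ℕ, 0 < m → τ (genA q ^ n * genBs q ^ m * b) =
        τ (scale q y hy b * (genA q ^ n * genBs q ^ m))) → b ∈ S := fun b k1 k2 k3 =>
    mono_induction h0 k1 k2 k3
      (fun x z hx hz => by rw [add_mul, map_add, hx, hz, mul_add, map_add])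
      (fun c x hx => by rw [smul_mul_assoc, map_smul, hx, mul_smul_comm, map_smul])
  refine mem_of_gens S (key _ (fun n => ?_) (fun n m hm => ?_) (fun n m hm => ?_))
    (key _ (fun n => ?_) (fun n m hm => ?_) (fun n m hm => ?_))
    (key _ (fun n => ?_) (fun n m hm => ?_) (fun n m hm => ?_)) b a
  · rw [scale_genA, ← pow_succ, ← pow_succ']
  · rw [scale_genA, monoB_mul_genA, ← mul_assoc, ← pow_succ', map_smul, hB _ _ hm, smul_zero]
  · rw [scale_genA, monoBs_mul_genA h0, ← mul_assoc, ← pow_succ', map_smul, hBs _ _ hm, smul_zero]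
  · have := hB n 1 one_pos
    rw [pow_one] at this
    rw [scale_genB, smul_mul_assoc, genB_mul_genA_pow, map_smul, map_smul, this, smul_zero,
      smul_zero]
  · rw [scale_genB, smul_mul_assoc, ← mul_assoc, genB_mul_genA_pow, smul_mul_assoc, mul_assoc,
      mul_assoc, ← pow_succ, ← pow_succ', map_smul, map_smul, hB _ _ m.succ_pos, smul_zero,
      smul_zero]
  -- In the mixed case both sides are combinations of `A^{n+1} B*^m` and `A^{n+2} B*^m`. They vanish
  -- under `τ` for `m > 0`; for `m = 0` the identity is precisely `hA n`.
  · obtain ⟨m, rfl⟩ := Nat.exists_eq_succ_of_ne_zero hm.ne'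
    rw [scale_genB, smul_mul_assoc, Nat.succ_eq_add_one, genB_mul_monoBs, monoBs_mul_genB h0]
    simp only [map_sub, map_smul, smul_eq_mul]
    rcases m.eq_zero_or_pos with rfl | hm'
    · have := hA n
      simp only [mul_zero, pow_zero, inv_one, one_mul, mul_one]
      linear_combination this
    · simp [hBs _ _ hm']
  · have := hBs n 1 one_pos
    rw [pow_one] at this
    rw [scale_genBs, smul_mul_assoc, genBs_mul_genA_pow h0, map_smul, map_smul, this, smul_zero,
      smul_zero]
  · obtain ⟨m, rfl⟩ := Nat.exists_eq_succ_of_ne_zero hm.ne'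
    rw [scale_genBs, smul_mul_assoc, Nat.succ_eq_add_one, genBs_mul_monoB h0, monoB_mul_genBs]
    simp only [map_sub, map_smul, smul_eq_mul]
    rcases m.eq_zero_or_pos with rfl | hm'
    · have := hA n
      simp only [mul_zero, pow_zero, zero_add, mul_one]
      have h2 := pow_ne_zero (2 * n) hq
      field_simp
      linear_combination -this
    · simp [hB _ _ hm']
  · rw [scale_genBs, smul_mul_assoc, ← mul_assoc, genBs_mul_genA_pow h0, smul_mul_assoc, mul_assoc,
      mul_assoc, ← pow_succ, ← pow_succ', map_smul, map_smul, hBs _ _ m.succ_pos, smul_zero,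
      smul_zero]

/-! ### Invariance of the counit under automorphisms -/

/-- The first order neighbourhood of the counit: the algebra of functions on it is
`ℂ ⊕ (ker ε / (ker ε)²)`, which has dimension `3`. -/
def jet (q : ℝ) : Sphere q →ₐ[ℂ] TrivSqZeroExt ℂ (ℂ × ℂ) :=
  lift q 0 (TrivSqZeroExt.inr (1, 0)) (TrivSqZeroExt.inr (0, 1)) (by simp) (by simp)
    (by simp) (by simp)

theorem fst_jet (q : ℝ) (x : Sphere q) : (jet q x).fst = counit q x := by
  have : (TrivSqZeroExt.fstHom ℂ ℂ (ℂ × ℂ)).comp (jet q) = counit q :=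
    hom_ext (by simp [jet, counit]) (by simp [jet, counit]) (by simp [jet, counit])
  rw [← this]
  rfl

/-- The subalgebra of those elements of a trivial square zero extension whose second component
is killed by a linear functional. -/
def sndKer (φ : ℂ × ℂ →ₗ[ℂ] ℂ) : Subalgebra ℂ (TrivSqZeroExt ℂ (ℂ × ℂ)) where
  carrier := {x | φ x.snd = 0}
  mul_mem' {a b} ha hb := by
    simp only [Set.mem_ofPred_eq] at *
    simp [TrivSqZeroExt.snd_mul, ha, hb]
  add_mem' {a b} ha hb := by
    simp only [Set.mem_ofPred_eq] at *
    simp [ha, hb]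
  algebraMap_mem' r := by
    simp [TrivSqZeroExt.algebraMap_eq_inl]

/-- As `σ` is onto and the jets of `B`, `B*` span the square-zero ideal, `jet ∘ σ` is onto. Thus the
images of the generators cannot all lie in a proper subalgebra cut out by a nonzero `φ`. -/
theorem jet_comp_mem {q : ℝ} (σ : Sphere q ≃ₐ[ℂ] Sphere q) (φ : ℂ × ℂ →ₗ[ℂ] ℂ)
    (hA : jet q (σ (genA q)) ∈ sndKer φ) (hB : jet q (σ (genB q)) ∈ sndKer φ)
    (hBs : jet q (σ (genBs q)) ∈ sndKer φ) : φ = 0 := by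
  have h : ∀ x, jet q x ∈ sndKer φ := fun x => by
    have := mem_of_gens ((sndKer φ).comap ((jet q).comp (σ : Sphere q →ₐ[ℂ] Sphere q))) hA hB hBs
      (σ.symm x)
    simpa using this
  have h1 : φ (1, 0) = 0 := by
    have : φ (jet q (genB q)).snd = 0 := h (genB q)
    simpa [jet] using this
  have h2 : φ (0, 1) = 0 := by
    have : φ (jet q (genBs q)).snd = 0 := h (genBs q)
    simpa [jet] using this
  ext <;> simp [h1, h2]

theorem exists_functional (v : ℂ × ℂ) : ∃ φ : ℂ × ℂ →ₗ[ℂ] ℂ, φ ≠ 0 ∧ φ v = 0 := by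
  by_cases h : v = 0
  · refine ⟨LinearMap.fst ℂ ℂ ℂ, fun h' => ?_, by simp [h]⟩
    simpa using LinearMap.congr_fun h' (1, 0)
  · refine ⟨v.2 • LinearMap.fst ℂ ℂ ℂ - v.1 • LinearMap.snd ℂ ℂ ℂ, fun h' => h ?_, by
      simp [mul_comm]⟩
    have h1 := LinearMap.congr_fun h' (1, 0)
    have h2 := LinearMap.congr_fun h' (0, 1)
    simp at h1 h2
    exact Prod.ext h2 h1

/-- An automorphism carries the tangent space at the counit isomorphically onto the one at the image
character. At any other character that space is at most one-dimensional, so the counit must be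
fixed. -/
theorem counit_comp {q : ℝ} (h0 : 0 < q) (h1 : q < 1) (σ : Sphere q ≃ₐ[ℂ] Sphere q) (x : Sphere q) :
    counit q (σ x) = counit q x := by
  have hq : (q : ℂ) ≠ 0 := by exact_mod_cast h0.ne'
  have hq2 : (1 - (q : ℂ) ^ 2) ≠ 0 := by
    have : 1 - q ^ 2 ≠ 0 := by nlinarith
    exact_mod_cast this
  have e1 := congrArg (fun x => jet q (σ x)) (genB_mul_genA q)
  have e2 := congrArg (fun x => jet q (σ x)) (genA_mul_genBs q)
  have e3 := congrArg (fun x => jet q (σ x)) (genBs_mul_genB q)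
  have e4 := congrArg (fun x => jet q (σ x)) (genB_mul_genBs q)
  have mem := fun φ => jet_comp_mem σ φ
  simp only [map_mul, map_smul, map_sub, map_pow] at e1 e2 e3 e4
  have fA := fst_jet q (σ (genA q))
  have fB := fst_jet q (σ (genB q))
  have fBs := fst_jet q (σ (genBs q))
  generalize jet q (σ (genA q)) = a at *
  generalize jet q (σ (genB q)) = b at *
  generalize jet q (σ (genBs q)) = c at *
  -- The jets commute, so the relation `BA = q² AB` becomes `(1 - q²) ab = 0`.
  have ab : a * b = 0 := by
    have : (1 - (q : ℂ) ^ 2) • (a * b) = 0 := by rw [sub_smul, one_smul, ← e1, mul_comm, sub_self]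
    exact (smul_eq_zero.1 this).resolve_left hq2
  have ac : a * c = 0 := by
    have : (1 - (q : ℂ) ^ 2) • (c * a) = 0 := by rw [sub_smul, one_smul, ← e2, mul_comm, sub_self]
    rw [mul_comm]
    exact (smul_eq_zero.1 this).resolve_left hq2
  have unit_of {u : TrivSqZeroExt ℂ (ℂ × ℂ)} (hu : u.fst ≠ 0) : IsUnit u :=
    TrivSqZeroExt.isUnit_iff_isUnit_fst.2 hu.isUnit
  -- Otherwise `b` is a unit, which forces `a = 0` and then `c = 0`. The single vector `b.snd` would
  -- have to span `ℂ²`.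
  have hb : b.fst = 0 := by
    by_contra h
    have ha : a = 0 := by
      exact (unit_of h).mul_left_eq_zero.1 ab
    have hc : c = 0 := by
      exact (unit_of h).mul_left_eq_zero.1 (by rw [e3, ha]; simp)
    obtain ⟨φ, hφ, hφ'⟩ := exists_functional b.snd
    exact hφ (mem φ (by rw [ha]; exact zero_mem _) hφ' (by rw [hc]; exact zero_mem _))
  have hc : c.fst = 0 := by
    by_contra h
    have ha : a = 0 := by
      exact (unit_of h).mul_left_eq_zero.1 ac
    have hb : b = 0 := by
      exact (unit_of h).mul_left_eq_zero.1 (by rw [mul_comm, e3, ha]; simp)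
    obtain ⟨φ, hφ, hφ'⟩ := exists_functional c.snd
    exact hφ (mem φ (by rw [ha]; exact zero_mem _) (by rw [hb]; exact zero_mem _) hφ')
  -- With `B`, `B*` sent to `0`, the last two relations read `a = a²` and `q² a = q⁴ a²`, which are
  -- compatible only at `a = 0`.
  have ha : a.fst = 0 := by
    have e3' := congrArg TrivSqZeroExt.fst e3
    have e4' := congrArg TrivSqZeroExt.fst e4
    simp only [TrivSqZeroExt.fst_mul, TrivSqZeroExt.fst_sub, TrivSqZeroExt.fst_smul,
      TrivSqZeroExt.fst_pow, hb, hc, mul_zero, smul_eq_mul] at e3' e4'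
    have : (q : ℂ) ^ 2 * (1 - (q : ℂ) ^ 2) * a.fst = 0 := by
      linear_combination (q : ℂ) ^ 4 * e3' - e4'
    simpa [hq, hq2] using this
  have : (counit q).comp (σ : Sphere q →ₐ[ℂ] Sphere q) = counit q :=
    hom_ext (by simpa [counit, ha] using fA.symm) (by simpa [counit, hb] using fB.symm)
      (by simpa [counit, hc] using fBs.symm)
  exact AlgHom.congr_fun this x

/-! ### Estimates for the matrix coefficients -/

theorem inv_sub_pos {q : ℝ} (h0 : 0 < q) (h1 : q < 1) : 0 < q⁻¹ - q := by
  have := sub_inv_neg h0 h1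
  linarith

/-- No sign condition on `m` is imposed: the real square root vanishes on negative numbers. Boundary
labels do lead to negative arguments such as `p - 1 = -1`. -/
theorem rz_sq_le {q : ℝ} (h0 : 0 < q) (h1 : q < 1) (m : ℤ) :
    rz q m ^ 2 ≤ (q⁻¹ - q)⁻¹ * (q ^ m)⁻¹ := by
  have hk := inv_sub_pos h0 h1
  have hm := zpow_pos h0 m
  rw [rz]
  rcases le_total (qz q m) 0 with h | h
  · rw [Real.sqrt_eq_zero_of_nonpos h, zero_pow two_ne_zero]
    exact mul_nonneg (inv_pos.2 hk).le (inv_pos.2 hm).le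
  · have e : qz q m = (q⁻¹ - q)⁻¹ * ((q ^ m)⁻¹ - q ^ m) := by
      rw [qz, ← neg_sub q⁻¹ q, ← neg_sub (q ^ m)⁻¹, neg_div_neg_eq, div_eq_inv_mul]
    rw [Real.sq_sqrt h, e]
    gcongr
    linarith

/-- Read off from `gt_sq`, as the denominator there is at least `(1-q²)²`. The sixth power of `qⁿ`
is what absorbs the growth of the `q`-numbers under the square roots. -/
theorem gt_sq_le {q : ℝ} (h0 : 0 < q) (h1 : q < 1) (s : ℤˣ) {n : ℤ} (hn : 0 ≤ n) :
    gt q s n ^ 2 ≤ q ^ (s : ℤ) / q ^ 2 * (q ^ n) ^ 6 := by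
  have ht := zpow_pos h0 n
  have ht1 : q ^ n ≤ 1 := zpow_le_one₀ h0 h1.le hn
  have hG := zpow_pos h0 (s : ℤ)
  have h := gt_sq h0 h1 s n
  have hw : 0 < 1 - q ^ 2 := by nlinarith
  generalize q ^ n = t at *
  have ht4 : t ^ 4 ≤ 1 := pow_le_one₀ ht.le ht1
  have hD : (1 - q ^ 2) ^ 2 ≤ (1 - t ^ 4 * q ^ 2) ^ 2 * (1 + t ^ 2) * (1 + t ^ 2 * q ^ 2) := by
    have a1 : (1 - q ^ 2) ^ 2 ≤ (1 - t ^ 4 * q ^ 2) ^ 2 := by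
      gcongr
      nlinarith [sq_nonneg q]
    calc (1 - q ^ 2) ^ 2 = (1 - q ^ 2) ^ 2 * 1 * 1 := by ring
      _ ≤ _ := by
        gcongr
        · nlinarith [sq_nonneg t]
        · nlinarith [mul_nonneg (sq_nonneg t) (sq_nonneg q)]
  have h2 : gt q s n ^ 2 * (1 - q ^ 2) ^ 2 ≤
      (q ^ (s : ℤ) / q ^ 2 * t ^ 6) * (1 - q ^ 2) ^ 2 := by
    calc _ ≤ _ := mul_le_mul_of_nonneg_left hD (sq_nonneg _)
      _ = _ := by rw [h]; ring
  exact le_of_mul_le_mul_right h2 (by positivity)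

/-- The constant in the estimates of `hf`. -/
def hfBound (q : ℝ) (s : ℤˣ) : ℝ := (5 + qs q s) / (1 - q ^ 2) ^ 2

theorem hfBound_nonneg {q : ℝ} (h0 : 0 < q) (s : ℤˣ) : 0 ≤ hfBound q s := by
  have : 0 < qs q s := zpow_pos h0 _
  unfold hfBound
  positivity

/-- `hf` is a rational function of `t²` with value `1` at `t = 0`. The constant is a generous
term-by-term bound of the numerator of the difference over a lower bound of the denominator. -/
theorem abs_hf_sub_one_le {q : ℝ} (h0 : 0 < q) (h1 : q < 1) (s : ℤˣ) {n : ℤ} (hn : 0 ≤ n) :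
    |hf q (qs q s) (q ^ n) - 1| ≤ hfBound q s * (q ^ n) ^ 2 := by
  have ht := zpow_pos h0 n
  have ht1 : q ^ n ≤ 1 := zpow_le_one₀ h0 h1.le hn
  have d1 := den1_ne h0 h1 n
  have d3 := den3_ne h0 h1 n
  have hQ : 0 < qs q s := zpow_pos h0 _
  have hw : 0 < 1 - q ^ 2 := by nlinarith
  rw [hfBound]
  generalize q ^ n = t at *
  generalize qs q s = Q at *
  have ht2 : t ^ 2 ≤ 1 := pow_le_one₀ ht.le ht1
  have ht4 : t ^ 4 ≤ 1 := pow_le_one₀ ht.le ht1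
  have hq2 : q ^ 2 ≤ 1 := pow_le_one₀ h0.le h1.le
  have hq6 : q ^ 6 ≤ q ^ 2 := pow_le_pow_of_le_one h0.le h1.le (by norm_num)
  have D1 : 1 - q ^ 2 ≤ 1 - t ^ 4 * q ^ 2 := by
    nlinarith [mul_le_mul_of_nonneg_right ht4 (sq_nonneg q)]
  have D3 : 1 - q ^ 2 ≤ 1 - t ^ 4 * q ^ 6 := by
    nlinarith [mul_le_mul ht4 hq6 (by positivity) zero_le_one]
  have e : hf q Q t - 1 = t ^ 2 * (t ^ 2 * q ^ 4 - (1 + Q) * q ^ 2 + t ^ 2 * q ^ 2 + t ^ 2 * q ^ 6 -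
      t ^ 6 * q ^ 8) / ((1 - t ^ 4 * q ^ 2) * (1 - t ^ 4 * q ^ 6)) := by
    rw [hf, div_sub_one (mul_ne_zero d1 d3)]
    congr 1
    ring
  have b (i j : ℕ) : 0 ≤ t ^ i * q ^ j ∧ t ^ i * q ^ j ≤ 1 :=
    ⟨by positivity, mul_le_one₀ (pow_le_one₀ ht.le ht1) (by positivity)
      (pow_le_one₀ h0.le h1.le)⟩
  have hN : |t ^ 2 * q ^ 4 - (1 + Q) * q ^ 2 + t ^ 2 * q ^ 2 + t ^ 2 * q ^ 6 - t ^ 6 * q ^ 8| ≤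
      5 + Q := by
    have := b 2 4; have := b 2 2; have := b 2 6; have := b 6 8
    have c1 : 0 ≤ (1 + Q) * q ^ 2 := by positivity
    have c2 : (1 + Q) * q ^ 2 ≤ 1 + Q := mul_le_of_le_one_right (by positivity) hq2
    rw [abs_le]
    constructor <;> linarith
  rw [e, abs_div, abs_mul, abs_of_pos (show 0 < t ^ 2 by positivity),
    abs_of_pos (mul_pos (hw.trans_le D1) (hw.trans_le D3)), div_mul_eq_mul_div, mul_comm (t ^ 2)]
  rw [pow_two (1 - q ^ 2)]
  have := hw.le.trans D1
  gcongr

theorem abs_hf_le {q : ℝ} (h0 : 0 < q) (h1 : q < 1) (s : ℤˣ) {n : ℤ} (hn : 0 ≤ n) :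
    |hf q (qs q s) (q ^ n)| ≤ 1 + hfBound q s := by
  have h := abs_hf_sub_one_le h0 h1 s hn
  have ht := zpow_pos h0 n
  have ht1 : q ^ n ≤ 1 := zpow_le_one₀ h0 h1.le hn
  have hH := hfBound_nonneg h0 s
  have h2 : hfBound q s * (q ^ n) ^ 2 ≤ hfBound q s :=
    mul_le_of_le_one_right hH (pow_le_one₀ ht.le ht1)
  have := abs_add_le (hf q (qs q s) (q ^ n) - 1) 1
  rw [sub_add_cancel, abs_one] at this
  linarith

/-- As `hf → 1`, the constant term of `af` tends to `0` and the coefficient of `x²` to `1`. A first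
power of `qⁿ` is kept, since the off-diagonal coefficients are bounded to that order. -/
theorem abs_cA0_sub_le {q : ℝ} (h0 : 0 < q) (h1 : q < 1) (s : ℤˣ) {n p r : ℤ} (hn : 0 ≤ n)
    (hp : 0 ≤ p) : |cA0 q s n p r - (q ^ p) ^ 2| ≤ (3 * hfBound q s + 1) * q ^ n := by
  have a1 := abs_hf_sub_one_le h0 h1 s hn
  have a2 := abs_hf_le h0 h1 s hn
  have ht := zpow_pos h0 n
  have ht1 : q ^ n ≤ 1 := zpow_le_one₀ h0 h1.le hn
  have hx := zpow_pos h0 p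
  have hx1 : q ^ p ≤ 1 := zpow_le_one₀ h0 h1.le hp
  have hH := hfBound_nonneg h0 s
  rw [cA0, af]
  generalize q ^ n = t at *
  generalize q ^ p = x at *
  generalize hf q (qs q s) t = h at *
  generalize hfBound q s = H at *
  have tt : t ^ 2 ≤ t := by nlinarith
  have t4 : t ^ 4 * q ^ 4 ≤ t := by
    have : t ^ 4 ≤ t ^ 1 := pow_le_pow_of_le_one ht.le ht1 (by norm_num)
    calc t ^ 4 * q ^ 4 ≤ t ^ 1 * 1 := by
          gcongr
          exact pow_le_one₀ h0.le h1.le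
      _ = t := by ring
  have e : (1 + q ^ 2)⁻¹ * (1 - (1 + t ^ 4 * q ^ 4) * h) + x ^ 2 * h - x ^ 2 =
      -((1 + q ^ 2)⁻¹ * (h - 1)) + -((1 + q ^ 2)⁻¹ * (t ^ 4 * q ^ 4 * h)) + x ^ 2 * (h - 1) := by
    ring
  have i1 : (1 + q ^ 2)⁻¹ ≤ 1 := inv_le_one_of_one_le₀ (by nlinarith [sq_nonneg q])
  have i0 : 0 ≤ (1 + q ^ 2)⁻¹ := by positivity
  have b1 : |(1 + q ^ 2)⁻¹ * (h - 1)| ≤ H * t := by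
    rw [abs_mul, abs_of_nonneg i0]
    calc _ ≤ 1 * (H * t ^ 2) := by gcongr
      _ ≤ H * t := by rw [one_mul]; gcongr
  have b2 : |(1 + q ^ 2)⁻¹ * (t ^ 4 * q ^ 4 * h)| ≤ (1 + H) * t := by
    rw [abs_mul, abs_of_nonneg i0, abs_mul, abs_of_nonneg (show 0 ≤ t ^ 4 * q ^ 4 by positivity)]
    calc _ ≤ 1 * (t * (1 + H)) := by gcongr
      _ = (1 + H) * t := by ring
  have b3 : |x ^ 2 * (h - 1)| ≤ H * t := by
    rw [abs_mul, abs_of_nonneg (sq_nonneg x)]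
    calc _ ≤ 1 * (H * t ^ 2) := by
          gcongr
          exact pow_le_one₀ hx.le hx1
      _ ≤ H * t := by rw [one_mul]; gcongr
  rw [e]
  refine (abs_add_three _ _ _).trans ?_
  rw [abs_neg, abs_neg]
  linarith

theorem abs_le_of_sq_le_mul_sq {c K t : ℝ} (ht : 0 ≤ t) (h : c ^ 2 ≤ K * t ^ 2) : |c| ≤ √K * t := by
  have := Real.abs_le_sqrt h
  rwa [Real.sqrt_mul' _ (sq_nonneg t), Real.sqrt_sq ht] at this

/-- The constant in the estimates of the off-diagonal coefficients. -/
def offBound (q : ℝ) (s : ℤˣ) : ℝ := q ^ (s : ℤ) / q ^ 2 * (q⁻¹ - q)⁻¹ ^ 2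

/-- Eliminates `q^r` from the power counts below: square roots of `q`-numbers in `p` and `r`
together cost only powers of `qⁿ`. -/
theorem zpow_r {q : ℝ} (h0 : 0 < q) {n p r : ℤ} (h : p + r = 2 * n + 1) :
    q ^ p * q ^ r = (q ^ n) ^ 2 * q := by
  rw [← zpow_add₀ h0.ne', h, zpow_add₀ h0.ne', mul_comm 2 n, zpow_mul, zpow_one]
  norm_cast

/-- Power count for the square, with `t = qⁿ`, `x = q^p`: `t⁶` from `gt`, `x²/t²` from the prefactor
and `(xy)⁻¹ ~ t⁻²` from the roots, in total `t² x² ≤ t²`. -/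
theorem abs_cAm_le {q : ℝ} (h0 : 0 < q) (h1 : q < 1) (s : ℤˣ) {n p r : ℤ} (hn : 0 ≤ n)
    (hp : 0 ≤ p) (h : p + r = 2 * n + 1) :
    |cAm q s n p r| ≤ √(offBound q s / q) * q ^ n := by
  have g := gt_sq_le h0 h1 s hn
  have r1 := rz_sq_le h0 h1 p
  have r2 := rz_sq_le h0 h1 r
  have hr := zpow_r h0 h
  have hk := inv_sub_pos h0 h1
  have hG := zpow_pos h0 (s : ℤ)
  have ht := zpow_pos h0 n
  have hx := zpow_pos h0 p
  have hy := zpow_pos h0 r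
  have hx1 : q ^ p ≤ 1 := zpow_le_one₀ h0 h1.le hp
  refine abs_le_of_sq_le_mul_sq ht.le ?_
  rw [cAm, offBound]
  generalize q ^ n = t at *
  generalize q ^ p = x at *
  generalize q ^ r = y at *
  generalize (q⁻¹ - q)⁻¹ = κ at *
  generalize q ^ (s : ℤ) = G at *
  have hκ : 0 ≤ κ := by
    have := (sq_nonneg (rz q p)).trans r1
    exact nonneg_of_mul_nonneg_left this (inv_pos.2 hx)
  calc _ = gt q s n ^ 2 * (x / t) ^ 2 * (rz q p ^ 2 * rz q r ^ 2) := by ring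
    _ ≤ (G / q ^ 2 * t ^ 6) * (x / t) ^ 2 * ((κ * x⁻¹) * (κ * y⁻¹)) := by gcongr
    _ = G / q ^ 2 * κ ^ 2 * t ^ 4 * x ^ 2 * (x * y)⁻¹ := by field_simp
    _ = G / q ^ 2 * κ ^ 2 / q * t ^ 2 * x ^ 2 := by rw [hr]; field_simp
    _ ≤ G / q ^ 2 * κ ^ 2 / q * t ^ 2 * 1 := by
      gcongr
      exact pow_le_one₀ hx.le hx1
    _ = _ := by ring

theorem abs_cAp_le {q : ℝ} (h0 : 0 < q) (h1 : q < 1) (s : ℤˣ) {n p r : ℤ} (hn : 0 ≤ n)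
    (hp : 0 ≤ p) (h : p + r = 2 * n + 1) :
    |cAp q s n p r| ≤ √(offBound q s * q ^ 3) * q ^ n := by
  have hq := h0.ne'
  have g := gt_sq_le h0 h1 s (show 0 ≤ n + 1 by omega)
  have r1 := rz_sq_le h0 h1 (p + 1)
  have r2 := rz_sq_le h0 h1 (r + 1)
  have hr := zpow_r h0 h
  have hk := inv_sub_pos h0 h1
  have hG := zpow_pos h0 (s : ℤ)
  have ht := zpow_pos h0 n
  have hx := zpow_pos h0 p
  have hy := zpow_pos h0 r
  have hx1 : q ^ p ≤ 1 := zpow_le_one₀ h0 h1.le hp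
  refine abs_le_of_sq_le_mul_sq ht.le ?_
  rw [cAp, offBound]
  rw [zpow_add_one₀ hq] at g r1 r2
  have hκ : 0 ≤ (q⁻¹ - q)⁻¹ := (inv_pos.2 hk).le
  generalize q ^ n = t at *
  generalize q ^ p = x at *
  generalize q ^ r = y at *
  generalize (q⁻¹ - q)⁻¹ = κ at *
  generalize q ^ (s : ℤ) = G at *
  calc _ = gt q s (n + 1) ^ 2 * (x / t) ^ 2 * (rz q (p + 1) ^ 2 * rz q (r + 1) ^ 2) := by ring
    _ ≤ (G / q ^ 2 * (t * q) ^ 6) * (x / t) ^ 2 * ((κ * (x * q)⁻¹) * (κ * (y * q)⁻¹)) := by gcongr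
    _ = G * q ^ 2 * κ ^ 2 * t ^ 4 * x ^ 2 * (x * y)⁻¹ := by field_simp
    _ = G / q ^ 2 * κ ^ 2 * q ^ 3 * t ^ 2 * x ^ 2 := by rw [hr]; field_simp
    _ ≤ G / q ^ 2 * κ ^ 2 * q ^ 3 * t ^ 2 * 1 := by
      gcongr
      exact pow_le_one₀ hx.le hx1
    _ = _ := by ring

/-- For `B` mere boundedness is enough: its monomials drop out of the trace by weight, not by size.
-/
theorem abs_cBm_le {q : ℝ} (h0 : 0 < q) (h1 : q < 1) (s : ℤˣ) {n p r : ℤ} (hn : 0 ≤ n)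
    (h : p + r = 2 * n + 1) : |cBm q s n p r| ≤ √(offBound q s * q) := by
  have hq := h0.ne'
  have g := gt_sq_le h0 h1 s hn
  have r1 := rz_sq_le h0 h1 p
  have r2 := rz_sq_le h0 h1 (p - 1)
  have hr := zpow_r h0 h
  have hk := inv_sub_pos h0 h1
  have hG := zpow_pos h0 (s : ℤ)
  have ht := zpow_pos h0 n
  have hx := zpow_pos h0 p
  have hy := zpow_pos h0 r
  have ht1 : q ^ n ≤ 1 := zpow_le_one₀ h0 h1.le hn
  refine Real.abs_le_sqrt ?_
  rw [cBm, offBound]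
  rw [zpow_sub_one₀ hq] at r2
  have hκ : 0 ≤ (q⁻¹ - q)⁻¹ := (inv_pos.2 hk).le
  generalize q ^ n = t at *
  generalize q ^ p = x at *
  generalize q ^ r = y at *
  generalize (q⁻¹ - q)⁻¹ = κ at *
  generalize q ^ (s : ℤ) = G at *
  calc _ = (q * y⁻¹) ^ 2 * gt q s n ^ 2 * (rz q p ^ 2 * rz q (p - 1) ^ 2) := by ring
    _ ≤ (q * y⁻¹) ^ 2 * (G / q ^ 2 * t ^ 6) * ((κ * x⁻¹) * (κ * (x * q⁻¹)⁻¹)) := by gcongr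
    _ = G * κ ^ 2 * q * t ^ 6 * ((x * y) ^ 2)⁻¹ := by field_simp
    _ = G / q ^ 2 * κ ^ 2 * q * t ^ 2 := by rw [hr]; field_simp
    _ ≤ G / q ^ 2 * κ ^ 2 * q * 1 := by
      gcongr
      exact pow_le_one₀ ht.le ht1
    _ = _ := by ring

theorem abs_cB0_le {q : ℝ} (h0 : 0 < q) (h1 : q < 1) (s : ℤˣ) {n p r : ℤ} (hn : 0 ≤ n)
    (hp : 0 ≤ p) (h : p + r = 2 * n + 1) :
    |cB0 q s n p r| ≤ √((1 + hfBound q s) ^ 2 * (q⁻¹ - q)⁻¹ ^ 2 / q ^ 2) := by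
  have hq := h0.ne'
  have r1 := rz_sq_le h0 h1 p
  have r2 := rz_sq_le h0 h1 (r + 1)
  have hr := zpow_r h0 h
  have hk := inv_sub_pos h0 h1
  have ht := zpow_pos h0 n
  have hx := zpow_pos h0 p
  have hy := zpow_pos h0 r
  have hx1 : q ^ p ≤ 1 := zpow_le_one₀ h0 h1.le hp
  have hf1 := abs_hf_le h0 h1 s hn
  have hH := hfBound_nonneg h0 s
  refine Real.abs_le_sqrt ?_
  rw [cB0]
  rw [zpow_add_one₀ hq] at r2
  have hκ : 0 ≤ (q⁻¹ - q)⁻¹ := (inv_pos.2 hk).le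
  generalize q ^ n = t at *
  generalize q ^ p = x at *
  generalize q ^ r = y at *
  generalize (q⁻¹ - q)⁻¹ = κ at *
  generalize hfBound q s = H at *
  have hf2 : hf q (qs q s) t ^ 2 ≤ (1 + H) ^ 2 := by
    rw [← sq_abs]
    gcongr
  have hq1 : (1 - q ^ 2) ^ 2 ≤ 1 := by
    have : q ^ 2 ≤ 1 := pow_le_one₀ h0.le h1.le
    nlinarith [sq_nonneg q]
  calc _ = (1 - q ^ 2) ^ 2 * (t ^ 2 * x ^ 2) * hf q (qs q s) t ^ 2 *
        (rz q p ^ 2 * rz q (r + 1) ^ 2) := by ring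
    _ ≤ 1 * (t ^ 2 * x ^ 2) * (1 + H) ^ 2 * ((κ * x⁻¹) * (κ * (y * q)⁻¹)) := by gcongr
    _ = (1 + H) ^ 2 * κ ^ 2 / q * t ^ 2 * x ^ 2 * (x * y)⁻¹ := by field_simp
    _ = (1 + H) ^ 2 * κ ^ 2 / q ^ 2 * x ^ 2 := by rw [hr]; field_simp
    _ ≤ (1 + H) ^ 2 * κ ^ 2 / q ^ 2 * 1 := by
      gcongr
      exact pow_le_one₀ hx.le hx1
    _ = _ := by ring

/-- The case `n = -1` is admitted because the lowering coefficient of `B*` is this one at `n - 1`.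
-/
theorem abs_cBp_le {q : ℝ} (h0 : 0 < q) (h1 : q < 1) (s : ℤˣ) {n p r : ℤ} (hn : 0 ≤ n + 1)
    (hp : 0 ≤ p) (h : p + r = 2 * n + 1) : |cBp q s n p r| ≤ √(offBound q s * q ^ 3) := by
  have hq := h0.ne'
  have g := gt_sq_le h0 h1 s hn
  have r1 := rz_sq_le h0 h1 (r + 1)
  have r2 := rz_sq_le h0 h1 (r + 2)
  have hr := zpow_r h0 h
  have hk := inv_sub_pos h0 h1
  have hG := zpow_pos h0 (s : ℤ)
  have ht := zpow_pos h0 n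
  have hx := zpow_pos h0 p
  have hy := zpow_pos h0 r
  have hx1 : q ^ p ≤ 1 := zpow_le_one₀ h0 h1.le hp
  have ht1 : q ^ (n + 1) ≤ 1 := zpow_le_one₀ h0 h1.le hn
  refine Real.abs_le_sqrt ?_
  rw [cBp, offBound]
  have z2 : q ^ (r + 2) = q ^ r * q ^ 2 := by rw [zpow_add₀ hq]; norm_cast
  rw [zpow_add_one₀ hq] at g r1 ht1
  rw [z2] at r2
  have hκ : 0 ≤ (q⁻¹ - q)⁻¹ := (inv_pos.2 hk).le
  generalize q ^ n = t at *
  generalize q ^ p = x at *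
  generalize q ^ r = y at *
  generalize (q⁻¹ - q)⁻¹ = κ at *
  generalize q ^ (s : ℤ) = G at *
  calc _ = q ^ 4 * x ^ 2 * gt q s (n + 1) ^ 2 * (rz q (r + 1) ^ 2 * rz q (r + 2) ^ 2) := by ring
    _ ≤ q ^ 4 * x ^ 2 * (G / q ^ 2 * (t * q) ^ 6) *
        ((κ * (y * q)⁻¹) * (κ * (y * q ^ 2)⁻¹)) := by gcongr
    _ = G * q ^ 5 * κ ^ 2 * t ^ 6 * x ^ 4 * ((x * y) ^ 2)⁻¹ := by field_simp
    _ = G / q ^ 2 * κ ^ 2 * q ^ 3 * ((t * q) ^ 2 * x ^ 4) := by rw [hr]; field_simp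
    _ ≤ G / q ^ 2 * κ ^ 2 * q ^ 3 * (1 * 1) := by
      gcongr
      · exact pow_le_one₀ (by positivity) ht1
      · exact pow_le_one₀ hx.le hx1
    _ = _ := by ring

/-! ### Column norms of operators on the span of the basis vectors -/

/-- The `ℓ¹`-norm. -/
def l1 (v : Dom) : ℝ := ∑ i ∈ v.support, ‖v i‖

theorem l1_eq_sum {v : Dom} {s : Finset Idx} (h : v.support ⊆ s) : l1 v = ∑ i ∈ s, ‖v i‖ :=
  Finset.sum_subset h fun i _ hi => by simp [Finsupp.notMem_support_iff.1 hi]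

theorem l1_nonneg (v : Dom) : 0 ≤ l1 v := Finset.sum_nonneg fun _ _ => norm_nonneg _

@[simp]
theorem l1_zero : l1 0 = 0 := by simp [l1]

theorem l1_add_le (v w : Dom) : l1 (v + w) ≤ l1 v + l1 w := by
  classical
  rw [l1_eq_sum (Finsupp.support_add (g₁ := v) (g₂ := w)),
    l1_eq_sum (Finset.subset_union_left (s₁ := v.support) (s₂ := w.support)),
    l1_eq_sum (Finset.subset_union_right (s₁ := v.support) (s₂ := w.support)),
    ← Finset.sum_add_distrib]
  exact Finset.sum_le_sum fun i _ => norm_add_le _ _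

theorem l1_smul (c : ℂ) (v : Dom) : l1 (c • v) = ‖c‖ * l1 v := by
  rw [l1_eq_sum (Finsupp.support_smul (b := c) (g := v)), l1, Finset.mul_sum]
  exact Finset.sum_congr rfl fun i _ => by simp

theorem l1_single (i : Idx) (c : ℂ) : l1 (Finsupp.single i c) = ‖c‖ := by
  rw [l1_eq_sum Finsupp.support_single_subset]
  simp

theorem l1_sum_le {ι : Type*} (s : Finset ι) (f : ι → Dom) :
    l1 (∑ i ∈ s, f i) ≤ ∑ i ∈ s, l1 (f i) := by
  classical
  induction s using Finset.induction_on with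
  | empty => simp
  | insert a s ha ih =>
    rw [Finset.sum_insert ha, Finset.sum_insert ha]
    exact (l1_add_le _ _).trans (by gcongr)

theorem norm_apply_le_l1 (v : Dom) (i : Idx) : ‖v i‖ ≤ l1 v := by
  by_cases h : i ∈ v.support
  · exact Finset.single_le_sum (f := fun i => ‖v i‖) (fun _ _ => norm_nonneg _) h
  · rw [Finsupp.notMem_support_iff.1 h, norm_zero]
    exact l1_nonneg v

theorem l1_vec_le (n j : ℤ) : l1 (vec n j) ≤ 1 := by
  rw [vec]
  split_ifs
  · rw [l1_single, norm_one]
  · simp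

theorem eq_sum_single (v : Dom) : v = ∑ i ∈ v.support, v i • Finsupp.single i (1 : ℂ) := by
  conv_lhs => rw [← Finsupp.sum_single v]
  exact Finset.sum_congr rfl fun i _ => by simp

/-- The supremum of the column norms controls the operator on `ℓ¹`; this makes column bounds
multiplicative without any `ℓ²` estimate. -/
theorem l1_apply_le {T : Module.End ℂ Dom} {C : ℝ} (h : ∀ i, l1 (T (Finsupp.single i 1)) ≤ C)
    (v : Dom) : l1 (T v) ≤ C * l1 v := by
  conv_lhs => rw [eq_sum_single v]
  rw [map_sum, show l1 v = ∑ i ∈ v.support, ‖v i‖ from rfl, Finset.mul_sum]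
  refine (l1_sum_le _ _).trans (Finset.sum_le_sum fun i _ => ?_)
  rw [map_smul, l1_smul, mul_comm]
  exact mul_le_mul_of_nonneg_right (h i) (norm_nonneg _)

/-- The columns of the matrix of `T` are uniformly bounded by multiples of `b`. -/
def ColBound (b : Idx → ℝ) (T : Module.End ℂ Dom) : Prop :=
  ∃ C : ℝ, 0 ≤ C ∧ ∀ i, l1 (T (Finsupp.single i 1)) ≤ C * b i

theorem ColBound.add {b : Idx → ℝ} {S T : Module.End ℂ Dom} (hS : ColBound b S)
    (hT : ColBound b T) : ColBound b (S + T) := by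
  obtain ⟨C, h0, hC⟩ := hS
  obtain ⟨D, h0', hD⟩ := hT
  refine ⟨C + D, by positivity, fun i => (l1_add_le _ _).trans ?_⟩
  rw [add_mul]
  exact add_le_add (hC i) (hD i)

theorem ColBound.smul {b : Idx → ℝ} {T : Module.End ℂ Dom} (c : ℂ) (hT : ColBound b T) :
    ColBound b (c • T) := by
  obtain ⟨C, h0, hC⟩ := hT
  refine ⟨‖c‖ * C, by positivity, fun i => ?_⟩
  rw [LinearMap.smul_apply, l1_smul, mul_assoc]
  exact mul_le_mul_of_nonneg_left (hC i) (norm_nonneg _)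

/-- The columns are uniformly bounded. -/
abbrev Bdd (T : Module.End ℂ Dom) : Prop := ColBound (fun _ => 1) T

/-- The weight `b` is read at the input vector, so a bounded factor on the left is harmless. A
factor on the right could move the input; only diagonal ones are allowed there
(`ColBound.mul_diag`). -/
theorem Bdd.mul {b : Idx → ℝ} {S T : Module.End ℂ Dom} (hS : Bdd S) (hT : ColBound b T) :
    ColBound b (S * T) := by
  obtain ⟨C, h0, hC⟩ := hS
  obtain ⟨D, h0', hD⟩ := hT
  refine ⟨C * D, by positivity, fun i => ?_⟩
  rw [Module.End.mul_apply, mul_assoc]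
  exact (l1_apply_le (fun i => (hC i).trans_eq (mul_one C)) _).trans
    (mul_le_mul_of_nonneg_left (hD i) h0)

theorem diag_single (c : Idx → ℂ) (i : Idx) :
    diag c (Finsupp.single i 1) = c i • Finsupp.single i 1 := by
  simp [diag]

theorem diag_apply (c : Idx → ℂ) (v : Dom) (i : Idx) : diag c v i = c i * v i := by
  rw [diag, Finsupp.linearCombination_apply, Finsupp.sum_apply, Finsupp.sum_eq_single i]
  · simp [mul_comm]
  · intro j _ hj
    simp [hj]
  · simp

theorem diag_mul_diag (c d : Idx → ℂ) : diag c * diag d = diag fun i => c i * d i := by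
  refine LinearMap.ext fun v => Finsupp.ext fun i => ?_
  rw [Module.End.mul_apply, diag_apply, diag_apply, diag_apply, mul_assoc]

theorem diag_pow (c : Idx → ℂ) (N : ℕ) : diag c ^ N = diag fun i => c i ^ N := by
  induction N with
  | zero =>
    refine LinearMap.ext fun v => Finsupp.ext fun i => ?_
    simp [diag_apply]
  | succ N ih => rw [pow_succ, ih, diag_mul_diag]; simp only [pow_succ]

theorem ColBound.mul_diag {b : Idx → ℝ} {T : Module.End ℂ Dom} (hT : ColBound b T)
    {c : Idx → ℂ} (hc : ∀ i, ‖c i‖ ≤ 1) : ColBound b (T * diag c) := by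
  obtain ⟨C, h0, hC⟩ := hT
  refine ⟨C, h0, fun i => ?_⟩
  rw [Module.End.mul_apply, diag_single, map_smul, l1_smul]
  calc _ ≤ 1 * (C * b i) := mul_le_mul (hc i) (hC i) (l1_nonneg _) zero_le_one
    _ = _ := one_mul _

theorem bdd_one : Bdd 1 := ⟨1, zero_le_one, fun i => by simp [l1_single]⟩

theorem l1_tri_le {c1 c2 c3 b1 b2 b3 : ℝ} (n1 n2 n3 p1 p2 p3 : ℤ) (h1 : |c1| ≤ b1) (h2 : |c2| ≤ b2)
    (h3 : |c3| ≤ b3) :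
    l1 (((c1 : ℝ) : ℂ) • vec n1 p1 + ((c2 : ℝ) : ℂ) • vec n2 p2 + ((c3 : ℝ) : ℂ) • vec n3 p3) ≤
      b1 + b2 + b3 := by
  have key : ∀ (c b : ℝ) (n p : ℤ), |c| ≤ b → l1 ((c : ℂ) • vec n p) ≤ b := by
    intro c b n p h
    rw [l1_smul, Complex.norm_real, Real.norm_eq_abs]
    calc |c| * l1 (vec n p) ≤ b * 1 :=
          mul_le_mul h (l1_vec_le n p) (l1_nonneg _) ((abs_nonneg c).trans h)
      _ = b := mul_one b
  exact (l1_add_le _ _).trans (add_le_add ((l1_add_le _ _).trans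
    (add_le_add (key _ _ _ _ h1) (key _ _ _ _ h2))) (key _ _ _ _ h3))

/-! ### Boundedness of the representation and the leading part of `A` -/

theorem bdd_opB {q : ℝ} (h0 : 0 < q) (h1 : q < 1) (s : ℤˣ) : Bdd (opB q s) := by
  refine ⟨√(offBound q s * q) + √((1 + hfBound q s) ^ 2 * (q⁻¹ - q)⁻¹ ^ 2 / q ^ 2) +
    √(offBound q s * q ^ 3), by positivity, fun i => ?_⟩
  have hi := i.2.2
  have hr : ((i.2 : ℕ) : ℤ) + (2 * i.1 + 1 - (i.2 : ℕ)) = 2 * (i.1 : ℤ) + 1 := by ring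
  rw [← vec_idx, isTri_B h0 h1 s _ _ _ hr, mul_one]
  exact l1_tri_le _ _ _ _ _ _ (abs_cBm_le h0 h1 s (by omega) hr)
    (abs_cB0_le h0 h1 s (by omega) (by omega) hr) (abs_cBp_le h0 h1 s (by omega) (by omega) hr)

theorem bdd_opBs {q : ℝ} (h0 : 0 < q) (h1 : q < 1) (s : ℤˣ) : Bdd (opBs q s) := by
  refine ⟨√(offBound q s * q ^ 3) + √((1 + hfBound q s) ^ 2 * (q⁻¹ - q)⁻¹ ^ 2 / q ^ 2) +
    √(offBound q s * q), by positivity, fun i => ?_⟩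
  have hi := i.2.2
  have hr : ((i.2 : ℕ) : ℤ) + (2 * i.1 + 1 - (i.2 : ℕ)) = 2 * (i.1 : ℤ) + 1 := by ring
  rw [← vec_idx, isTri_Bs h0 h1 s _ _ _ hr, mul_one]
  exact l1_tri_le _ _ _ _ _ _ (abs_cBp_le h0 h1 s (by omega) (by omega) (by omega))
    (abs_cB0_le h0 h1 s (by omega) (by omega) (by omega)) (abs_cBm_le h0 h1 s (by omega) (by omega))

/-- The leading part of `A`: the diagonal operator with eigenvalues `q^{2(l+k)}`. -/
def leadA (q : ℝ) : Module.End ℂ Dom := diag fun i => (((q ^ (i.2 : ℕ)) ^ 2 : ℝ) : ℂ)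

theorem colBound_opA_sub {q : ℝ} (h0 : 0 < q) (h1 : q < 1) (s : ℤˣ) :
    ColBound (fun i => q ^ i.1) (opA q s - leadA q) := by
  refine ⟨√(offBound q s / q) + (3 * hfBound q s + 1) + √(offBound q s * q ^ 3), ?_, fun i => ?_⟩
  · have := hfBound_nonneg h0 s
    positivity
  have hi := i.2.2
  have hr : ((i.2 : ℕ) : ℤ) + (2 * i.1 + 1 - (i.2 : ℕ)) = 2 * (i.1 : ℤ) + 1 := by ring
  rw [LinearMap.sub_apply, leadA, diag_single, ← vec_idx, isTri_A h0 h1 s _ _ _ hr, add_zero,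
    add_zero, add_zero, add_mul, add_mul]
  simp only [← zpow_natCast q i.1]
  have e : ∀ (c1 c2 c3 d : ℝ) (v1 v2 v3 : Dom),
      (c1 : ℂ) • v1 + (c2 : ℂ) • v2 + (c3 : ℂ) • v3 - (d : ℂ) • v2 =
      (c1 : ℂ) • v1 + ((c2 - d : ℝ) : ℂ) • v2 + (c3 : ℂ) • v3 := by
    intro c1 c2 c3 d v1 v2 v3
    push_cast
    module
  rw [e]
  refine l1_tri_le _ _ _ _ _ _ (abs_cAm_le h0 h1 s (by omega) (by omega) hr) ?_
    (abs_cAp_le h0 h1 s (by omega) (by omega) hr)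
  rw [← zpow_natCast q (i.2 : ℕ)]
  exact abs_cA0_sub_le h0 h1 s (by omega) (by omega)

theorem ColBound.bdd {q : ℝ} (h0 : 0 < q) (h1 : q < 1) {T : Module.End ℂ Dom}
    (hT : ColBound (fun i => q ^ i.1) T) : Bdd T := by
  obtain ⟨C, hC0, hC⟩ := hT
  exact ⟨C, hC0, fun i => (hC i).trans (mul_le_mul_of_nonneg_left (pow_le_one₀ h0.le h1.le) hC0)⟩

theorem norm_leadA_le {q : ℝ} (h0 : 0 < q) (h1 : q < 1) (N : ℕ) (i : Idx) :
    ‖(((q ^ (i.2 : ℕ)) ^ 2 : ℝ) : ℂ) ^ N‖ ≤ 1 := by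
  rw [norm_pow, Complex.norm_real, Real.norm_eq_abs, abs_of_nonneg (by positivity)]
  exact pow_le_one₀ (by positivity) (pow_le_one₀ (by positivity) (pow_le_one₀ h0.le h1.le))

theorem bdd_opA {q : ℝ} (h0 : 0 < q) (h1 : q < 1) (s : ℤˣ) : Bdd (opA q s) := by
  have h := ((colBound_opA_sub h0 h1 s).bdd h0 h1).add
    (bdd_one.mul_diag (norm_leadA_le h0 h1 1))
  have e : opA q s = (opA q s - leadA q) + 1 * diag fun i => (((q ^ (i.2 : ℕ)) ^ 2 : ℝ) : ℂ) ^ 1 := by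
    simp only [pow_one, one_mul]
    exact (sub_add_cancel (opA q s) (leadA q)).symm
  rwa [e]

theorem bdd_rep {q : ℝ} (hq : 0 < q ∧ q < 1) (s : ℤˣ) (a : Sphere q) : Bdd (rep q hq s a) := by
  let S : Subalgebra ℂ (Sphere q) :=
    { carrier := {a | Bdd (rep q hq s a)}
      mul_mem' := fun {a b} ha hb => by
        change Bdd (rep q hq s (a * b)); rw [map_mul]; exact Bdd.mul ha hb
      add_mem' := fun {a b} ha hb => by
        change Bdd (rep q hq s (a + b)); rw [map_add]; exact ColBound.add ha hb
      algebraMap_mem' := fun r => by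
        change Bdd (rep q hq s _)
        rw [AlgHom.commutes, Algebra.algebraMap_eq_smul_one]; exact bdd_one.smul r }
  refine mem_of_gens S ?_ ?_ ?_ a
  · change Bdd _; rw [rep, lift_genA]; exact bdd_opA hq.1 hq.2 s
  · change Bdd _; rw [rep, lift_genB]; exact bdd_opB hq.1 hq.2 s
  · change Bdd _; rw [rep, lift_genBs]; exact bdd_opBs hq.1 hq.2 s

theorem mul_sub_mul_eq {R : Type*} [Ring R] (a b c d : R) :
    a * c - b * d = a * (c - d) + (a - b) * d := by
  noncomm_ring

theorem commutator_mul {R : Type*} [Ring R] (k s t : R) :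
    k * (s * t) - s * t * k = (k * s - s * k) * t + s * (k * t - t * k) := by
  noncomm_ring

theorem colBound_opA_pow_sub {q : ℝ} (h0 : 0 < q) (h1 : q < 1) (s : ℤˣ) (N : ℕ) :
    ColBound (fun i => q ^ i.1) (opA q s ^ N - leadA q ^ N) := by
  induction N with
  | zero => exact ⟨0, le_rfl, fun i => by simp⟩
  | succ N ih =>
    -- Telescoping with the full `A` on the left and only powers of the diagonal model on the right,
    -- the arrangement in which the column weight `qⁿ` survives.
    have e : opA q s ^ (N + 1) - leadA q ^ (N + 1) =
        opA q s * (opA q s ^ N - leadA q ^ N) + (opA q s - leadA q) * leadA q ^ N := by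
      rw [pow_succ', pow_succ' (leadA q)]
      exact mul_sub_mul_eq (opA q s) (leadA q) (opA q s ^ N) (leadA q ^ N)
    rw [e]
    refine ((bdd_opA h0 h1 s).mul ih).add ?_
    rw [leadA, diag_pow]
    exact (colBound_opA_sub h0 h1 s).mul_diag (norm_leadA_le h0 h1 N)

/-! ### Weights -/

/-- The operator with eigenvalue `k + 1/2` on `v^l_k`. -/
def weightOp : Module.End ℂ Dom := diag fun i => (((i.2 : ℕ) : ℤ) - (i.1 : ℤ) : ℤ)

/-- `T` shifts the weight `k` by `w`. -/
def HasWeight (w : ℤ) (T : Module.End ℂ Dom) : Prop :=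
  weightOp * T - T * weightOp = (w : ℂ) • T

theorem HasWeight.mul {w w' : ℤ} {S T : Module.End ℂ Dom} (hS : HasWeight w S)
    (hT : HasWeight w' T) : HasWeight (w + w') (S * T) := by
  unfold HasWeight at *
  have e : weightOp * (S * T) - S * T * weightOp =
      (weightOp * S - S * weightOp) * T + S * (weightOp * T - T * weightOp) :=
    commutator_mul weightOp S T
  rw [e, hS, hT, smul_mul_assoc, mul_smul_comm, ← add_smul]
  push_cast
  rfl

theorem HasWeight.pow {w : ℤ} {T : Module.End ℂ Dom} (hT : HasWeight w T) (N : ℕ) :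
    HasWeight (N * w) (T ^ N) := by
  induction N with
  | zero =>
    rw [pow_zero, HasWeight, mul_one, one_mul, Nat.cast_zero, zero_mul, Int.cast_zero, zero_smul]
    exact sub_self weightOp
  | succ N ih =>
    rw [pow_succ]
    have := ih.mul hT
    rwa [show ((N + 1 : ℕ) : ℤ) * w = N * w + w by push_cast; ring]

/-- A commutator with a diagonal operator has zero diagonal, and here it equals `w • T`. -/
theorem HasWeight.diag_eq_zero {w : ℤ} (hw : w ≠ 0) {T : Module.End ℂ Dom} (hT : HasWeight w T)
    (i : Idx) : T (Finsupp.single i 1) i = 0 := by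
  have h := DFunLike.congr_fun (LinearMap.congr_fun hT (Finsupp.single i 1)) i
  rw [LinearMap.sub_apply, Module.End.mul_apply, Module.End.mul_apply, weightOp, diag_single,
    map_smul, Finsupp.sub_apply, diag_apply, LinearMap.smul_apply, Finsupp.smul_apply,
    Finsupp.smul_apply, smul_eq_mul, smul_eq_mul, sub_self] at h
  exact (mul_eq_zero.1 h.symm).resolve_left (by exact_mod_cast hw)

theorem weightOp_vec (n j : ℤ) : weightOp (vec n j) = ((j - n : ℤ) : ℂ) • vec n j := by
  by_cases h : 0 ≤ n ∧ 0 ≤ j ∧ j ≤ 2 * n + 1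
  · obtain ⟨i, hn, hj, hv⟩ := exists_idx h
    rw [hv, weightOp, diag_single, hn, hj]
  · simp [vec_eq_zero h]

theorem IsTri.hasWeight {T : Module.End ℂ Dom} {d : ℤ} {cm c0 cp : ℤ → ℤ → ℤ → ℝ}
    (h : IsTri T d cm c0 cp) : HasWeight d T := by
  refine end_ext fun n p _ => ?_
  rw [LinearMap.sub_apply, Module.End.mul_apply, Module.End.mul_apply, weightOp_vec, map_smul,
    LinearMap.smul_apply, h n p (2 * n + 1 - p) (by ring)]
  simp only [map_add, map_smul, weightOp_vec]
  push_cast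
  module

theorem diag_monoB {q : ℝ} (hq : 0 < q ∧ q < 1) (s : ℤˣ) (n m : ℕ) (hm : 0 < m) (i : Idx) :
    rep q hq s (genA q ^ n * genB q ^ m) (Finsupp.single i 1) i = 0 := by
  have h := ((isTri_A hq.1 hq.2 s).hasWeight.pow n).mul ((isTri_B hq.1 hq.2 s).hasWeight.pow m)
  rw [map_mul, map_pow, map_pow, rep, lift_genA, lift_genB]
  exact h.diag_eq_zero (by omega) i

theorem diag_monoBs {q : ℝ} (hq : 0 < q ∧ q < 1) (s : ℤˣ) (n m : ℕ) (hm : 0 < m) (i : Idx) :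
    rep q hq s (genA q ^ n * genBs q ^ m) (Finsupp.single i 1) i = 0 := by
  have h := ((isTri_A hq.1 hq.2 s).hasWeight.pow n).mul ((isTri_Bs hq.1 hq.2 s).hasWeight.pow m)
  rw [map_mul, map_pow, map_pow, rep, lift_genA, lift_genBs]
  exact h.diag_eq_zero (by omega) i

theorem diag_genA_pow {q : ℝ} (hq : 0 < q ∧ q < 1) (s : ℤˣ) (N : ℕ) :
    ∃ C : ℝ, 0 ≤ C ∧ ∀ i : Idx,
      ‖rep q hq s (genA q ^ N) (Finsupp.single i 1) i - (((q ^ (i.2 : ℕ)) ^ 2 : ℝ) : ℂ) ^ N‖ ≤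
        C * q ^ i.1 := by
  obtain ⟨C, h0, hC⟩ := colBound_opA_pow_sub hq.1 hq.2 s N
  refine ⟨C, h0, fun i => le_trans (le_of_eq ?_) ((norm_apply_le_l1 _ i).trans (hC i))⟩
  rw [map_pow, rep, lift_genA, LinearMap.sub_apply, leadA, diag_pow, diag_single,
    Finsupp.sub_apply, Finsupp.smul_apply, Finsupp.single_eq_same, smul_eq_mul, mul_one]

/-! ### A criterion for the trace class -/

/-- `|T|` is self-adjoint with square `T*T`, so both squared norms equal `⟨x, T*T x⟩`. -/
theorem norm_cfcAbs_apply {H : Type*} [NormedAddCommGroup H] [InnerProductSpace ℂ H]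
    [CompleteSpace H] (T : H →L[ℂ] H) (x : H) : ‖CFC.abs T x‖ = ‖T x‖ := by
  have hs : ContinuousLinearMap.adjoint (CFC.abs T) = CFC.abs T :=
    (CFC.abs_nonneg T).isSelfAdjoint.star_eq
  have h2 : CFC.abs T * CFC.abs T = star T * T := CFC.abs_mul_abs T
  have key : inner ℂ (CFC.abs T x) (CFC.abs T x) = inner ℂ (T x) (T x) := by
    calc inner ℂ (CFC.abs T x) (CFC.abs T x)
        = inner ℂ (ContinuousLinearMap.adjoint (CFC.abs T) x) (CFC.abs T x) := by rw [hs]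
      _ = inner ℂ x ((CFC.abs T * CFC.abs T) x) := by
        rw [ContinuousLinearMap.adjoint_inner_left]; rfl
      _ = inner ℂ x (ContinuousLinearMap.adjoint T (T x)) := by rw [h2]; rfl
      _ = inner ℂ (T x) (T x) := by rw [ContinuousLinearMap.adjoint_inner_right]
  rw [inner_self_eq_norm_sq_to_K, inner_self_eq_norm_sq_to_K] at key
  have key' : ‖CFC.abs T x‖ ^ 2 = ‖T x‖ ^ 2 := by exact_mod_cast key
  exact (pow_left_inj₀ (norm_nonneg _) (norm_nonneg _) two_ne_zero).1 key'

/-- By Cauchy–Schwarz, `⟨e, |T| e⟩ ≤ ‖|T| e‖ = ‖T e‖` for unit vectors `e`. -/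
theorem isTraceClass_of_summable {ι H : Type*} [NormedAddCommGroup H] [InnerProductSpace ℂ H]
    [CompleteSpace H] (e : HilbertBasis ι ℂ H) (T : H →L[ℂ] H) (h : Summable fun i => ‖T (e i)‖) :
    IsTraceClass e T := by
  refine Summable.of_nonneg_of_le (fun i => ?_) (fun i => ?_) h
  · have := ((ContinuousLinearMap.nonneg_iff_isPositive _).1 (CFC.abs_nonneg T)).re_inner_nonneg_right (e i)
    exact this
  · have h1 := (Complex.re_le_norm _).trans (norm_inner_le_norm (𝕜 := ℂ) (e i) (CFC.abs T (e i)))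
    rwa [e.orthonormal.norm_eq_one, one_mul, norm_cfcAbs_apply] at h1

theorem norm_toHilb_le (v : Dom) : ‖toHilb v‖ ≤ l1 v := by
  rw [toHilb, Finsupp.linearCombination_apply]
  refine (norm_sum_le _ _).trans (Finset.sum_le_sum fun i _ => ?_)
  rw [norm_smul, lp.norm_single (by norm_num), norm_one, mul_one]

/-- The bounded extension is the norm-convergent sum of the rank-one operators `x ↦ ⟨eᵢ, x⟩ T eᵢ`,
so no separate proof of `ℓ²`-boundedness is required. -/
theorem hasTraceClassClosure_of_summable (T : Module.End ℂ Dom)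
    (h : Summable fun i => l1 (T (Finsupp.single i 1))) : HasTraceClassClosure T := by
  let t : Idx → (Hilb →L[ℂ] Hilb) := fun i =>
    (innerSL ℂ (stdBasis i)).smulRight (toHilb (T (Finsupp.single i 1)))
  have ht : Summable t := by
    refine Summable.of_norm_bounded h fun i => ?_
    rw [ContinuousLinearMap.norm_smulRight_apply, innerSL_apply_norm, stdBasis.orthonormal.norm_eq_one, one_mul]
    exact norm_toHilb_le _
  have key : ∀ i, (∑' j, t j) (stdBasis i) = toHilb (T (Finsupp.single i 1)) := by
    intro i
    have e : (∑' j, t j) (stdBasis i) = ∑' j, t j (stdBasis i) :=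
      ContinuousLinearMap.map_tsum (ContinuousLinearMap.apply ℂ Hilb (stdBasis i)) ht
    rw [e, tsum_eq_single i]
    · simp [t, stdBasis.orthonormal.norm_eq_one]
    · intro j hj
      simp [t, stdBasis.orthonormal.inner_eq_zero hj]
  refine ⟨∑' i, t i, fun v => ?_, isTraceClass_of_summable _ _ ?_⟩
  · conv_lhs => rw [eq_sum_single v]
    conv_rhs => rw [eq_sum_single v]
    simp only [map_sum, map_smul, ← stdBasis_apply, key]
  · refine Summable.of_nonneg_of_le (fun _ => norm_nonneg _) (fun i => ?_) h
    rw [key]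
    exact norm_toHilb_le _

/-! ### Principal parts, residues and uniqueness of continuations -/

/-- `f` has at most a double pole at `z₀`, with principal part `b / (z - z₀)² + w / (z - z₀)`. -/
def HasPrincipalPart (f : ℂ → ℂ) (z₀ b w : ℂ) : Prop :=
  ∃ g : ℂ → ℂ, AnalyticAt ℂ g z₀ ∧
    ∀ᶠ z in 𝓝[≠] z₀, f z = b / (z - z₀) ^ 2 + w / (z - z₀) + g z

theorem AnalyticAt.hasPrincipalPart {f : ℂ → ℂ} {z₀ : ℂ} (h : AnalyticAt ℂ f z₀) :
    HasPrincipalPart f z₀ 0 0 :=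
  ⟨f, h, Filter.Eventually.of_forall fun z => by simp⟩

theorem HasPrincipalPart.add {f f' : ℂ → ℂ} {z₀ b b' w w' : ℂ} (h : HasPrincipalPart f z₀ b w)
    (h' : HasPrincipalPart f' z₀ b' w') : HasPrincipalPart (f + f') z₀ (b + b') (w + w') := by
  obtain ⟨g, hg, e⟩ := h
  obtain ⟨g', hg', e'⟩ := h'
  refine ⟨g + g', hg.add hg', ?_⟩
  filter_upwards [e, e'] with z h h'
  rw [Pi.add_apply, Pi.add_apply, h, h']
  ring

theorem HasPrincipalPart.const_mul {f : ℂ → ℂ} {z₀ b w : ℂ} (c : ℂ) (h : HasPrincipalPart f z₀ b w) :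
    HasPrincipalPart (fun z => c * f z) z₀ (c * b) (c * w) := by
  obtain ⟨g, hg, e⟩ := h
  refine ⟨fun z => c * g z, analyticAt_const.mul hg, ?_⟩
  filter_upwards [e] with z h
  rw [h]
  ring

theorem HasPrincipalPart.congr {f f' : ℂ → ℂ} {z₀ b w : ℂ} (h : HasPrincipalPart f z₀ b w)
    (e : f' =ᶠ[𝓝[≠] z₀] f) : HasPrincipalPart f' z₀ b w := by
  obtain ⟨g, hg, e'⟩ := h
  refine ⟨g, hg, ?_⟩
  filter_upwards [e, e'] with z h h'
  rw [h, h']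

theorem analyticAt_dslope {f : ℂ → ℂ} {z₀ : ℂ} (h : AnalyticAt ℂ f z₀) :
    AnalyticAt ℂ (dslope f z₀) z₀ := by
  obtain ⟨p, hp⟩ := h
  exact ⟨_, hp.has_fpower_series_dslope_fslope⟩

theorem eq_add_mul_dslope (f : ℂ → ℂ) (z₀ z : ℂ) : f z = f z₀ + (z - z₀) * dslope f z₀ z := by
  have := sub_smul_dslope f z₀ z
  rw [smul_eq_mul] at this
  rw [this]
  ring

theorem hasPrincipalPart_simple {φ f : ℂ → ℂ} {z₀ : ℂ} (h : AnalyticAt ℂ φ z₀)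
    (e : ∀ᶠ z in 𝓝[≠] z₀, f z = φ z / (z - z₀)) : HasPrincipalPart f z₀ 0 (φ z₀) := by
  refine ⟨dslope φ z₀, analyticAt_dslope h, ?_⟩
  filter_upwards [e, self_mem_nhdsWithin] with z hz hne
  have hne' : z - z₀ ≠ 0 := sub_ne_zero.2 hne
  rw [hz, eq_add_mul_dslope φ z₀ z]
  field_simp
  ring

/-- Taylor expansion of `φ` to second order, with the iterated `dslope` as analytic remainder. -/
theorem hasPrincipalPart_double {φ f : ℂ → ℂ} {z₀ : ℂ} (h : AnalyticAt ℂ φ z₀)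
    (e : ∀ᶠ z in 𝓝[≠] z₀, f z = φ z / (z - z₀) ^ 2) :
    HasPrincipalPart f z₀ (φ z₀) (deriv φ z₀) := by
  refine ⟨dslope (dslope φ z₀) z₀, analyticAt_dslope (analyticAt_dslope h), ?_⟩
  filter_upwards [e, self_mem_nhdsWithin] with z hz hne
  have hne' : z - z₀ ≠ 0 := sub_ne_zero.2 hne
  rw [hz, eq_add_mul_dslope φ z₀ z, eq_add_mul_dslope (dslope φ z₀) z₀ z, dslope_same]
  field_simp
  ring

/-- On small circles `(z - z₀)⁻²` integrates to `0`, `(z - z₀)⁻¹` to `2πi`, and the analytic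
remainder to `0` by Cauchy's theorem. -/
theorem HasPrincipalPart.hasResidue {f : ℂ → ℂ} {z₀ b w : ℂ} (hf : MeromorphicAt f z₀)
    (h : HasPrincipalPart f z₀ b w) : HasResidue f z₀ w := by
  refine ⟨hf, ?_⟩
  obtain ⟨g, hg, e⟩ := h
  rw [eventually_nhdsWithin_iff] at e
  obtain ⟨ε, hε, hball⟩ := Metric.eventually_nhds_iff_ball.1 (e.and hg.eventually_analyticAt)
  have hmem : Set.Ioo 0 ε ∈ 𝓝[>] (0 : ℝ) := Ioo_mem_nhdsGT hε
  filter_upwards [hmem] with r hr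
  have hsub : Metric.closedBall z₀ r ⊆ Metric.ball z₀ ε := Metric.closedBall_subset_ball hr.2
  have hd : DifferentiableOn ℂ g (Metric.closedBall z₀ r) := fun z hz =>
    ((hball z (hsub hz)).2.differentiableAt).differentiableWithinAt
  have hne : ∀ z ∈ Metric.sphere z₀ r, z - z₀ ≠ 0 := fun z hz h => by
    rw [Metric.mem_sphere, dist_eq_norm, h, norm_zero] at hz
    exact hr.1.ne hz
  have hc2 : ContinuousOn (fun z => (z - z₀) ^ (-2 : ℤ)) (Metric.sphere z₀ r) := fun z hz =>
    ((continuousAt_id.sub continuousAt_const).zpow₀ _ (Or.inl (hne z hz))).continuousWithinAt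
  have hc1 : ContinuousOn (fun z => (z - z₀)⁻¹) (Metric.sphere z₀ r) := fun z hz =>
    ((continuousAt_id.sub continuousAt_const).inv₀ (hne z hz)).continuousWithinAt
  have hcg : ContinuousOn g (Metric.sphere z₀ r) :=
    hd.continuousOn.mono Metric.sphere_subset_closedBall
  have i2 : CircleIntegrable (fun z => b * (z - z₀) ^ (-2 : ℤ)) z₀ r :=
    (continuousOn_const.mul hc2).circleIntegrable hr.1.le
  have i1 : CircleIntegrable (fun z => w * (z - z₀)⁻¹) z₀ r :=
    (continuousOn_const.mul hc1).circleIntegrable hr.1.le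
  have ig : CircleIntegrable g z₀ r := hcg.circleIntegrable hr.1.le
  have i21 : CircleIntegrable (fun z => b * (z - z₀) ^ (-2 : ℤ) + w * (z - z₀)⁻¹) z₀ r := i2.add i1
  have key : (∮ z in C(z₀, r), f z) =
      ∮ z in C(z₀, r), (b * (z - z₀) ^ (-2 : ℤ) + w * (z - z₀)⁻¹ + g z) := by
    refine circleIntegral.integral_congr hr.1.le fun z hz => ?_
    have hz' := Metric.sphere_subset_closedBall hz
    rw [(hball z (hsub hz')).1 (sub_ne_zero.1 (hne z hz)), div_eq_mul_inv, div_eq_mul_inv,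
      zpow_neg]
    norm_cast
  have hg0 : (∮ z in C(z₀, r), g z) = 0 :=
    Complex.circleIntegral_eq_zero_of_differentiable_on_off_countable hr.1.le Set.countable_empty
      hd.continuousOn fun z hz =>
        (hball z (hsub (Metric.ball_subset_closedBall hz.1))).2.differentiableAt
  rw [key, circleIntegral.integral_add i21 ig, circleIntegral.integral_add i2 i1, hg0,
    circleIntegral.integral_const_mul, circleIntegral.integral_const_mul,
    circleIntegral.integral_sub_zpow_of_ne (by norm_num), circleIntegral.integral_sub_center_inv _
    hr.1.ne']
  have : (Real.pi : ℂ) ≠ 0 := by exact_mod_cast Real.pi_ne_zero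
  field_simp
  ring

theorem HasResidue.unique {f : ℂ → ℂ} {z₀ w w' : ℂ} (h : HasResidue f z₀ w)
    (h' : HasResidue f z₀ w') : w = w' := by
  obtain ⟨r, hr, hr'⟩ := (h.2.and h'.2).exists
  rw [← hr, hr']

/-- Identity theorem: `f - g` has infinite order at `c + 1`, hence at every point of the connected
half-plane. Equality holds only off `z₀`, since the value of a meromorphic function at a single
point is arbitrary. -/
theorem continuation_unique {F f g : ℂ → ℂ} {c c' : ℝ} (hc : c' < c)
    (hf : IsMeromorphicContinuation F c c' f) (hg : IsMeromorphicContinuation F c c' g) {z₀ : ℂ}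
    (hz : c' < z₀.re) : f =ᶠ[𝓝[≠] z₀] g := by
  have hU : IsPreconnected {z : ℂ | c' < z.re} := (convex_halfSpace_re_gt c').isPreconnected
  have hm : MeromorphicOn (f - g) {z : ℂ | c' < z.re} := hf.1.sub hg.1
  have hp : c < (((c + 1 : ℝ) : ℂ)).re := by simp
  have htop : meromorphicOrderAt (f - g) ((c + 1 : ℝ) : ℂ) = ⊤ := by
    rw [meromorphicOrderAt_eq_top_iff]
    have : {z : ℂ | c < z.re} ∈ 𝓝 ((c + 1 : ℝ) : ℂ) :=
      (isOpen_lt continuous_const Complex.continuous_re).mem_nhds hp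
    filter_upwards [nhdsWithin_le_nhds this] with z hz
    rw [Pi.sub_apply, hf.2 hz, hg.2 hz, sub_self]
  have h : meromorphicOrderAt (f - g) z₀ = ⊤ := by
    by_contra h
    exact hm.meromorphicOrderAt_ne_top_of_isPreconnected hU hz (hc.trans hp) h htop
  rw [meromorphicOrderAt_eq_top_iff] at h
  filter_upwards [h] with z hz
  exact sub_eq_zero.1 hz

/-- `F`, given on `{Re z > x}`, continues to `{Re z > x - 1}` with at most a double pole at `x`
and residue `w` there. -/
def Continues (x : ℝ) (F : ℂ → ℂ) (w : ℂ) : Prop :=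
  ∃ (f : ℂ → ℂ) (b : ℂ), IsMeromorphicContinuation F x (x - 1) f ∧ HasPrincipalPart f (x : ℂ) b w

theorem Continues.add {x : ℝ} {F G H : ℂ → ℂ} {w w' : ℂ} (hF : Continues x F w)
    (hG : Continues x G w') (e : ∀ z : ℂ, x < z.re → H z = F z + G z) : Continues x H (w + w') := by
  obtain ⟨f, b, hf, pf⟩ := hF
  obtain ⟨g, b', hg, pg⟩ := hG
  refine ⟨f + g, b + b', ⟨hf.1.add hg.1, fun z hz => ?_⟩, pf.add pg⟩
  rw [Pi.add_apply, hf.2 hz, hg.2 hz, e z hz]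

theorem Continues.const_mul {x : ℝ} {F H : ℂ → ℂ} {w : ℂ} (c : ℂ) (hF : Continues x F w)
    (e : ∀ z : ℂ, x < z.re → H z = c * F z) : Continues x H (c * w) := by
  obtain ⟨f, b, hf, pf⟩ := hF
  refine ⟨fun z => c * f z, c * b, ⟨(MeromorphicOn.const c).mul hf.1, fun z hz => ?_⟩,
    pf.const_mul c⟩
  change c * f z = H z
  rw [hf.2 hz, e z hz]

theorem continues_zero {x : ℝ} {F : ℂ → ℂ} (e : ∀ z : ℂ, x < z.re → F z = 0) :
    Continues x F 0 :=
  ⟨fun _ => 0, 0, ⟨MeromorphicOn.const 0, fun z hz => (e z hz).symm⟩,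
    AnalyticAt.hasPrincipalPart analyticAt_const⟩

theorem Continues.hasResidue {x : ℝ} {F : ℂ → ℂ} {w : ℂ} (hF : Continues x F w) {f : ℂ → ℂ}
    (hf : IsMeromorphicContinuation F x (x - 1) f) : HasResidue f (x : ℂ) w := by
  obtain ⟨g, b, hg, pg⟩ := hF
  have hx : x - 1 < ((x : ℝ) : ℂ).re := by simp
  exact (pg.congr (continuation_unique (by linarith) hf hg hx)).hasResidue (hf.1 _ hx)

theorem Continues.unique {x : ℝ} {F : ℂ → ℂ} {w w' : ℂ} (h : Continues x F w)
    (h' : Continues x F w') : w = w' := by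
  obtain ⟨f, b, hf, pf⟩ := id h
  exact (h.hasResidue hf).unique (h'.hasResidue hf)

/-! ### Series `∑ cₙ [n+1]^{-z}` -/

/-- The series `∑ₙ cₙ [n + 1]_q^{-z}`. -/
def qseries (q : ℝ) (c : ℕ → ℂ) (z : ℂ) : ℂ :=
  ∑' n : ℕ, c n * ((qnum q ((n : ℝ) + 1) : ℝ) : ℂ) ^ (-z)

/-- `log (1 - q^{2(n+1)})`. -/
def logu (q : ℝ) (n : ℕ) : ℝ := Real.log (1 - q ^ (2 * (n + 1)))

theorem u_bounds {q : ℝ} (h0 : 0 < q) (h1 : q < 1) (n : ℕ) :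
    0 < 1 - q ^ 2 ∧ 1 - q ^ 2 ≤ 1 - q ^ (2 * (n + 1)) ∧ 1 - q ^ (2 * (n + 1)) < 1 := by
  have a : q ^ (2 * (n + 1)) ≤ q ^ 2 := pow_le_pow_of_le_one h0.le h1.le (by omega)
  have b : 0 < q ^ (2 * (n + 1)) := by positivity
  have c : q ^ 2 < 1 := pow_lt_one₀ h0.le h1 two_ne_zero
  exact ⟨by linarith, by linarith, by linarith⟩

/-- From `log u⁻¹ ≤ u⁻¹ - 1` with `u = 1 - q^{2(n+1)} ≥ 1 - q²`. -/
theorem abs_logu_le {q : ℝ} (h0 : 0 < q) (h1 : q < 1) (n : ℕ) :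
    |logu q n| ≤ (1 - q ^ 2)⁻¹ * q ^ (2 * n) := by
  obtain ⟨a, b, c⟩ := u_bounds h0 h1 n
  have hu := a.trans_le b
  rw [logu, abs_of_neg (Real.log_neg hu c), ← Real.log_inv]
  refine (Real.log_le_sub_one_of_pos (inv_pos.2 hu)).trans ?_
  have e : (1 - q ^ (2 * (n + 1)))⁻¹ - 1 = (1 - q ^ (2 * (n + 1)))⁻¹ * q ^ (2 * (n + 1)) := by
    field_simp
    ring
  rw [e]
  have : q ^ (2 * (n + 1)) ≤ q ^ (2 * n) := pow_le_pow_of_le_one h0.le h1.le (by omega)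
  gcongr

theorem abs_logu_le' {q : ℝ} (h0 : 0 < q) (h1 : q < 1) (n : ℕ) : |logu q n| ≤ (1 - q ^ 2)⁻¹ := by
  refine (abs_logu_le h0 h1 n).trans (mul_le_of_le_one_right ?_ (pow_le_one₀ h0.le h1.le))
  exact (inv_pos.2 (u_bounds h0 h1 n).1).le

theorem log_qnum {q : ℝ} (h0 : 0 < q) (h1 : q < 1) (n : ℕ) :
    0 < qnum q ((n : ℝ) + 1) ∧ Real.log (qnum q ((n : ℝ) + 1)) =
      -(((n : ℝ) + 1) * Real.log q) + logu q n - Real.log (q⁻¹ - q) := by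
  obtain ⟨a, b, c⟩ := u_bounds h0 h1 n
  have hu := a.trans_le b
  have hk := inv_sub_pos h0 h1
  have hp : 0 < q ^ (n + 1) := by positivity
  have e : qnum q ((n : ℝ) + 1) = (q ^ (n + 1))⁻¹ * (1 - q ^ (2 * (n + 1))) / (q⁻¹ - q) := by
    have : (n : ℝ) + 1 = ((n + 1 : ℕ) : ℝ) := by push_cast; rfl
    rw [qnum, this, Real.rpow_neg h0.le, Real.rpow_natCast, ← neg_sub q⁻¹ q, div_neg, ← neg_div,
      neg_sub]
    congr 1
    rw [mul_comm 2, pow_mul]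
    field_simp
  refine ⟨by rw [e]; positivity, ?_⟩
  rw [e, Real.log_div (by positivity) hk.ne', Real.log_mul (by positivity) hu.ne', Real.log_inv,
    Real.log_pow, logu]
  push_cast
  rfl

/-- The factor of `[n + 1]^{-z}` which does not depend on `n`. -/
def pre (q : ℝ) (z : ℂ) : ℂ := Complex.exp (z * ((Real.log q + Real.log (q⁻¹ - q) : ℝ) : ℂ))

theorem differentiable_pre (q : ℝ) : Differentiable ℂ (pre q) := by
  unfold pre
  fun_prop

/-- Separates a factor independent of `n`, a geometric factor, and a correction tending to `1`. -/
theorem qnum_cpow {q : ℝ} (h0 : 0 < q) (h1 : q < 1) (n : ℕ) (z : ℂ) :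
    ((qnum q ((n : ℝ) + 1) : ℝ) : ℂ) ^ (-z) =
      pre q z * (Complex.exp (z * Real.log q) ^ n * Complex.exp (-(z * logu q n))) := by
  obtain ⟨hp, hl⟩ := log_qnum h0 h1 n
  rw [Complex.cpow_def_of_ne_zero (by exact_mod_cast hp.ne'), ← Complex.ofReal_log hp.le, hl, pre,
    ← Complex.exp_nat_mul, ← Complex.exp_add, ← Complex.exp_add]
  congr 1
  push_cast
  ring

theorem norm_exp_pow {q : ℝ} (h0 : 0 < q) (n : ℕ) (z : ℂ) :
    ‖Complex.exp (z * Real.log q) ^ n‖ = q ^ (z.re * n) := by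
  rw [← Complex.exp_nat_mul, Complex.norm_exp, Real.rpow_def_of_pos h0]
  congr 1
  simp [Complex.mul_re]
  ring

/-- `cₙ = O((n + 1) q^{θ n})`. -/
def Growth (q θ : ℝ) (c : ℕ → ℂ) : Prop :=
  ∃ C : ℝ, 0 ≤ C ∧ ∀ n, ‖c n‖ ≤ C * (((n : ℝ) + 1) * q ^ (θ * n))

theorem Growth.add {q θ : ℝ} {c d : ℕ → ℂ} (hc : Growth q θ c) (hd : Growth q θ d) :
    Growth q θ (c + d) := by
  obtain ⟨C, hC0, hC⟩ := hc
  obtain ⟨D, hD0, hD⟩ := hd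
  refine ⟨C + D, by positivity, fun n => (norm_add_le _ _).trans ?_⟩
  rw [add_mul]
  exact add_le_add (hC n) (hD n)

theorem Growth.const_mul {q θ : ℝ} {c : ℕ → ℂ} (a : ℂ) (hc : Growth q θ c) :
    Growth q θ (fun n => a * c n) := by
  obtain ⟨C, hC0, hC⟩ := hc
  refine ⟨‖a‖ * C, by positivity, fun n => ?_⟩
  rw [norm_mul, mul_assoc]
  exact mul_le_mul_of_nonneg_left (hC n) (norm_nonneg _)

theorem Growth.mono {q θ θ' : ℝ} (h0 : 0 < q) (h1 : q < 1) {c : ℕ → ℂ} (hc : Growth q θ c)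
    (h : θ' ≤ θ) : Growth q θ' c := by
  obtain ⟨C, hC0, hC⟩ := hc
  refine ⟨C, hC0, fun n => (hC n).trans ?_⟩
  have : q ^ (θ * n) ≤ q ^ (θ' * n) :=
    Real.rpow_le_rpow_of_exponent_ge h0 h1.le (mul_le_mul_of_nonneg_right h n.cast_nonneg)
  gcongr

theorem growth_rpow {q : ℝ} (h0 : 0 < q) (θ : ℝ) :
    Growth q θ (fun n => ((q ^ (θ * n) : ℝ) : ℂ)) := by
  refine ⟨1, zero_le_one, fun n => ?_⟩
  have : 0 < q ^ (θ * n) := Real.rpow_pos_of_pos h0 _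
  rw [Complex.norm_real, Real.norm_eq_abs, abs_of_pos this, one_mul]
  exact le_mul_of_one_le_left this.le (by linarith [n.cast_nonneg (α := ℝ)])

theorem growth_succ_mul_rpow {q : ℝ} (h0 : 0 < q) (θ : ℝ) :
    Growth q θ (fun n => ((((n : ℝ) + 1) * q ^ (θ * n) : ℝ) : ℂ)) := by
  refine ⟨1, zero_le_one, fun n => ?_⟩
  have : 0 < q ^ (θ * n) := Real.rpow_pos_of_pos h0 _
  rw [Complex.norm_real, Real.norm_eq_abs, abs_of_nonneg (by positivity), one_mul]

/-- A locally uniform bound for a series of functions of `z`. -/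
def SeriesBound (q θ : ℝ) (g : ℕ → ℂ → ℂ) : Prop :=
  ∀ R : ℝ, ∃ C : ℝ, 0 ≤ C ∧ ∀ n z, ‖z‖ ≤ R → ‖g n z‖ ≤ C * (((n : ℝ) + 1) * q ^ ((θ + z.re) * n))

theorem summable_succ_mul_rpow {q : ℝ} (h0 : 0 < q) (h1 : q < 1) {ε : ℝ} (hε : 0 < ε) :
    Summable fun n : ℕ => ((n : ℝ) + 1) * q ^ (ε * n) := by
  have hr : ‖q ^ ε‖ < 1 := by
    rw [Real.norm_eq_abs, abs_of_pos (Real.rpow_pos_of_pos h0 _)]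
    exact Real.rpow_lt_one h0.le h1 hε
  have s1 := summable_pow_mul_geometric_of_norm_lt_one 1 hr
  have s0 := summable_pow_mul_geometric_of_norm_lt_one 0 hr
  refine (s1.add s0).congr fun n => ?_
  rw [Real.rpow_mul h0.le, Real.rpow_natCast]
  ring

theorem SeriesBound.summable {q θ : ℝ} (h0 : 0 < q) (h1 : q < 1) {g : ℕ → ℂ → ℂ}
    (hg : SeriesBound q θ g) {z : ℂ} (hz : -θ < z.re) : Summable fun n => g n z := by
  obtain ⟨C, _, hC⟩ := hg ‖z‖
  exact Summable.of_norm_bounded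
    ((summable_succ_mul_rpow h0 h1 (show 0 < θ + z.re by linarith)).mul_left C)
    fun n => hC n z le_rfl

theorem SeriesBound.differentiableOn {q θ : ℝ} (h0 : 0 < q) (h1 : q < 1) {g : ℕ → ℂ → ℂ}
    (hg : SeriesBound q θ g) (hd : ∀ n, Differentiable ℂ (g n)) :
    DifferentiableOn ℂ (fun z => ∑' n, g n z) {z : ℂ | -θ < z.re} := by
  intro z₀ hz₀
  have hz₀' : -θ < z₀.re := hz₀
  -- The midpoint between the abscissa `-θ` and `Re z₀`. The ball keeps `‖z‖` bounded, so one
  -- summable majorant serves the whole neighbourhood `U`.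
  let δ : ℝ := (z₀.re - θ) / 2
  let U : Set ℂ := {z | δ < z.re} ∩ Metric.ball 0 (‖z₀‖ + 1)
  have hU : IsOpen U :=
    (isOpen_lt continuous_const Complex.continuous_re).inter Metric.isOpen_ball
  have hzU : z₀ ∈ U := ⟨show (z₀.re - θ) / 2 < z₀.re by linarith, by simp⟩
  obtain ⟨C, hC0, hC⟩ := hg (‖z₀‖ + 1)
  have hs := (summable_succ_mul_rpow h0 h1 (ε := θ + δ) (by simp only [δ]; linarith)).mul_left C
  have := Complex.differentiableOn_tsum_of_summable_norm hs
    (fun n => (hd n).differentiableOn) hU fun n z hz => by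
      have hz2 : ‖z‖ ≤ ‖z₀‖ + 1 := by simpa using (Metric.mem_ball.1 hz.2).le
      refine (hC n z hz2).trans ?_
      have hz1 : δ < z.re := hz.1
      have : q ^ ((θ + z.re) * n) ≤ q ^ ((θ + δ) * n) :=
        Real.rpow_le_rpow_of_exponent_ge h0 h1.le
          (mul_le_mul_of_nonneg_right (by linarith) n.cast_nonneg)
      gcongr
  exact ((this z₀ hzU).differentiableAt (hU.mem_nhds hzU)).differentiableWithinAt

theorem norm_logu_mul_le {q : ℝ} (h0 : 0 < q) (h1 : q < 1) (n : ℕ) {z : ℂ} {R : ℝ} (hz : ‖z‖ ≤ R) :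
    ‖-(z * logu q n)‖ ≤ R * (1 - q ^ 2)⁻¹ := by
  rw [norm_neg, norm_mul, Complex.norm_real, Real.norm_eq_abs]
  exact mul_le_mul hz (abs_logu_le' h0 h1 n) (abs_nonneg _) ((norm_nonneg z).trans hz)

theorem rpow_add_mul {q : ℝ} (h0 : 0 < q) (a b x : ℝ) :
    q ^ ((a + b) * x) = q ^ (a * x) * q ^ (b * x) := by
  rw [add_mul, Real.rpow_add h0]

theorem Growth.seriesBound {q θ : ℝ} (h0 : 0 < q) (h1 : q < 1) {c : ℕ → ℂ} (hc : Growth q θ c) :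
    SeriesBound q θ fun n z =>
      c n * (Complex.exp (z * Real.log q) ^ n * Complex.exp (-(z * logu q n))) := by
  intro R
  obtain ⟨C, hC0, hC⟩ := hc
  refine ⟨C * Real.exp (R * (1 - q ^ 2)⁻¹), by positivity, fun n z hz => ?_⟩
  rw [norm_mul, norm_mul, norm_exp_pow h0, rpow_add_mul h0]
  have h2 : ‖Complex.exp (-(z * logu q n))‖ ≤ Real.exp (R * (1 - q ^ 2)⁻¹) := by
    rw [Complex.norm_exp]
    exact Real.exp_le_exp.2 ((Complex.re_le_norm _).trans (norm_logu_mul_le h0 h1 n hz))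
  have h3 : 0 ≤ q ^ (z.re * n) := (Real.rpow_pos_of_pos h0 _).le
  have h4 : 0 ≤ q ^ (θ * n) := (Real.rpow_pos_of_pos h0 _).le
  calc _ ≤ (C * (((n : ℝ) + 1) * q ^ (θ * n))) *
        (q ^ (z.re * n) * Real.exp (R * (1 - q ^ 2)⁻¹)) := by
        gcongr
        exact hC n
    _ = _ := by ring

/-- `e^w - 1 = O(|w|)` for bounded `w`, and `w = -z logu` is `O(q^{2n})`: the correction gains two
units of convergence, more than the one unit needed. -/
theorem Growth.seriesBound_sub_one {q θ : ℝ} (h0 : 0 < q) (h1 : q < 1) {c : ℕ → ℂ}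
    (hc : Growth q θ c) :
    SeriesBound q (θ + 2) fun n z =>
      c n * (Complex.exp (z * Real.log q) ^ n * (Complex.exp (-(z * logu q n)) - 1)) := by
  intro R
  obtain ⟨C, hC0, hC⟩ := hc
  have hw := (u_bounds h0 h1 0).1
  refine ⟨C * (|R| * (1 - q ^ 2)⁻¹ * Real.exp (R * (1 - q ^ 2)⁻¹)), by positivity,
    fun n z hz => ?_⟩
  have hR : 0 ≤ R := (norm_nonneg z).trans hz
  rw [norm_mul, norm_mul, norm_exp_pow h0, rpow_add_mul h0, rpow_add_mul h0, abs_of_nonneg hR]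
  have h2 : ‖Complex.exp (-(z * logu q n)) - 1‖ ≤
      R * ((1 - q ^ 2)⁻¹ * q ^ ((2 : ℝ) * n)) * Real.exp (R * (1 - q ^ 2)⁻¹) := by
    have := Complex.norm_exp_sub_sum_le_norm_mul_exp (-(z * logu q n)) 1
    simp only [Finset.range_one, Finset.sum_singleton, pow_zero, Nat.factorial_zero, Nat.cast_one,
      div_one, pow_one] at this
    refine this.trans ?_
    have e2 : q ^ ((2 : ℝ) * n) = q ^ (2 * n) := by
      rw [← Real.rpow_natCast]
      push_cast
      rfl
    have h5 : ‖-(z * logu q n)‖ ≤ R * ((1 - q ^ 2)⁻¹ * q ^ (2 * n)) := by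
      rw [norm_neg, norm_mul, Complex.norm_real, Real.norm_eq_abs]
      exact mul_le_mul hz (abs_logu_le h0 h1 n) (abs_nonneg _) hR
    rw [e2]
    gcongr
    exact norm_logu_mul_le h0 h1 n hz
  have h3 : 0 ≤ q ^ (z.re * n) := (Real.rpow_pos_of_pos h0 _).le
  have h4 : 0 ≤ q ^ (θ * n) := (Real.rpow_pos_of_pos h0 _).le
  calc _ ≤ (C * (((n : ℝ) + 1) * q ^ (θ * n))) * (q ^ (z.re * n) *
        (R * ((1 - q ^ 2)⁻¹ * q ^ ((2 : ℝ) * n)) * Real.exp (R * (1 - q ^ 2)⁻¹))) := by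
        gcongr
        exact hC n
    _ = _ := by ring

theorem qseries_eq {q : ℝ} (h0 : 0 < q) (h1 : q < 1) (c : ℕ → ℂ) (z : ℂ) :
    qseries q c z = pre q z *
      ∑' n, c n * (Complex.exp (z * Real.log q) ^ n * Complex.exp (-(z * logu q n))) := by
  rw [qseries, ← tsum_mul_left]
  refine tsum_congr fun n => ?_
  rw [qnum_cpow h0 h1]
  ring

theorem Growth.summable {q θ : ℝ} (h0 : 0 < q) (h1 : q < 1) {c : ℕ → ℂ} (hc : Growth q θ c)
    {z : ℂ} (hz : -θ < z.re) :
    Summable fun n : ℕ => c n * ((qnum q ((n : ℝ) + 1) : ℝ) : ℂ) ^ (-z) := by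
  refine (((hc.seriesBound h0 h1).summable h0 h1 hz).mul_left (pre q z)).congr fun n => ?_
  rw [qnum_cpow h0 h1]
  ring

theorem Growth.qseries_add {q θ : ℝ} (h0 : 0 < q) (h1 : q < 1) {c d : ℕ → ℂ} (hc : Growth q θ c)
    (hd : Growth q θ d) {z : ℂ} (hz : -θ < z.re) :
    qseries q (c + d) z = qseries q c z + qseries q d z := by
  rw [qseries, qseries, qseries, ← (hc.summable h0 h1 hz).tsum_add (hd.summable h0 h1 hz)]
  exact tsum_congr fun n => add_mul _ _ _

theorem qseries_const_mul (q : ℝ) (a : ℂ) (c : ℕ → ℂ) (z : ℂ) :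
    qseries q (fun n => a * c n) z = a * qseries q c z := by
  rw [qseries, qseries, ← tsum_mul_left]
  exact tsum_congr fun n => mul_assoc _ _ _

theorem Growth.differentiableOn {q θ : ℝ} (h0 : 0 < q) (h1 : q < 1) {c : ℕ → ℂ}
    (hc : Growth q θ c) : DifferentiableOn ℂ (qseries q c) {z : ℂ | -θ < z.re} := by
  rw [funext (qseries_eq h0 h1 c)]
  refine (differentiable_pre q).differentiableOn.mul
    ((hc.seriesBound h0 h1).differentiableOn h0 h1 fun n => ?_)
  fun_prop

theorem isOpen_re_gt (c : ℝ) : IsOpen {z : ℂ | c < z.re} :=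
  isOpen_lt continuous_const Complex.continuous_re

theorem DifferentiableOn.analyticAt_re {f : ℂ → ℂ} {c : ℝ}
    (h : DifferentiableOn ℂ f {z : ℂ | c < z.re}) {z : ℂ} (hz : c < z.re) : AnalyticAt ℂ f z :=
  h.analyticAt ((isOpen_re_gt c).mem_nhds hz)

/-- Disposes of error terms: coefficients smaller by `qⁿ` than the critical size still converge on
the whole larger half-plane. -/
theorem Growth.continues {q x : ℝ} (h0 : 0 < q) (h1 : q < 1) {c : ℕ → ℂ}
    (hc : Growth q (1 - x) c) : Continues x (qseries q c) 0 := by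
  have hd := hc.differentiableOn h0 h1
  rw [neg_sub] at hd
  exact ⟨qseries q c, 0,
    ⟨fun z hz => (DifferentiableOn.analyticAt_re hd hz).meromorphicAt, fun _ _ => rfl⟩,
    AnalyticAt.hasPrincipalPart (DifferentiableOn.analyticAt_re hd (by simp))⟩

/-- The sum of the corrections which come from `[n + 1] ≠ q^{-n-1} / (q⁻¹ - q)`. -/
def rest (q : ℝ) (c : ℕ → ℂ) (z : ℂ) : ℂ :=
  ∑' n, c n * (Complex.exp (z * Real.log q) ^ n * (Complex.exp (-(z * logu q n)) - 1))

theorem Growth.analyticAt_rest {q θ : ℝ} (h0 : 0 < q) (h1 : q < 1) {c : ℕ → ℂ} (hc : Growth q θ c)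
    {z : ℂ} (hz : -(θ + 2) < z.re) : AnalyticAt ℂ (rest q c) z :=
  DifferentiableOn.analyticAt_re
    ((hc.seriesBound_sub_one h0 h1).differentiableOn h0 h1 fun n => by fun_prop) hz

/-- Reduces the continuation to that of the power series `∑ cₙ q^{nz}`, which is explicit for the
leading terms. -/
theorem Growth.qseries_eq_rest {q θ : ℝ} (h0 : 0 < q) (h1 : q < 1) {c : ℕ → ℂ} (hc : Growth q θ c)
    {z w : ℂ} (hz : -θ < z.re) (hw : HasSum (fun n => c n * Complex.exp (z * Real.log q) ^ n) w) :
    qseries q c z = pre q z * w + pre q z * rest q c z := by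
  rw [qseries_eq h0 h1, ← mul_add, rest, ← hw.tsum_eq, ← hw.summable.tsum_add
    ((hc.seriesBound_sub_one h0 h1).summable h0 h1 (by linarith))]
  congr 1
  exact tsum_congr fun n => by ring

/-! ### Continuation of the leading terms -/

theorem continues_of_analyticAt {x : ℝ} {F : ℂ → ℂ}
    (h : ∀ z : ℂ, x - 1 < z.re → AnalyticAt ℂ F z) : Continues x F 0 :=
  ⟨F, 0, ⟨fun z hz => (h z hz).meromorphicAt, fun _ _ => rfl⟩,
    AnalyticAt.hasPrincipalPart (h _ (by simp))⟩

theorem analyticAt_pre (q : ℝ) (z : ℂ) : AnalyticAt ℂ (pre q) z := (differentiable_pre q).analyticAt z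

theorem continues_pre_mul_rest {q θ x : ℝ} (h0 : 0 < q) (h1 : q < 1) {c : ℕ → ℂ}
    (hc : Growth q θ c) (hθ : -x ≤ θ) : Continues x (fun z => pre q z * rest q c z) 0 :=
  continues_of_analyticAt fun z hz =>
    (analyticAt_pre q z).mul (hc.analyticAt_rest h0 h1 (by linarith))

/-- `q^{θ + z}`. -/
def ratio (q θ : ℝ) (z : ℂ) : ℂ := Complex.exp ((θ + z) * Real.log q)

theorem analyticAt_ratio (q θ : ℝ) (z : ℂ) : AnalyticAt ℂ (ratio q θ) z := by
  have : Differentiable ℂ (ratio q θ) := by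
    unfold ratio
    fun_prop
  exact this.analyticAt z

theorem norm_ratio_lt_one {q θ : ℝ} (h0 : 0 < q) (h1 : q < 1) {z : ℂ} (hz : -θ < z.re) :
    ‖ratio q θ z‖ < 1 := by
  rw [ratio, Complex.norm_exp, Real.exp_lt_one_iff]
  have := Real.log_neg h0 h1
  have h2 : ((θ + z) * Real.log q).re = (θ + z.re) * Real.log q := by simp
  rw [h2]
  exact mul_neg_of_pos_of_neg (by linarith) this

theorem rpow_mul_exp_pow {q : ℝ} (h0 : 0 < q) (θ : ℝ) (n : ℕ) (z : ℂ) :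
    ((q ^ (θ * n) : ℝ) : ℂ) * Complex.exp (z * Real.log q) ^ n = ratio q θ z ^ n := by
  rw [Real.rpow_def_of_pos h0, Complex.ofReal_exp, ratio, ← Complex.exp_nat_mul,
    ← Complex.exp_nat_mul, ← Complex.exp_add]
  congr 1
  push_cast
  ring

theorem meromorphicAt_pre_mul_inv_pow (q θ : ℝ) (m : ℕ) (z : ℂ) :
    MeromorphicAt (fun z => pre q z * ((1 - ratio q θ z) ^ m)⁻¹) z :=
  (analyticAt_pre q z).meromorphicAt.mul
    ((analyticAt_const.sub (analyticAt_ratio q θ z)).pow m).meromorphicAt.inv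

/-- The function is meromorphic on the whole plane with poles where `q^{θ+z} = 1`. Under `-x ≤ θ`
the point `x` is one of them only if `θ = -x`. The derivative of `q^{θ+z}` there is `log q`. -/
theorem continues_pre_mul_inv {q θ x : ℝ} (h0 : 0 < q) (h1 : q < 1) (hθ : -x ≤ θ) :
    Continues x (fun z => pre q z * ((1 - ratio q θ z) ^ 1)⁻¹)
      (if θ = -x then -(pre q x / Real.log q) else 0) := by
  have hL : (Real.log q : ℂ) ≠ 0 := by exact_mod_cast (Real.log_neg h0 h1).ne
  by_cases h : θ = -x
  · subst h
    rw [if_pos rfl]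
    refine ⟨_, 0, ⟨fun z _ => meromorphicAt_pre_mul_inv_pow q _ 1 z, fun _ _ => rfl⟩, ?_⟩
    let k := dslope (ratio q (-x)) (x : ℂ)
    have hk : AnalyticAt ℂ k x := analyticAt_dslope (analyticAt_ratio q _ _)
    have hkx : k x = Real.log q := by
      have : HasDerivAt (ratio q (-x)) (Complex.exp ((((-x : ℝ) : ℂ) + x) * Real.log q) *
          (1 * Real.log q)) x :=
        (((hasDerivAt_id (x : ℂ)).const_add _).mul_const _).cexp
      rw [show k x = deriv (ratio q (-x)) x from dslope_same _ _, this.deriv]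
      simp
    have h1r : ∀ z, 1 - ratio q (-x) z = -((z - x) * k z) := by
      intro z
      rw [eq_add_mul_dslope (ratio q (-x)) x z]
      have : ratio q (-x) x = 1 := by simp [ratio]
      rw [this]
      ring
    have ha : AnalyticAt ℂ (fun z => pre q z * (-k z)⁻¹) x :=
      (analyticAt_pre q _).mul (hk.neg.inv (by rw [Pi.neg_apply, hkx]; exact neg_ne_zero.2 hL))
    have := hasPrincipalPart_simple (f := fun z => pre q z * ((1 - ratio q (-x) z) ^ 1)⁻¹) ha
      (Filter.Eventually.of_forall fun z => by
        rw [h1r, pow_one, ← mul_neg, mul_inv, div_eq_mul_inv]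
        ring)
    rwa [hkx, inv_neg, mul_neg, ← div_eq_mul_inv] at this
  · rw [if_neg h]
    have hlt : -θ < ((x : ℝ) : ℂ).re := by
      rw [Complex.ofReal_re]
      rcases hθ.lt_or_eq with h' | h'
      · linarith
      · exact absurd h'.symm h
    refine ⟨_, 0, ⟨fun z _ => meromorphicAt_pre_mul_inv_pow q _ 1 z, fun _ _ => rfl⟩,
      AnalyticAt.hasPrincipalPart ((analyticAt_pre q _).mul
        (((analyticAt_const.sub (analyticAt_ratio q θ _)).pow 1).inv ?_))⟩
    rw [Pi.pow_apply, Pi.sub_apply, pow_one]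
    intro h'
    have := norm_ratio_lt_one h0 h1 hlt
    rw [← sub_eq_zero.1 h', norm_one] at this
    exact lt_irrefl _ this

theorem continues_rpow {q θ x : ℝ} (h0 : 0 < q) (h1 : q < 1) (hθ : -x ≤ θ) :
    Continues x (qseries q fun n => ((q ^ (θ * n) : ℝ) : ℂ))
      (if θ = -x then -(pre q x / Real.log q) else 0) := by
  have hc := growth_rpow h0 θ
  have := (continues_pre_mul_inv h0 h1 hθ).add (continues_pre_mul_rest h0 h1 hc hθ)
    (H := qseries q fun n => ((q ^ (θ * n) : ℝ) : ℂ)) fun z hz => by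
      refine hc.qseries_eq_rest h0 h1 (by linarith) ?_
      simp only [rpow_mul_exp_pow h0, pow_one]
      exact hasSum_geometric_of_norm_lt_one (norm_ratio_lt_one h0 h1 (by linarith))
  rwa [add_zero] at this

/-! ### The double pole at `z = 0` -/

/-- The entire function `(q^{z/2} - q^{-z/2}) / z`. -/
def sinhc (q : ℝ) : ℂ → ℂ :=
  dslope (fun z => Complex.exp (z * Real.log q / 2) - Complex.exp (-(z * Real.log q / 2))) 0

theorem mul_sinhc (q : ℝ) (z : ℂ) : z * sinhc q z =
    Complex.exp (z * Real.log q / 2) - Complex.exp (-(z * Real.log q / 2)) := by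
  have := eq_add_mul_dslope
    (fun z : ℂ => Complex.exp (z * Real.log q / 2) - Complex.exp (-(z * Real.log q / 2))) 0 z
  simp only [zero_mul, zero_div, neg_zero, sub_self, zero_add, sub_zero] at this
  exact this.symm

theorem analyticAt_sinhc (q : ℝ) : AnalyticAt ℂ (sinhc q) 0 := by
  refine analyticAt_dslope ?_
  have : Differentiable ℂ fun z : ℂ =>
      Complex.exp (z * Real.log q / 2) - Complex.exp (-(z * Real.log q / 2)) := by fun_prop
  exact this.analyticAt 0

theorem sinhc_zero (q : ℝ) : sinhc q 0 = Real.log q := by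
  have h1 : HasDerivAt (fun z : ℂ => z * Real.log q / 2) (1 * Real.log q / 2) 0 :=
    ((hasDerivAt_id (0 : ℂ)).mul_const _).div_const _
  rw [sinhc, dslope_same]
  refine (h1.cexp.sub h1.neg.cexp).deriv.trans ?_
  simp

theorem sinhc_neg (q : ℝ) (z : ℂ) : sinhc q (-z) = sinhc q z := by
  by_cases h : z = 0
  · simp [h]
  · refine mul_left_cancel₀ h ?_
    have := mul_sinhc q (-z)
    rw [mul_sinhc q z]
    simp only [neg_mul, neg_div, neg_neg] at this
    linear_combination -this

/-- By evenness. Consequently the denominator of the double pole contributes nothing to the residue.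
-/
theorem deriv_sinhc_zero (q : ℝ) : deriv (sinhc q) 0 = 0 := by
  have h := deriv_comp_neg (sinhc q) 0
  simp only [sinhc_neg, neg_zero] at h
  change deriv (sinhc q) 0 = -deriv (sinhc q) 0 at h
  exact self_eq_neg.1 h

/-- `∑ (n+1) q^{nz} = (1 - q^z)⁻²` has a double pole at `0`, so the residue is the first derivative
of the regular factor `φ`. -/
theorem continues_succ {q : ℝ} (h0 : 0 < q) (h1 : q < 1) :
    Continues 0 (qseries q fun n => ((((n : ℝ) + 1) * q ^ ((0 : ℝ) * n) : ℝ) : ℂ))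
      (Real.log (q⁻¹ - q) / (Real.log q : ℂ) ^ 2) := by
  have hL : (Real.log q : ℂ) ≠ 0 := by exact_mod_cast (Real.log_neg h0 h1).ne
  have hc := growth_succ_mul_rpow h0 0
  have key : Continues 0 (fun z => pre q z * ((1 - ratio q 0 z) ^ 2)⁻¹)
      (Real.log (q⁻¹ - q) / (Real.log q : ℂ) ^ 2) := by
    let φ : ℂ → ℂ := fun z => Complex.exp (z * Real.log (q⁻¹ - q)) / sinhc q z ^ 2
    have hE : HasDerivAt (fun z : ℂ => Complex.exp (z * Real.log (q⁻¹ - q)))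
        (Complex.exp (0 * Real.log (q⁻¹ - q)) * (1 * Real.log (q⁻¹ - q))) 0 :=
      ((hasDerivAt_id (0 : ℂ)).mul_const _).cexp
    have hS : HasDerivAt (fun z => sinhc q z ^ 2) 0 0 := by
      have := (analyticAt_sinhc q).differentiableAt.hasDerivAt.pow 2
      rw [deriv_sinhc_zero, mul_zero] at this
      exact this
    have hS0 : sinhc q 0 ^ 2 ≠ 0 := by
      rw [sinhc_zero]
      exact pow_ne_zero 2 hL
    have hφ : AnalyticAt ℂ φ 0 := by
      have : Differentiable ℂ fun z : ℂ => Complex.exp (z * Real.log (q⁻¹ - q)) := by fun_prop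
      exact (this.analyticAt 0).div ((analyticAt_sinhc q).pow 2) hS0
    have hd : deriv φ 0 = Real.log (q⁻¹ - q) / (Real.log q : ℂ) ^ 2 := by
      refine (hE.div hS hS0).deriv.trans ?_
      rw [sinhc_zero]
      simp
      field_simp
    refine ⟨_, φ 0, ⟨fun z _ => meromorphicAt_pre_mul_inv_pow q _ 2 z, fun _ _ => rfl⟩, ?_⟩
    rw [← hd, Complex.ofReal_zero]
    refine hasPrincipalPart_double hφ ?_
    filter_upwards [self_mem_nhdsWithin] with z hz
    -- Symmetrising by `q^{z/2}` makes its square cancel the `q^z` in `pre`; only `(q⁻¹ - q)^z` over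
    -- an even function is left.
    have e1 : (1 - ratio q 0 z) = -(Complex.exp (z * Real.log q / 2) * (z * sinhc q z)) := by
      rw [mul_sinhc, mul_sub, ← Complex.exp_add, ← Complex.exp_add, ratio, add_neg_cancel,
        Complex.exp_zero, Complex.ofReal_zero, zero_add, add_halves]
      ring
    have e2 : pre q z = Complex.exp (z * Real.log q / 2) ^ 2 *
        Complex.exp (z * Real.log (q⁻¹ - q)) := by
      rw [pre, ← Complex.exp_nat_mul, ← Complex.exp_add]
      congr 1
      push_cast
      ring
    have e3 := Complex.exp_ne_zero (z * Real.log q / 2)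
    rw [e1, e2, sub_zero, neg_sq, mul_pow, mul_pow, mul_inv, mul_inv]
    simp only [φ]
    field_simp
  have := key.add (continues_pre_mul_rest h0 h1 hc (by simp))
    (H := qseries q fun n => ((((n : ℝ) + 1) * q ^ ((0 : ℝ) * n) : ℝ) : ℂ)) fun z hz => by
      refine hc.qseries_eq_rest h0 h1 (by linarith) ?_
      have hr := norm_ratio_lt_one (θ := 0) h0 h1 (z := z) (by linarith)
      have hne : 1 - ratio q 0 z ≠ 0 := by
        intro h'
        rw [← sub_eq_zero.1 h', norm_one] at hr
        exact lt_irrefl _ hr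
      have h2 := (hasSum_coe_mul_geometric_of_norm_lt_one hr).add
        (hasSum_geometric_of_norm_lt_one hr)
      convert! h2 using 1
      · funext n
        rw [← rpow_mul_exp_pow h0 0 n z]
        push_cast
        ring
      · field_simp
        ring
  rwa [add_zero] at this

/-! ### The zeta functions -/

/-- `∑_k q^{2μk} d(l, k)`, for `l = n + 1/2`. -/
def wsum (q μ : ℝ) (d : Idx → ℂ) (n : ℕ) : ℂ :=
  ∑ p : Fin (2 * n + 2), ((q ^ (2 * μ * Idx.k ⟨n, p⟩) : ℝ) : ℂ) * d ⟨n, p⟩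

theorem wsum_add (q μ : ℝ) (d d' : Idx → ℂ) : wsum q μ (d + d') = wsum q μ d + wsum q μ d' := by
  funext n
  simp only [wsum, Pi.add_apply, mul_add, Finset.sum_add_distrib]

theorem wsum_smul (q μ : ℝ) (c : ℂ) (d : Idx → ℂ) :
    wsum q μ (fun i => c * d i) = fun n => c * wsum q μ d n := by
  funext n
  rw [wsum, wsum, Finset.mul_sum]
  exact Finset.sum_congr rfl fun p _ => by ring

theorem rpow_k_le {q : ℝ} (h0 : 0 < q) (h1 : q < 1) (μ : ℝ) (i : Idx) :
    q ^ (2 * μ * i.k) ≤ q ^ (-|μ|) * q ^ (-(2 * |μ|) * i.1) := by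
  rw [← Real.rpow_add h0]
  refine Real.rpow_le_rpow_of_exponent_ge h0 h1.le ?_
  have h2 : ((i.2 : ℕ) : ℝ) ≤ 2 * i.1 + 1 := by exact_mod_cast Nat.lt_succ_iff.1 i.2.2
  have h3 : (0 : ℝ) ≤ (i.2 : ℕ) := Nat.cast_nonneg _
  have hk : |i.k| ≤ i.1 + 1 / 2 := by
    rw [Idx.k, Idx.l, abs_le]
    constructor <;> linarith
  have h4 : |μ * i.k| ≤ |μ| * (i.1 + 1 / 2) := by
    rw [abs_mul]
    exact mul_le_mul_of_nonneg_left hk (abs_nonneg _)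
  have := neg_abs_le (μ * i.k)
  linarith

/-- The `2n+2` values of `k` account for the factor `n + 1` in `Growth`, and the bound `|k| ≤ n +
1/2` for the loss `2|μ|` in the exponent. -/
theorem growth_wsum {q : ℝ} (h0 : 0 < q) (h1 : q < 1) (μ ν : ℝ) {d : Idx → ℂ} {C : ℝ} (hC0 : 0 ≤ C)
    (hd : ∀ i, ‖d i‖ ≤ C * q ^ (ν * i.1)) : Growth q (ν - 2 * |μ|) (wsum q μ d) := by
  refine ⟨2 * q ^ (-|μ|) * C, mul_nonneg (mul_nonneg zero_le_two (Real.rpow_pos_of_pos h0 _).le)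
    hC0, fun n => ?_⟩
  have hb : ∀ p ∈ (Finset.univ : Finset (Fin (2 * n + 2))),
      ‖((q ^ (2 * μ * Idx.k ⟨n, p⟩) : ℝ) : ℂ) * d ⟨n, p⟩‖ ≤
        q ^ (-|μ|) * q ^ (-(2 * |μ|) * n) * (C * q ^ (ν * n)) := by
    intro p _
    rw [norm_mul, Complex.norm_real, Real.norm_eq_abs, abs_of_pos (Real.rpow_pos_of_pos h0 _)]
    exact mul_le_mul (rpow_k_le h0 h1 μ ⟨n, p⟩) (hd ⟨n, p⟩) (norm_nonneg _)
      (mul_nonneg (Real.rpow_pos_of_pos h0 _).le (Real.rpow_pos_of_pos h0 _).le)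
  refine (norm_sum_le_of_le _ hb).trans (le_of_eq ?_)
  rw [Finset.sum_const, Finset.card_univ, Fintype.card_fin, nsmul_eq_mul, sub_eq_add_neg,
    rpow_add_mul h0]
  push_cast
  ring

/-- The diagonal matrix coefficients of `a` on `H_±`. -/
def diagCoef (q : ℝ) (hq : 0 < q ∧ q < 1) (s : ℤˣ) (a : Sphere q) (i : Idx) : ℂ :=
  rep q hq s a (Finsupp.single i 1) i

theorem diagCoef_add {q : ℝ} (hq : 0 < q ∧ q < 1) (s : ℤˣ) (a b : Sphere q) :
    diagCoef q hq s (a + b) = diagCoef q hq s a + diagCoef q hq s b := by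
  funext i
  simp [diagCoef]

theorem diagCoef_smul {q : ℝ} (hq : 0 < q ∧ q < 1) (s : ℤˣ) (c : ℂ) (a : Sphere q) :
    diagCoef q hq s (c • a) = fun i => c * diagCoef q hq s a i := by
  funext i
  simp [diagCoef]

theorem growth_diagCoef {q : ℝ} (hq : 0 < q ∧ q < 1) (s : ℤˣ) (μ : ℝ) (a : Sphere q) :
    Growth q (-(2 * |μ|)) (wsum q μ (diagCoef q hq s a)) := by
  obtain ⟨C, hC0, hC⟩ := bdd_rep hq s a
  have := growth_wsum hq.1 hq.2 μ 0 (d := diagCoef q hq s a) hC0 fun i => by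
    rw [zero_mul, Real.rpow_zero]
    exact (norm_apply_le_l1 _ i).trans (hC i)
  rwa [zero_sub] at this

theorem zetaOp_single {q : ℝ} (hq : 0 < q ∧ q < 1) (s : ℤˣ) (μ : ℝ) (a : Sphere q) (z : ℂ)
    (i : Idx) : zetaOp q hq s μ a z (Finsupp.single i 1) =
      (((q ^ (2 * μ * i.k) : ℝ) : ℂ) * ((qnum q ((i.1 : ℝ) + 1) : ℝ) : ℂ) ^ (-z)) •
        rep q hq s a (Finsupp.single i 1) := by
  have e : i.l + 1 / 2 = (i.1 : ℝ) + 1 := by rw [Idx.l]; ring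
  rw [zetaOp, Module.End.mul_apply, Module.End.mul_apply, opAbsD, diag_single, map_smul, opK,
    diag_single, smul_smul, map_smul, e, mul_comm]

theorem summable_zetaOp {q : ℝ} (hq : 0 < q ∧ q < 1) (s : ℤˣ) (μ : ℝ) (a : Sphere q) {z : ℂ}
    (hz : 2 * |μ| < z.re) :
    Summable fun i : Idx => l1 (zetaOp q hq s μ a z (Finsupp.single i 1)) := by
  obtain ⟨C, hC0, hC⟩ := bdd_rep hq s a
  let B : ℕ → ℝ := fun n => C * q ^ (-|μ|) *
    ‖((q ^ (-(2 * |μ|) * n) : ℝ) : ℂ) * ((qnum q ((n : ℝ) + 1) : ℝ) : ℂ) ^ (-z)‖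
  have hB : ∀ i : Idx, l1 (zetaOp q hq s μ a z (Finsupp.single i 1)) ≤ B i.1 := by
    intro i
    have hp := Real.rpow_pos_of_pos hq.1 (2 * μ * i.k)
    have hp' := Real.rpow_pos_of_pos hq.1 (-(2 * |μ|) * (i.1 : ℝ))
    have hC' := hC i
    rw [mul_one] at hC'
    rw [zetaOp_single, l1_smul, norm_mul, Complex.norm_real, Real.norm_eq_abs, abs_of_pos hp]
    simp only [B]
    rw [norm_mul, Complex.norm_real, Real.norm_eq_abs, abs_of_pos hp']
    calc _ ≤ (q ^ (-|μ|) * q ^ (-(2 * |μ|) * (i.1 : ℝ))) *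
          ‖((qnum q ((i.1 : ℝ) + 1) : ℝ) : ℂ) ^ (-z)‖ * C := by
          exact mul_le_mul (mul_le_mul_of_nonneg_right (rpow_k_le hq.1 hq.2 μ i) (norm_nonneg _)) hC'
            (l1_nonneg _) (mul_nonneg (mul_nonneg (Real.rpow_pos_of_pos hq.1 _).le hp'.le)
              (norm_nonneg _))
      _ = _ := by ring
  refine Summable.of_nonneg_of_le (fun i => l1_nonneg _) hB ?_
  have hB0 : ∀ n, 0 ≤ B n := fun n =>
    mul_nonneg (mul_nonneg hC0 (Real.rpow_pos_of_pos hq.1 _).le) (norm_nonneg _)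
  rw [summable_sigma_of_nonneg fun i => hB0 i.1]
  refine ⟨fun n => (hasSum_fintype _).summable, ?_⟩
  have hg := (growth_succ_mul_rpow hq.1 (-(2 * |μ|))).summable hq.1 hq.2 (z := z) (by linarith)
  refine (hg.norm.mul_left (2 * (C * q ^ (-|μ|)))).congr fun n => ?_
  have e : ∑' p : Fin (2 * n + 2), B (Sigma.fst (⟨n, p⟩ : Idx)) = ((2 * n + 2 : ℕ) : ℝ) * B n := by
    rw [tsum_fintype]
    simp
  rw [e]
  have hn : (0 : ℝ) ≤ (n : ℝ) + 1 := by positivity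
  simp only [B]
  simp only [Complex.ofReal_mul, norm_mul]
  rw [Complex.norm_real ((n : ℝ) + 1), Real.norm_eq_abs, abs_of_nonneg hn]
  push_cast
  ring

/-- The absolutely convergent trace is summed first over `k` at fixed `l`, where `|D|` is constant.
-/
theorem zeta_eq_qseries {q : ℝ} (hq : 0 < q ∧ q < 1) (s : ℤˣ) (μ : ℝ) (a : Sphere q) {z : ℂ}
    (hz : 2 * |μ| < z.re) :
    zeta q hq s μ a z = qseries q (wsum q μ (diagCoef q hq s a)) z := by
  have hs : Summable fun i : Idx => zetaOp q hq s μ a z (Finsupp.single i 1) i :=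
    Summable.of_norm_bounded (summable_zetaOp hq s μ a hz) fun i => norm_apply_le_l1 _ i
  rw [zeta, trace, hs.tsum_sigma, qseries]
  refine tsum_congr fun n => ?_
  rw [tsum_fintype, wsum, Finset.sum_mul]
  refine Finset.sum_congr rfl fun p _ => ?_
  rw [zetaOp_single, Finsupp.smul_apply, smul_eq_mul, diagCoef]
  ring

theorem differentiableOn_zeta {q : ℝ} (hq : 0 < q ∧ q < 1) (s : ℤˣ) (μ : ℝ) (a : Sphere q) :
    DifferentiableOn ℂ (zeta q hq s μ a) {z : ℂ | 2 * |μ| < z.re} := by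
  have h := (growth_diagCoef hq s μ a).differentiableOn hq.1 hq.2
  rw [neg_neg] at h
  exact h.congr fun z hz => zeta_eq_qseries hq s μ a hz

theorem zeta_add {q : ℝ} (hq : 0 < q ∧ q < 1) (s : ℤˣ) (μ : ℝ) (a b : Sphere q) {z : ℂ}
    (hz : 2 * |μ| < z.re) :
    zeta q hq s μ (a + b) z = zeta q hq s μ a z + zeta q hq s μ b z := by
  rw [zeta_eq_qseries hq s μ _ hz, zeta_eq_qseries hq s μ _ hz, zeta_eq_qseries hq s μ _ hz,
    diagCoef_add, wsum_add]
  exact (growth_diagCoef hq s μ a).qseries_add hq.1 hq.2 (growth_diagCoef hq s μ b) (by linarith)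

theorem zeta_smul {q : ℝ} (hq : 0 < q ∧ q < 1) (s : ℤˣ) (μ : ℝ) (c : ℂ) (a : Sphere q) {z : ℂ}
    (hz : 2 * |μ| < z.re) : zeta q hq s μ (c • a) z = c * zeta q hq s μ a z := by
  rw [zeta_eq_qseries hq s μ _ hz, zeta_eq_qseries hq s μ _ hz, diagCoef_smul, wsum_smul,
    qseries_const_mul]

theorem continues_monoB {q : ℝ} (hq : 0 < q ∧ q < 1) (s : ℤˣ) (μ : ℝ) (n m : ℕ) (hm : 0 < m) :
    Continues (2 * |μ|) (zeta q hq s μ (genA q ^ n * genB q ^ m)) 0 :=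
  continues_zero fun z hz => by
    have e : diagCoef q hq s (genA q ^ n * genB q ^ m) = fun _ => 0 :=
      funext (diag_monoB hq s n m hm)
    rw [zeta_eq_qseries hq s μ _ hz, qseries, e]
    simp [wsum]

theorem continues_monoBs {q : ℝ} (hq : 0 < q ∧ q < 1) (s : ℤˣ) (μ : ℝ) (n m : ℕ) (hm : 0 < m) :
    Continues (2 * |μ|) (zeta q hq s μ (genA q ^ n * genBs q ^ m)) 0 :=
  continues_zero fun z hz => by
    have e : diagCoef q hq s (genA q ^ n * genBs q ^ m) = fun _ => 0 :=
      funext (diag_monoBs hq s n m hm)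
    rw [zeta_eq_qseries hq s μ _ hz, qseries, e]
    simp [wsum]

/-- The diagonal coefficients of the leading part of `A^N`. -/
def leadCoef (q : ℝ) (N : ℕ) (i : Idx) : ℂ := (((q ^ (i.2 : ℕ)) ^ 2 : ℝ) : ℂ) ^ N

/-- With `p = l + k` one has `2μk + 2Np = 2(N + μ)p - μ(2n + 1)`, so the sum over `k` is geometric.
-/
theorem wsum_leadCoef {q : ℝ} (h0 : 0 < q) (μ : ℝ) (N n : ℕ) :
    wsum q μ (leadCoef q N) n = ((q ^ (-μ) * q ^ (-(2 * μ) * n) *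
      ∑ p ∈ Finset.range (2 * n + 2), (q ^ (2 * (N + μ))) ^ p : ℝ) : ℂ) := by
  rw [wsum, ← Fin.sum_univ_eq_sum_range (fun p => (q ^ (2 * (N + μ))) ^ p) (2 * n + 2),
    Finset.mul_sum, Complex.ofReal_sum]
  refine Finset.sum_congr rfl fun p _ => ?_
  rw [leadCoef, ← Complex.ofReal_pow, ← Complex.ofReal_mul]
  congr 1
  simp only [← Real.rpow_natCast, ← Real.rpow_mul h0.le, ← Real.rpow_add h0, Idx.k, Idx.l]
  congr 1
  push_cast
  ring

/-- The zeta function of `A^N` is, up to terms that do not matter for the residue, the series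
of its leading part. -/
theorem continues_genA_pow {q : ℝ} (hq : 0 < q ∧ q < 1) (s : ℤˣ) (μ : ℝ) (N : ℕ) {w : ℂ}
    (h : Continues (2 * |μ|) (qseries q (wsum q μ (leadCoef q N))) w) :
    Continues (2 * |μ|) (zeta q hq s μ (genA q ^ N)) w := by
  obtain ⟨C, hC0, hC⟩ := diag_genA_pow hq s N
  -- Here `ν = 1` is the gain `qⁿ` from `diag_genA_pow`; it gives exactly the exponent `1 - 2|μ|`
  -- that `Growth.continues` asks for.
  have he := growth_wsum hq.1 hq.2 μ 1 (d := fun i => diagCoef q hq s (genA q ^ N) i -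
    leadCoef q N i) hC0 fun i => by
      rw [one_mul, Real.rpow_natCast]
      exact hC i
  have hl : Growth q (-(2 * |μ|)) (wsum q μ (leadCoef q N)) := by
    have := growth_wsum hq.1 hq.2 μ 0 (d := leadCoef q N) zero_le_one fun i => by
      rw [zero_mul, Real.rpow_zero, mul_one]
      exact norm_leadA_le hq.1 hq.2 N i
    rwa [zero_sub] at this
  have := h.add (he.continues hq.1 hq.2) (H := zeta q hq s μ (genA q ^ N)) fun z hz => by
    rw [zeta_eq_qseries hq s μ _ hz, ← hl.qseries_add hq.1 hq.2 (he.mono hq.1 hq.2 (by linarith))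
      (by linarith), ← wsum_add]
    congr 2
    funext i
    simp
  rwa [add_zero] at this

/-- The geometric sum splits into its two ends, `q^{-2μn}` and `q^{(2μ+4N)n}`. Each contributes a
residue exactly when its exponent is the critical `-2|μ|`. -/
theorem continues_lead {q : ℝ} (h0 : 0 < q) (h1 : q < 1) (μ : ℝ) (N : ℕ) (hN : N + μ ≠ 0) :
    Continues (2 * |μ|) (qseries q (wsum q μ (leadCoef q N)))
      (((q ^ (-μ) / (1 - q ^ (2 * (N + μ))) : ℝ) : ℂ) *
        (if -(2 * μ) = -(2 * |μ|) then -(pre q (2 * |μ| : ℝ) / Real.log q) else 0) +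
      ((-(q ^ (-μ + 4 * (N + μ)) / (1 - q ^ (2 * (N + μ)))) : ℝ) : ℂ) *
        (if 2 * μ + 4 * N = -(2 * |μ|) then -(pre q (2 * |μ| : ℝ) / Real.log q) else 0)) := by
  have hμ := le_abs_self μ
  have hμ' := neg_abs_le μ
  have hN0 : (0 : ℝ) ≤ N := N.cast_nonneg
  have hθ1 : -(2 * |μ|) ≤ -(2 * μ) := by linarith
  have hθ2 : -(2 * |μ|) ≤ 2 * μ + 4 * N := by linarith
  have hne : q ^ (2 * (N + μ)) ≠ 1 := by
    intro h
    have := congrArg Real.log h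
    rw [Real.log_rpow h0, Real.log_one] at this
    rcases mul_eq_zero.1 this with h' | h'
    · exact hN (by linarith)
    · exact (Real.log_neg h0 h1).ne h'
  have hne' : 1 - q ^ (2 * (N + μ)) ≠ 0 := sub_ne_zero.2 hne.symm
  have e : wsum q μ (leadCoef q N) =
      (fun n : ℕ => ((q ^ (-μ) / (1 - q ^ (2 * (N + μ))) : ℝ) : ℂ) *
        ((q ^ (-(2 * μ) * n) : ℝ) : ℂ)) +
      (fun n : ℕ => ((-(q ^ (-μ + 4 * (N + μ)) / (1 - q ^ (2 * (N + μ)))) : ℝ) : ℂ) *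
        ((q ^ ((2 * μ + 4 * N) * n) : ℝ) : ℂ)) := by
    funext n
    rw [wsum_leadCoef h0, Pi.add_apply, ← Complex.ofReal_mul, ← Complex.ofReal_mul,
      ← Complex.ofReal_add, geom_sum_eq hne]
    congr 1
    have e2 : q ^ (-μ + 4 * (N + μ)) * q ^ ((2 * μ + 4 * N) * n) =
        q ^ (-μ) * q ^ (-(2 * μ) * n) * (q ^ (2 * (N + μ))) ^ (2 * n + 2) := by
      simp only [← Real.rpow_natCast, ← Real.rpow_mul h0.le, ← Real.rpow_add h0]
      congr 1
      push_cast
      ring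
    have hne2 : q ^ (2 * (N + μ)) - 1 ≠ 0 := sub_ne_zero.2 hne
    have e3 : -(q ^ (-μ + 4 * (N + μ)) / (1 - q ^ (2 * (N + μ)))) * q ^ ((2 * μ + 4 * N) * n) =
        -((q ^ (-μ + 4 * (N + μ)) * q ^ ((2 * μ + 4 * N) * n)) / (1 - q ^ (2 * (N + μ)))) := by
      ring
    rw [e3, e2, ← neg_sub 1 (q ^ (2 * (N + μ)))]
    field_simp
    ring
  rw [e]
  have g1 := ((growth_rpow h0 (-(2 * μ))).mono h0 h1 hθ1).const_mul
    ((q ^ (-μ) / (1 - q ^ (2 * (N + μ))) : ℝ) : ℂ)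
  have g2 := ((growth_rpow h0 (2 * μ + 4 * N)).mono h0 h1 hθ2).const_mul
    ((-(q ^ (-μ + 4 * (N + μ)) / (1 - q ^ (2 * (N + μ)))) : ℝ) : ℂ)
  refine Continues.add ((continues_rpow h0 h1 hθ1).const_mul _ fun _ _ => qseries_const_mul _ _ _ _)
    ((continues_rpow h0 h1 hθ2).const_mul _ fun _ _ => qseries_const_mul _ _ _ _) fun z hz => ?_
  exact g1.qseries_add h0 h1 g2 (by linarith)

theorem wsum_leadCoef_of_eq {q : ℝ} (h0 : 0 < q) (μ : ℝ) (N n : ℕ) (hN : N + μ = 0) :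
    wsum q μ (leadCoef q N) n = ((2 * q ^ (-μ) : ℝ) : ℂ) *
      ((((n : ℝ) + 1) * q ^ (-(2 * μ) * n) : ℝ) : ℂ) := by
  rw [wsum_leadCoef h0, hN, mul_zero, Real.rpow_zero]
  simp only [one_pow, Finset.sum_const, Finset.card_range, nsmul_eq_mul, mul_one]
  push_cast
  ring

/-- All terms of the sum are equal, and the coefficients are of size `(n+1) q^{2Nn}`. As `|μ| = N ≥
1`, the exponent `2N` exceeds `1 - 2|μ|`, so there is no pole. -/
theorem continues_lead_of_eq {q : ℝ} (h0 : 0 < q) (h1 : q < 1) (μ : ℝ) (N : ℕ) (hN : N + μ = 0)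
    (hN0 : 0 < N) : Continues (2 * |μ|) (qseries q (wsum q μ (leadCoef q N))) 0 := by
  rw [funext fun n => wsum_leadCoef_of_eq h0 μ N n hN]
  refine (((growth_succ_mul_rpow h0 _).const_mul _).mono h0 h1 ?_).continues h0 h1
  have : (1 : ℝ) ≤ N := by exact_mod_cast hN0
  rw [abs_of_nonpos (by linarith)]
  linarith

theorem continues_lead_zero {q : ℝ} (h0 : 0 < q) (h1 : q < 1) :
    Continues (2 * |0|) (qseries q (wsum q 0 (leadCoef q 0)))
      (2 * (Real.log (q⁻¹ - q) / (Real.log q : ℂ) ^ 2)) := by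
  rw [funext fun n => wsum_leadCoef_of_eq h0 0 0 n (by simp), abs_zero, mul_zero]
  simp only [neg_zero, Real.rpow_zero, mul_one]
  exact (continues_succ h0 h1).const_mul 2 fun z _ => by
    rw [← qseries_const_mul]
    push_cast
    rfl

theorem pre_ofReal {q : ℝ} (h0 : 0 < q) (h1 : q < 1) (x : ℝ) :
    pre q x = ((q ^ x * (q⁻¹ - q) ^ x : ℝ) : ℂ) := by
  rw [pre, Real.rpow_def_of_pos h0, Real.rpow_def_of_pos (inv_sub_pos h0 h1), ← Real.exp_add,
    Complex.ofReal_exp]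
  congr 1
  push_cast
  ring

/-! ### The residues -/

theorem one_sub_rpow_ne {q : ℝ} (h0 : 0 < q) (h1 : q < 1) {x : ℝ} (hx : 0 < x) : 1 - q ^ x ≠ 0 := by
  have := Real.rpow_lt_one h0.le h1 hx
  linarith

/-- Continuability with some residue passes to linear combinations, so the monomials decide.
Uniqueness of the residue then makes the chosen value linear in `a`. -/
theorem exists_continues {q : ℝ} (hq : 0 < q ∧ q < 1) (s : ℤˣ) (μ : ℝ) (a : Sphere q) :
    ∃ w, Continues (2 * |μ|) (zeta q hq s μ a) w := by
  induction a using mono_induction hq.1 with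
  | hA N =>
    by_cases hN : (N : ℝ) + μ = 0
    · rcases N.eq_zero_or_pos with rfl | hN0
      · obtain rfl : μ = 0 := by simpa using hN
        exact ⟨_, continues_genA_pow hq s 0 0 (continues_lead_zero hq.1 hq.2)⟩
      · exact ⟨_, continues_genA_pow hq s μ N (continues_lead_of_eq hq.1 hq.2 μ N hN hN0)⟩
    · exact ⟨_, continues_genA_pow hq s μ N (continues_lead hq.1 hq.2 μ N hN)⟩
  | hB n m hm => exact ⟨_, continues_monoB hq s μ n m hm⟩
  | hBs n m hm => exact ⟨_, continues_monoBs hq s μ n m hm⟩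
  | hadd x y hx hy =>
    obtain ⟨w, hw⟩ := hx
    obtain ⟨w', hw'⟩ := hy
    exact ⟨_, hw.add hw' fun z hz => zeta_add hq s μ x y hz⟩
  | hsmul c x hx =>
    obtain ⟨w, hw⟩ := hx
    exact ⟨_, hw.const_mul c fun z hz => zeta_smul hq s μ c x hz⟩

/-- The residue of `ζ^±_{a K^{2μ}}` at `2|μ|`, as a linear functional of `a`. -/
def residue (q : ℝ) (hq : 0 < q ∧ q < 1) (μ : ℝ) (s : ℤˣ) : Sphere q →ₗ[ℂ] ℂ where
  toFun a := (exists_continues hq s μ a).choose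
  map_add' a b := (exists_continues hq s μ (a + b)).choose_spec.unique
    ((exists_continues hq s μ a).choose_spec.add (exists_continues hq s μ b).choose_spec
      fun z hz => zeta_add hq s μ a b hz)
  map_smul' c a := (exists_continues hq s μ (c • a)).choose_spec.unique
    ((exists_continues hq s μ a).choose_spec.const_mul c fun z hz => zeta_smul hq s μ c a hz)

theorem continues_residue {q : ℝ} (hq : 0 < q ∧ q < 1) (μ : ℝ) (s : ℤˣ) (a : Sphere q) :
    Continues (2 * |μ|) (zeta q hq s μ a) (residue q hq μ s a) :=
  (exists_continues hq s μ a).choose_spec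

theorem residue_eq {q : ℝ} {hq : 0 < q ∧ q < 1} {μ : ℝ} {s : ℤˣ} {a : Sphere q} {w : ℂ}
    (h : Continues (2 * |μ|) (zeta q hq s μ a) w) : residue q hq μ s a = w :=
  (continues_residue hq μ s a).unique h

theorem residue_monoB {q : ℝ} (hq : 0 < q ∧ q < 1) (μ : ℝ) (s : ℤˣ) (n m : ℕ) (hm : 0 < m) :
    residue q hq μ s (genA q ^ n * genB q ^ m) = 0 :=
  residue_eq (continues_monoB hq s μ n m hm)

theorem residue_monoBs {q : ℝ} (hq : 0 < q ∧ q < 1) (μ : ℝ) (s : ℤˣ) (n m : ℕ) (hm : 0 < m) :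
    residue q hq μ s (genA q ^ n * genBs q ^ m) = 0 :=
  residue_eq (continues_monoBs hq s μ n m hm)

theorem residue_genA_pow_of_neg {q : ℝ} (hq : 0 < q ∧ q < 1) {μ : ℝ} (hμ : μ < 0) (s : ℤˣ) (N : ℕ)
    (hN : 0 < N) : residue q hq μ s (genA q ^ N) = 0 := by
  refine residue_eq (continues_genA_pow hq s μ N ?_)
  by_cases h : (N : ℝ) + μ = 0
  · exact continues_lead_of_eq hq.1 hq.2 μ N h hN
  · have hN' : (0 : ℝ) < N := by exact_mod_cast hN
    have := continues_lead hq.1 hq.2 μ N h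
    rwa [if_neg, if_neg, mul_zero, mul_zero, add_zero] at this
    · rw [abs_of_neg hμ]
      intro h'
      linarith
    · rw [abs_of_neg hμ]
      intro h'
      linarith

/-- Only the end `p = 0` of the geometric sum reaches the critical exponent. The condition `0 < N +
μ` admits `N = 0` when `μ > 0`, which covers `a = 1`. -/
theorem residue_genA_pow_of_nonneg {q : ℝ} (hq : 0 < q ∧ q < 1) {μ : ℝ} (hμ : 0 ≤ μ) (s : ℤˣ)
    (N : ℕ) (hN : 0 < (N : ℝ) + μ) : residue q hq μ s (genA q ^ N) =
      ((-(q ^ μ * (q⁻¹ - q) ^ (2 * μ)) / ((1 - q ^ (2 * ((N : ℝ) + μ))) * Real.log q) : ℝ) : ℂ) := by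
  have hN0 : (0 : ℝ) ≤ N := N.cast_nonneg
  have h := residue_eq (continues_genA_pow hq s μ N (continues_lead hq.1 hq.2 μ N hN.ne'))
  rw [abs_of_nonneg hμ, if_pos rfl, if_neg (by intro h'; linarith), mul_zero, add_zero,
    pre_ofReal hq.1 hq.2] at h
  rw [h, ← Complex.ofReal_div, ← Complex.ofReal_neg, ← Complex.ofReal_mul]
  congr 1
  have e : q ^ (-μ) * q ^ (2 * μ) = q ^ μ := by
    rw [← Real.rpow_add hq.1]
    congr 1
    ring
  have := one_sub_rpow_ne hq.1 hq.2 (show 0 < 2 * ((N : ℝ) + μ) by linarith)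
  have := (Real.log_neg hq.1 hq.2).ne
  rw [← e]
  field_simp

/-- Now the other end, `p = 2n + 1`, is critical. Multiplying through by powers of `q^μ` brings its
contribution to the form symmetric in `±μ`. -/
theorem residue_one_of_neg {q : ℝ} (hq : 0 < q ∧ q < 1) {μ : ℝ} (hμ : μ < 0) (s : ℤˣ) :
    residue q hq μ s 1 =
      ((-(q ^ |μ| * (q⁻¹ - q) ^ (2 * |μ|)) / ((1 - q ^ (2 * |μ|)) * Real.log q) : ℝ) : ℂ) := by
  have h := residue_eq (continues_genA_pow hq s μ 0 (continues_lead hq.1 hq.2 μ 0 (by simpa using hμ.ne)))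
  rw [abs_of_neg hμ, if_neg (by intro h'; linarith), if_pos (by push_cast; ring), mul_zero,
    zero_add, pre_ofReal hq.1 hq.2, pow_zero] at h
  rw [h, abs_of_neg hμ, ← Complex.ofReal_div, ← Complex.ofReal_neg, ← Complex.ofReal_mul]
  congr 1
  rw [Nat.cast_zero, zero_add]
  have e1 : q ^ (-μ + 4 * μ) * q ^ (2 * -μ) = q ^ μ := by
    rw [← Real.rpow_add hq.1]
    congr 1
    ring
  have e2 : q ^ (2 * -μ) = (q ^ μ)⁻¹ ^ 2 := by
    rw [← Real.rpow_neg hq.1.le, ← Real.rpow_natCast, ← Real.rpow_mul hq.1.le]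
    congr 1
    push_cast
    ring
  have e3 : q ^ (2 * μ) = (q ^ μ) ^ 2 := by
    rw [← Real.rpow_natCast, ← Real.rpow_mul hq.1.le]
    congr 1
    push_cast
    ring
  have h1 := one_sub_rpow_ne hq.1 hq.2 (show 0 < 2 * -μ by linarith)
  have hL := (Real.log_neg hq.1 hq.2).ne
  have hp := Real.rpow_pos_of_pos hq.1 μ
  have e4 : -(q ^ (-μ + 4 * μ) / (1 - q ^ (2 * μ))) *
      -(q ^ (2 * -μ) * (q⁻¹ - q) ^ (2 * -μ) / Real.log q) =
      (q ^ (-μ + 4 * μ) * q ^ (2 * -μ)) / (1 - q ^ (2 * μ)) * (q⁻¹ - q) ^ (2 * -μ) / Real.log q := by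
    ring
  rw [e4, e1, e2, e3, Real.rpow_neg hq.1.le]
  rw [e2] at h1
  generalize q ^ μ = t at *
  have h2 : t ^ 2 - 1 ≠ 0 := by
    intro h
    apply h1
    field_simp
    linarith
  have h2' : 1 - t ^ 2 ≠ 0 := by
    intro h
    apply h2
    linarith
  field_simp
  ring

theorem residue_one_of_pos {q : ℝ} (hq : 0 < q ∧ q < 1) {μ : ℝ} (hμ : 0 < μ) (s : ℤˣ) :
    residue q hq μ s 1 =
      ((-(q ^ |μ| * (q⁻¹ - q) ^ (2 * |μ|)) / ((1 - q ^ (2 * |μ|)) * Real.log q) : ℝ) : ℂ) := by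
  have := residue_genA_pow_of_nonneg hq hμ.le s 0 (by simpa using hμ)
  rw [pow_zero, Nat.cast_zero, zero_add] at this
  rw [this, abs_of_pos hμ]

theorem residue_one_of_ne {q : ℝ} (hq : 0 < q ∧ q < 1) {μ : ℝ} (hμ : μ ≠ 0) (s : ℤˣ) :
    residue q hq μ s 1 =
      ((-(q ^ |μ| * (q⁻¹ - q) ^ (2 * |μ|)) / ((1 - q ^ (2 * |μ|)) * Real.log q) : ℝ) : ℂ) :=
  hμ.lt_or_gt.elim (fun h => residue_one_of_neg hq h s) fun h => residue_one_of_pos hq h s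

theorem residue_one_of_zero {q : ℝ} (hq : 0 < q ∧ q < 1) (s : ℤˣ) :
    residue q hq 0 s 1 = ((2 * Real.log (q⁻¹ - q) / Real.log q ^ 2 : ℝ) : ℂ) := by
  have h := residue_eq (continues_genA_pow hq s 0 0 (continues_lead_zero hq.1 hq.2))
  rw [pow_zero] at h
  rw [h]
  push_cast
  ring

theorem residue_one_sign {q : ℝ} (hq : 0 < q ∧ q < 1) (μ : ℝ) (s s' : ℤˣ) :
    residue q hq μ s 1 = residue q hq μ s' 1 := by
  by_cases h : μ = 0
  · subst h
    rw [residue_one_of_zero, residue_one_of_zero]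
  · rw [residue_one_of_ne hq h, residue_one_of_ne hq h]

theorem residue_sign {q : ℝ} (hq : 0 < q ∧ q < 1) (μ : ℝ) (s s' : ℤˣ) :
    residue q hq μ s = residue q hq μ s' := by
  refine LinearMap.ext fun a => ?_
  induction a using mono_induction hq.1 with
  | hA N =>
    rcases N.eq_zero_or_pos with rfl | hN
    · rw [pow_zero]
      exact residue_one_sign hq μ s s'
    · rcases lt_or_ge μ 0 with h | h
      · rw [residue_genA_pow_of_neg hq h _ N hN, residue_genA_pow_of_neg hq h _ N hN]
      · have : 0 < (N : ℝ) + μ := add_pos_of_pos_of_nonneg (by exact_mod_cast hN) h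
        rw [residue_genA_pow_of_nonneg hq h _ N this, residue_genA_pow_of_nonneg hq h _ N this]
  | hB n m hm => rw [residue_monoB hq μ _ n m hm, residue_monoB hq μ _ n m hm]
  | hBs n m hm => rw [residue_monoBs hq μ _ n m hm, residue_monoBs hq μ _ n m hm]
  | hadd x y hx hy => rw [map_add, map_add, hx, hy]
  | hsmul c x hx => rw [map_smul, map_smul, hx]

/-- The exceptional case is the vanishing of `log (q⁻¹ - q)` in the double-pole residue at `μ = 0`.
-/
theorem residue_one_ne_zero {q : ℝ} (hq : 0 < q ∧ q < 1) {μ : ℝ} (h : μ ≠ 0 ∨ q⁻¹ - q ≠ 1)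
    (s : ℤˣ) : residue q hq μ s 1 ≠ 0 := by
  have hL := (Real.log_neg hq.1 hq.2).ne
  have hk := inv_sub_pos hq.1 hq.2
  by_cases hμ : μ = 0
  · subst hμ
    rw [residue_one_of_zero]
    have h1 := h.resolve_left (not_not.2 rfl)
    have h2 : Real.log (q⁻¹ - q) ≠ 0 := Real.log_ne_zero_of_pos_of_ne_one hk h1
    exact_mod_cast div_ne_zero (mul_ne_zero two_ne_zero h2) (pow_ne_zero 2 hL)
  · rw [residue_one_of_ne hq hμ]
    have h1 := one_sub_rpow_ne hq.1 hq.2 (show 0 < 2 * |μ| from mul_pos two_pos (abs_pos.2 hμ))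
    have h2 := (Real.rpow_pos_of_pos hq.1 |μ|).ne'
    have h3 := (Real.rpow_pos_of_pos hk (2 * |μ|)).ne'
    exact_mod_cast div_ne_zero (neg_ne_zero.2 (mul_ne_zero h2 h3)) (mul_ne_zero h1 hL)

/-! ### The normalised residue -/

/-- The normalised residue; both signs give the same. -/
def normRes (q : ℝ) (hq : 0 < q ∧ q < 1) (μ : ℝ) : Sphere q →ₗ[ℂ] ℂ :=
  (residue q hq μ 1 1)⁻¹ • residue q hq μ 1

theorem normRes_apply {q : ℝ} (hq : 0 < q ∧ q < 1) (μ : ℝ) (a : Sphere q) :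
    normRes q hq μ a = (residue q hq μ 1 1)⁻¹ * residue q hq μ 1 a := rfl

theorem normRes_eq {q : ℝ} (hq : 0 < q ∧ q < 1) (μ : ℝ) (a : Sphere q) :
    normRes q hq μ a = (residue q hq μ 1 a + residue q hq μ (-1) a) /
      (residue q hq μ 1 1 + residue q hq μ (-1) 1) := by
  rw [residue_sign hq μ (-1) 1, ← two_mul, ← two_mul, mul_div_mul_left _ _ two_ne_zero,
    normRes_apply, div_eq_inv_mul]

theorem normRes_one {q : ℝ} (hq : 0 < q ∧ q < 1) {μ : ℝ} (h : μ ≠ 0 ∨ q⁻¹ - q ≠ 1) :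
    normRes q hq μ 1 = 1 := by
  rw [normRes_apply, inv_mul_cancel₀ (residue_one_ne_zero hq h 1)]

theorem normRes_monoB {q : ℝ} (hq : 0 < q ∧ q < 1) (μ : ℝ) (n m : ℕ) (hm : 0 < m) :
    normRes q hq μ (genA q ^ n * genB q ^ m) = 0 := by
  rw [normRes_apply, residue_monoB hq μ 1 n m hm, mul_zero]

theorem normRes_monoBs {q : ℝ} (hq : 0 < q ∧ q < 1) (μ : ℝ) (n m : ℕ) (hm : 0 < m) :
    normRes q hq μ (genA q ^ n * genBs q ^ m) = 0 := by
  rw [normRes_apply, residue_monoBs hq μ 1 n m hm, mul_zero]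

theorem normRes_eq_counit {q : ℝ} (hq : 0 < q ∧ q < 1) {μ : ℝ} (hμ : μ < 0) :
    normRes q hq μ = (counit q).toLinearMap := by
  have cA : counit q (genA q) = 0 := by simp [counit]
  have cB : counit q (genB q) = 0 := by simp [counit]
  have cBs : counit q (genBs q) = 0 := by simp [counit]
  refine LinearMap.ext fun a => ?_
  rw [AlgHom.toLinearMap_apply]
  induction a using mono_induction hq.1 with
  | hA N =>
    rcases N.eq_zero_or_pos with rfl | hN
    · rw [pow_zero, normRes_one hq (Or.inl hμ.ne), map_one]
    · rw [normRes_apply, residue_genA_pow_of_neg hq hμ 1 N hN, mul_zero, map_pow, cA,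
        zero_pow hN.ne']
  | hB n m hm => rw [normRes_monoB hq μ n m hm, map_mul, map_pow, map_pow, cB, zero_pow hm.ne', mul_zero]
  | hBs n m hm =>
    rw [normRes_monoBs hq μ n m hm, map_mul, map_pow, map_pow, cBs, zero_pow hm.ne', mul_zero]
  | hadd x y hx hy => rw [map_add, map_add, hx, hy]
  | hsmul c x hx => rw [map_smul, map_smul, hx]

/-- Multiplying the residue of `A^N` by `1 - q^{2μ} q^{2N}` clears its only `N`-dependent factor, as
`twisted_trace` with `y = q^{2μ}` demands. -/
theorem normRes_twisted {q : ℝ} (hq : 0 < q ∧ q < 1) {μ : ℝ} (hμ : 0 ≤ μ)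
    (hy : ((q ^ (2 * μ) : ℝ) : ℂ) ≠ 0) (a b : Sphere q) :
    normRes q hq μ (a * b) = normRes q hq μ (scale q ((q ^ (2 * μ) : ℝ) : ℂ) hy b * a) := by
  refine twisted_trace hq.1 _ hy _ (normRes_monoB hq μ) (normRes_monoBs hq μ) (fun n => ?_) a b
  have key : ∀ N : ℕ, 0 < N → (1 - ((q ^ (2 * μ) : ℝ) : ℂ) * (q : ℂ) ^ (2 * N)) *
      residue q hq μ 1 (genA q ^ N) =
      ((-(q ^ μ * (q⁻¹ - q) ^ (2 * μ)) / Real.log q : ℝ) : ℂ) := by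
    intro N hN
    have hp : 0 < (N : ℝ) + μ := add_pos_of_pos_of_nonneg (by exact_mod_cast hN) hμ
    rw [residue_genA_pow_of_nonneg hq hμ 1 N hp]
    have h1 := one_sub_rpow_ne hq.1 hq.2 (show 0 < 2 * ((N : ℝ) + μ) by linarith)
    have hL := (Real.log_neg hq.1 hq.2).ne
    have e : q ^ (2 * μ) * q ^ (2 * N) = q ^ (2 * ((N : ℝ) + μ)) := by
      rw [← Real.rpow_natCast, ← Real.rpow_add hq.1]
      congr 1
      push_cast
      ring
    rw [← Complex.ofReal_pow, ← Complex.ofReal_mul, ← Complex.ofReal_one, ← Complex.ofReal_sub,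
      ← Complex.ofReal_mul, e]
    congr 1
    field_simp
  rw [normRes_apply, normRes_apply, mul_left_comm, key _ n.succ_pos, mul_left_comm,
    key _ (n + 1).succ_pos]

theorem normRes_genA_pow_of_pos {q : ℝ} (hq : 0 < q ∧ q < 1) {μ : ℝ} (hμ : 0 < μ) (n : ℕ)
    (hn : 0 < n) : normRes q hq μ (genA q ^ n) =
      (((1 - q ^ (2 * μ)) / (1 - q ^ (2 * ((n : ℝ) + μ))) : ℝ) : ℂ) := by
  have hp : 0 < (n : ℝ) + μ := add_pos_of_pos_of_nonneg (by exact_mod_cast hn) hμ.le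
  rw [normRes_apply, residue_genA_pow_of_nonneg hq hμ.le 1 n hp, residue_one_of_pos hq hμ,
    abs_of_pos hμ, ← Complex.ofReal_inv, ← Complex.ofReal_mul]
  congr 1
  have h1 := one_sub_rpow_ne hq.1 hq.2 (show 0 < 2 * ((n : ℝ) + μ) by linarith)
  have h2 := one_sub_rpow_ne hq.1 hq.2 (show 0 < 2 * μ by linarith)
  have h3 := (Real.rpow_pos_of_pos hq.1 μ).ne'
  have h4 := (Real.rpow_pos_of_pos (inv_sub_pos hq.1 hq.2) (2 * μ)).ne'
  have hL := (Real.log_neg hq.1 hq.2).ne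
  generalize (q⁻¹ - q) ^ (2 * μ) = κ at *
  field_simp

theorem normRes_genA_pow_of_zero {q : ℝ} (hq : 0 < q ∧ q < 1) (h : q⁻¹ - q ≠ 1) (n : ℕ)
    (hn : 0 < n) : normRes q hq 0 (genA q ^ n) =
      ((-Real.log q / (2 * (1 - q ^ (2 * n)) * Real.log (q⁻¹ - q)) : ℝ) : ℂ) := by
  have hp : 0 < (n : ℝ) + 0 := by simpa using hn
  rw [normRes_apply, residue_genA_pow_of_nonneg hq le_rfl 1 n hp, residue_one_of_zero,
    ← Complex.ofReal_inv, ← Complex.ofReal_mul]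
  congr 1
  have e : q ^ (2 * ((n : ℝ) + 0)) = q ^ (2 * n) := by
    rw [← Real.rpow_natCast]
    congr 1
    push_cast
    ring
  have h1 := one_sub_rpow_ne hq.1 hq.2 (show 0 < 2 * ((n : ℝ) + 0) by linarith)
  rw [e] at h1 ⊢
  have hL := (Real.log_neg hq.1 hq.2).ne
  have h2 : Real.log (q⁻¹ - q) ≠ 0 :=
    Real.log_ne_zero_of_pos_of_ne_one (inv_sub_pos hq.1 hq.2) h
  rw [mul_zero, Real.rpow_zero, Real.rpow_zero]
  generalize Real.log (q⁻¹ - q) = κ at *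
  field_simp

end Podles

end

theorem proposition3p4 (q : ℝ) (hq : 0 < q ∧ q < 1) (μ : ℝ) :
    -- the operators are of trace class for `Re z > 2|μ|`, and their traces are holomorphic there
    (∀ (s : ℤˣ) (a : Podles.Sphere q) (z : ℂ), 2 * |μ| < z.re →
      Podles.HasTraceClassClosure (Podles.zetaOp q hq s μ a z)) ∧
    (∀ (s : ℤˣ) (a : Podles.Sphere q),
      DifferentiableOn ℂ (Podles.zeta q hq s μ a) {z : ℂ | 2 * |μ| < z.re}) ∧
    -- meromorphic continuation to `Re z > 2|μ| - 1`
    (∀ (s : ℤˣ) (a : Podles.Sphere q), ∃ f : ℂ → ℂ,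
      Podles.IsMeromorphicContinuation (Podles.zeta q hq s μ a) (2 * |μ|) (2 * |μ| - 1) f) ∧
    -- `ρ s a` is the residue of the zeta function at `z = 2|μ|`
    ∃ ρ : ℤˣ → Podles.Sphere q →ₗ[ℂ] ℂ,
      (∀ (s : ℤˣ) (a : Podles.Sphere q) (f : ℂ → ℂ),
        Podles.IsMeromorphicContinuation (Podles.zeta q hq s μ a) (2 * |μ|) (2 * |μ| - 1) f →
          Podles.HasResidue f ((2 * |μ| : ℝ) : ℂ) (ρ s a)) ∧
      -- the table of residues
      (∀ (s : ℤˣ) (n m : ℕ), 0 < m → ρ s (Podles.genA q ^ n * Podles.genB q ^ m) = 0) ∧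
      (∀ (s : ℤˣ) (n m : ℕ), 0 < m → ρ s (Podles.genA q ^ n * Podles.genBs q ^ m) = 0) ∧
      (μ < 0 → ∀ (s : ℤˣ) (n : ℕ), 0 < n → ρ s (Podles.genA q ^ n) = 0) ∧
      (0 ≤ μ → ∀ (s : ℤˣ) (n : ℕ), 0 < n → ρ s (Podles.genA q ^ n) =
        ((-(q ^ μ * (q⁻¹ - q) ^ (2 * μ)) /
          ((1 - q ^ (2 * ((n : ℝ) + μ))) * Real.log q) : ℝ) : ℂ)) ∧
      (μ ≠ 0 → ∀ s : ℤˣ, ρ s 1 =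
        ((-(q ^ |μ| * (q⁻¹ - q) ^ (2 * |μ|)) /
          ((1 - q ^ (2 * |μ|)) * Real.log q) : ℝ) : ℂ)) ∧
      (μ = 0 → ∀ s : ℤˣ, ρ s 1 = ((2 * Real.log (q⁻¹ - q) / Real.log q ^ 2 : ℝ) : ℂ)) ∧
      -- the normalised residues of `tr_H = tr_{H_+} + tr_{H_-}`; the normalising factor vanishes
      -- only for `μ = 0` and `q⁻¹ - q = 1`
      (μ ≠ 0 ∨ q⁻¹ - q ≠ 1 →
        ρ 1 1 + ρ (-1) 1 ≠ 0 ∧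
        ∃ τ : Podles.Sphere q →ₗ[ℂ] ℂ,
          (∀ a, τ a = (ρ 1 a + ρ (-1) a) / (ρ 1 1 + ρ (-1) 1)) ∧
          (μ < 0 → τ = (Podles.counit q).toLinearMap ∧
            ∀ (σ : Podles.Sphere q ≃ₐ[ℂ] Podles.Sphere q) (a b : Podles.Sphere q),
              τ (a * b) = τ (σ b * a)) ∧
          (0 ≤ μ → ∃ σ : Podles.Sphere q ≃ₐ[ℂ] Podles.Sphere q,
            σ (Podles.genA q) = Podles.genA q ∧
            σ (Podles.genB q) = ((q ^ (2 * μ) : ℝ) : ℂ) • Podles.genB q ∧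
            σ (Podles.genBs q) = ((q ^ (-(2 * μ)) : ℝ) : ℂ) • Podles.genBs q ∧
            ∀ a b : Podles.Sphere q, τ (a * b) = τ (σ b * a)) ∧
          τ 1 = 1 ∧
          (∀ n m : ℕ, 0 < m → τ (Podles.genA q ^ n * Podles.genB q ^ m) = 0) ∧
          (∀ n m : ℕ, 0 < m → τ (Podles.genA q ^ n * Podles.genBs q ^ m) = 0) ∧
          (0 < μ → ∀ n : ℕ, 0 < n → τ (Podles.genA q ^ n) =
            (((1 - q ^ (2 * μ)) / (1 - q ^ (2 * ((n : ℝ) + μ))) : ℝ) : ℂ)) ∧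
          (μ = 0 → ∀ n : ℕ, 0 < n → τ (Podles.genA q ^ n) =
            ((-Real.log q / (2 * (1 - q ^ (2 * n)) * Real.log (q⁻¹ - q)) : ℝ) : ℂ))) := by
  refine ⟨fun s a z hz => Podles.hasTraceClassClosure_of_summable _
      (Podles.summable_zetaOp hq s μ a hz),
    fun s a => Podles.differentiableOn_zeta hq s μ a, fun s a => ?_, Podles.residue q hq μ,
    fun s a f hf => (Podles.continues_residue hq μ s a).hasResidue hf,
    Podles.residue_monoB hq μ, Podles.residue_monoBs hq μ,
    fun hμ s n hn => Podles.residue_genA_pow_of_neg hq hμ s n hn, fun hμ s n hn => ?_,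
    fun hμ s => Podles.residue_one_of_ne hq hμ s, fun hμ s => ?_, fun h => ⟨?_, ?_⟩⟩
  · obtain ⟨f, _, hf, _⟩ := Podles.continues_residue hq μ s a
    exact ⟨f, hf⟩
  · exact Podles.residue_genA_pow_of_nonneg hq hμ s n
      (add_pos_of_pos_of_nonneg (by exact_mod_cast hn) hμ)
  · subst hμ
    exact Podles.residue_one_of_zero hq s
  · rw [Podles.residue_sign hq μ (-1) 1, ← two_mul]
    exact mul_ne_zero two_ne_zero (Podles.residue_one_ne_zero hq h 1)
  · have hy : ((q ^ (2 * μ) : ℝ) : ℂ) ≠ 0 := by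
      exact_mod_cast (Real.rpow_pos_of_pos hq.1 (2 * μ)).ne'
    refine ⟨Podles.normRes q hq μ, Podles.normRes_eq hq μ, fun hμ => ?_, fun hμ => ?_,
      Podles.normRes_one hq h, Podles.normRes_monoB hq μ, Podles.normRes_monoBs hq μ,
      fun hμ n hn => Podles.normRes_genA_pow_of_pos hq hμ n hn, fun hμ n hn => ?_⟩
    · refine ⟨Podles.normRes_eq_counit hq hμ, fun σ a b => ?_⟩
      -- A character takes commuting values and is invariant under `σ`, so every automorphism
      -- qualifies as a twist.
      rw [Podles.normRes_eq_counit hq hμ, AlgHom.toLinearMap_apply, AlgHom.toLinearMap_apply,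
        map_mul, map_mul, Podles.counit_comp hq.1 hq.2, mul_comm]
    · refine ⟨Podles.scale q _ hy, Podles.scale_genA q _ hy, Podles.scale_genB q _ hy, ?_,
        Podles.normRes_twisted hq hμ hy⟩
      rw [Podles.scale_genBs, Real.rpow_neg hq.1.le, Complex.ofReal_inv]
    · subst hμ
      exact Podles.normRes_genA_pow_of_zero hq (h.resolve_left (not_not.2 rfl)) n hn
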